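/- **Definitions.** A *bichromatic set* is a finite set $S=R\cup B$ of points of the plane with rational coordinates, with $R$ (the red points) and $B$ (the blue points) disjoint. An *axis-aligned box* is a bounded set $[a,b]\times[c,d]$ with $a<b$, $c<d$; an *axis-aligned half-strip* is a closed axis-aligned box with non-empty interior that is unbounded in exactly one of the four axis-aligned directions. A region *covers* a point if the point lies in its interior. A *class cover* of $S$ by boxes (by half-strips) is a finite set $Z$ of boxes (of half-strips) such that every red point is covered by some member of $Z$ and no member of $Z$ covers a blue point. Boxes Class Cover (BCC) asks for a class cover of $S$ by boxes of minimum cardinality; the half-strip variant asks for a class cover by half-strips of minimum cardinality, for those $S$ that have one. $S$ is *in general position* if no three of its points are collinear. A minimization problem can be *approximated in polynomial time within a factor $\rho$* if there is a Turing machine that, on every admissible instance (numbers written in binary), halts after a number of steps polynomial in the input length and outputs a feasible solution whose cardinality is at most $\rho$ times the minimum. **Theorem.** Let $\varepsilon>0$ be a real number and $d\ge 0$ an integer. If BCC can be approximated in polynomial time within the factor $1+\varepsilon$, then Vertex Cover on simple undirected graphs of maximum degree at most $d$ can be approximated in polynomial time within the factor $1+(d+1)\varepsilon$. The same conclusion holds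 if the hypothesis on BCC is replaced by any one of the following: * BCC restricted to bichromatic sets in general position can be approximated in polynomial time within the factor $1+\varepsilon$; * the half-strip variant can be approximated in polynomial time within the factor $1+\varepsilon$; * the half-strip variant restricted to bichromatic sets in general position can be approximated in polynomial time within the factor $1+\varepsilon$. -/

import Mathlib

namespace ClassCover

open Computability (Γ' encodeNat decode_encodeNat)

/-! ### Polynomial time search problems (Mathlib's multi-stack Turing machines) -/

/-- An instance `a : α` is handed to the machine as the string `enc a`; `Good a w` says that the
string `w` is an acceptable answer. The problem is solvable in polynomial time if some function
producing acceptable answers is computed by a Turing machine in time polynomial in the length of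
`enc a`. -/
def SolvableInPolyTime {α : Type} (enc : α → List Γ') (Good : α → List Γ' → Prop) : Prop :=
  ∃ f : α → List Γ',
    Nonempty (Turing.TM2ComputableInPolyTime enc (id : List Γ' → List Γ') f) ∧
      ∀ a, Good a (f a)

/-! ### Encodings -/

/-- Natural numbers are written in binary. -/
def encNat (n : ℕ) : List Γ' := (encodeNat n).map Γ'.bit

/-- A rational number in lowest terms, `[sign |num| , den]`, numbers in binary
(the sign bit is `true` for negative numbers). -/
def encRat (q : ℚ) : List Γ' :=
  [Γ'.bra, Γ'.bit (decide (q < 0))] ++ encNat q.num.natAbs ++ [Γ'.comma] ++ encNat q.den ++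
    [Γ'.ket]

/-- A bracketed list of already encoded items. -/
def encList {α : Type} (e : α → List Γ') (l : List α) : List Γ' :=
  [Γ'.bra] ++ l.flatMap e ++ [Γ'.ket]

/-- A point with rational coordinates. -/
def encPoint (p : ℚ × ℚ) : List Γ' := [Γ'.bra] ++ encRat p.1 ++ encRat p.2 ++ [Γ'.ket]

/-! ### Bichromatic point sets, boxes and class covers -/

/-- A finite bichromatic set `S = R ∪ B` of points in the plane with rational coordinates, given by
a listing without repetitions of the red points and one of the blue points. -/
structure BichromaticSet where
  red : List (ℚ × ℚ)
  blue : List (ℚ × ℚ)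
  red_nodup : red.Nodup
  blue_nodup : blue.Nodup
  disjoint : red.Disjoint blue

/-- The point of the real plane with the given rational coordinates. -/
def toPlane (p : ℚ × ℚ) : ℝ × ℝ := ((p.1 : ℝ), (p.2 : ℝ))

/-- The set `R` of red points. -/
def BichromaticSet.R (S : BichromaticSet) : Set (ℝ × ℝ) := {x | ∃ p ∈ S.red, toPlane p = x}

/-- The set `B` of blue points. -/
def BichromaticSet.B (S : BichromaticSet) : Set (ℝ × ℝ) := {x | ∃ p ∈ S.blue, toPlane p = x}

/-- The string representing a bichromatic point set: its red points, then its blue points. -/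
def BichromaticSet.enc (S : BichromaticSet) : List Γ' :=
  encList encPoint S.red ++ encList encPoint S.blue

/-- General position: no three (distinct) points of `S` are collinear. -/
def BichromaticSet.GeneralPosition (S : BichromaticSet) : Prop :=
  ∀ x ∈ S.R ∪ S.B, ∀ y ∈ S.R ∪ S.B, ∀ z ∈ S.R ∪ S.B,
    x ≠ y → x ≠ z → y ≠ z → ¬ Collinear ℝ ({x, y, z} : Set (ℝ × ℝ))

/-- Bounded closed axis-aligned boxes with non-empty interior. -/
def boxes : Set (Set (ℝ × ℝ)) :=
  {K | ∃ a b c d : ℝ, a < b ∧ c < d ∧ K = Set.Icc a b ×ˢ Set.Icc c d}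

/-- Closed axis-aligned half-strips with non-empty interior: boxes which are unbounded in exactly
one of the four axis-aligned directions. -/
def halfStrips : Set (Set (ℝ × ℝ)) :=
  {K | ∃ a b c : ℝ, a < b ∧
    (K = Set.Icc a b ×ˢ Set.Ici c ∨ K = Set.Icc a b ×ˢ Set.Iic c ∨
      K = Set.Ici c ×ˢ Set.Icc a b ∨ K = Set.Iic c ×ˢ Set.Icc a b)}

/-- `Z` is a class cover of `S` by regions from the class `𝒦`: every red point is covered by some
member of `Z` and no member of `Z` covers a blue point. A region covers a point if the point lies
in its interior. -/
structure IsClassCover (𝒦 : Set (Set (ℝ × ℝ))) (S : BichromaticSet) (Z : Set (Set (ℝ × ℝ))) :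
    Prop where
  finite : Z.Finite
  subset : Z ⊆ 𝒦
  covers_red : ∀ p ∈ S.R, ∃ K ∈ Z, p ∈ interior K
  avoids_blue : ∀ K ∈ Z, ∀ p ∈ S.B, p ∉ interior K

/-- A description of a closed, possibly unbounded axis-aligned box by its rational sides; `none`
stands for a missing side, that is, for a direction in which the box is unbounded. -/
structure BoxCode where
  left : Option ℚ
  right : Option ℚ
  bottom : Option ℚ
  top : Option ℚ

/-- The region of the plane described by a code. -/
def BoxCode.region (K : BoxCode) : Set (ℝ × ℝ) :=
  {x | (∀ q ∈ K.left, (q : ℝ) ≤ x.1) ∧ (∀ q ∈ K.right, x.1 ≤ (q : ℝ)) ∧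
    (∀ q ∈ K.bottom, (q : ℝ) ≤ x.2) ∧ (∀ q ∈ K.top, x.2 ≤ (q : ℝ))}

/-- A missing side is written as a single blank. -/
def encSide : Option ℚ → List Γ'
  | none => [Γ'.blank]
  | some q => encRat q

/-- The string representing a box code. -/
def BoxCode.enc (K : BoxCode) : List Γ' :=
  [Γ'.bra] ++ encSide K.left ++ encSide K.right ++ encSide K.bottom ++ encSide K.top ++ [Γ'.ket]

/-- The set of regions described by a list of codes. -/
def regions (L : List BoxCode) : Set (Set (ℝ × ℝ)) := {K | ∃ c ∈ L, c.region = K}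

/-- The minimum class cover problem with regions from `𝒦`, restricted to the bichromatic point sets
satisfying `P` that have a class cover at all, can be approximated in polynomial time within the
factor `ρ`: the answer describes a class cover `Z` with at most `ρ` times as many members as any
class cover. -/
def ClassCoverApproximable (𝒦 : Set (Set (ℝ × ℝ))) (P : BichromaticSet → Prop) (ρ : ℝ) : Prop :=
  SolvableInPolyTime
    (fun S : {S : BichromaticSet // P S ∧ ∃ Z, IsClassCover 𝒦 S Z} => S.1.enc)
    (fun S w => ∃ L : List BoxCode, w = encList BoxCode.enc L ∧
      IsClassCover 𝒦 S.1 (regions L) ∧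
      ∀ Z, IsClassCover 𝒦 S.1 Z → ((regions L).ncard : ℝ) ≤ ρ * (Z.ncard : ℝ))

/-! ### Vertex Cover on graphs of bounded degree -/

/-- A finite simple undirected graph, with vertices `0, …, n - 1`. -/
structure FinGraph where
  n : ℕ
  graph : SimpleGraph (Fin n)

open scoped Classical in
/-- A subset of `{0, …, n - 1}` is written as its characteristic vector. -/
noncomputable def encSubset {n : ℕ} (C : Set (Fin n)) : List Γ' :=
  (List.finRange n).map fun i => Γ'.bit (decide (i ∈ C))

/-- A graph is written as its adjacency matrix, row by row, each row followed by a comma. -/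
noncomputable def FinGraph.enc (G : FinGraph) : List Γ' :=
  (List.finRange G.n).flatMap fun i => encSubset (G.graph.neighborSet i) ++ [Γ'.comma]

/-- Every vertex has at most `d` neighbours. -/
def FinGraph.MaxDegreeLE (G : FinGraph) (d : ℕ) : Prop :=
  ∀ v, (G.graph.neighborSet v).ncard ≤ d

/-- Minimum Vertex Cover on graphs of maximum degree at most `d` can be approximated in polynomial
time within the factor `ρ`. -/
def VertexCoverApproximable (d : ℕ) (ρ : ℝ) : Prop :=
  SolvableInPolyTime
    (fun G : {G : FinGraph // G.MaxDegreeLE d} => G.1.enc)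
    (fun G w => ∃ C : Set (Fin G.1.n), w = encSubset C ∧ G.1.graph.IsVertexCover C ∧
      ∀ C' : Set (Fin G.1.n), G.1.graph.IsVertexCover C' → (C.ncard : ℝ) ≤ ρ * (C'.ncard : ℝ))

/-! ### The encodings are faithful: different objects have different encodings -/

/-- An encoding whose end can be recognised while reading from the left. -/
def SelfDelimiting {α : Type} (e : α → List Γ') : Prop :=
  ∀ a b s t, e a ++ s = e b ++ t → a = b ∧ s = t

theorem map_bit_append_inj {u v : List Bool} {c : Γ'} (hc : ∀ b, c ≠ Γ'.bit b) {s t : List Γ'}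
    (h : u.map Γ'.bit ++ c :: s = v.map Γ'.bit ++ c :: t) : u = v ∧ s = t := by
  induction u generalizing v with
  | nil =>
    cases v with
    | nil => simpa using h
    | cons b v => simp [hc] at h
  | cons a u ih =>
    cases v with
    | nil => exact absurd (by simpa using (List.cons.inj h).1.symm) (hc a)
    | cons b v =>
      simp only [List.map_cons, List.cons_append, List.cons.injEq, Γ'.bit.injEq] at h
      obtain ⟨rfl, h1⟩ := h
      obtain ⟨rfl, h2⟩ := ih h1
      exact ⟨rfl, h2⟩

theorem encNat_append_inj {m n : ℕ} {c : Γ'} (hc : ∀ b, c ≠ Γ'.bit b) {s t : List Γ'}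
    (h : encNat m ++ c :: s = encNat n ++ c :: t) : m = n ∧ s = t := by
  obtain ⟨h1, h2⟩ := map_bit_append_inj hc h
  refine ⟨?_, h2⟩
  rw [← decode_encodeNat m, h1, decode_encodeNat]

theorem encRat_selfDelimiting : SelfDelimiting encRat := by
  intro a b s t h
  simp only [encRat, List.append_assoc, List.cons_append, List.nil_append, List.cons.injEq,
    Γ'.bit.injEq, true_and] at h
  obtain ⟨hs, h⟩ := h
  obtain ⟨h1, h⟩ := encNat_append_inj (by simp) h
  obtain ⟨h2, h⟩ := encNat_append_inj (by simp) h
  refine ⟨Rat.ext ?_ h2, h⟩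
  have hs' : a < 0 ↔ b < 0 := by simpa using hs
  rw [← Rat.num_neg, ← Rat.num_neg] at hs'
  omega

theorem encPoint_selfDelimiting : SelfDelimiting encPoint := by
  intro a b s t h
  simp only [encPoint, List.append_assoc, List.cons_append, List.nil_append, List.cons.injEq,
    true_and] at h
  obtain ⟨h1, h⟩ := encRat_selfDelimiting _ _ _ _ h
  obtain ⟨h2, h⟩ := encRat_selfDelimiting _ _ _ _ h
  exact ⟨Prod.ext h1 h2, (List.cons.inj h).2⟩

theorem encSide_selfDelimiting : SelfDelimiting encSide := by
  intro a b s t h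
  cases a with
  | none =>
    cases b with
    | none => simpa [encSide] using h
    | some q => simp [encSide, encRat] at h
  | some p =>
    cases b with
    | none => simp [encSide, encRat] at h
    | some q =>
      obtain ⟨h1, h2⟩ := encRat_selfDelimiting _ _ _ _ h
      exact ⟨congrArg some h1, h2⟩

theorem BoxCode.enc_selfDelimiting : SelfDelimiting BoxCode.enc := by
  rintro ⟨a1, a2, a3, a4⟩ ⟨b1, b2, b3, b4⟩ s t h
  simp only [BoxCode.enc, List.append_assoc, List.cons_append, List.nil_append, List.cons.injEq,
    true_and] at h
  obtain ⟨rfl, h1⟩ := encSide_selfDelimiting _ _ _ _ h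
  obtain ⟨rfl, h2⟩ := encSide_selfDelimiting _ _ _ _ h1
  obtain ⟨rfl, h3⟩ := encSide_selfDelimiting _ _ _ _ h2
  obtain ⟨rfl, h4⟩ := encSide_selfDelimiting _ _ _ _ h3
  exact ⟨rfl, (List.cons.inj h4).2⟩

theorem encList_selfDelimiting {α : Type} {e : α → List Γ'} (he : SelfDelimiting e)
    (hb : ∀ a, ∃ w, e a = Γ'.bra :: w) : SelfDelimiting (encList e) := by
  intro l l' s t h
  simp only [encList, List.append_assoc, List.cons_append, List.nil_append, List.cons.injEq,
    true_and] at h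
  induction l generalizing l' with
  | nil =>
    cases l' with
    | nil => simpa using h
    | cons b l' => obtain ⟨w, hw⟩ := hb b; simp [hw] at h
  | cons a l ih =>
    cases l' with
    | nil => obtain ⟨w, hw⟩ := hb a; simp [hw] at h
    | cons b l' =>
      simp only [List.flatMap_cons, List.append_assoc] at h
      obtain ⟨rfl, h1⟩ := he _ _ _ _ h
      obtain ⟨rfl, h2⟩ := ih _ h1
      exact ⟨rfl, h2⟩

theorem BichromaticSet.enc_injective : Function.Injective BichromaticSet.enc := by
  have hp := encList_selfDelimiting encPoint_selfDelimiting (fun p => ⟨_, rfl⟩)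
  rintro ⟨r, b, _, _, _⟩ ⟨r', b', _, _, _⟩ h
  obtain ⟨h1, h2⟩ := hp _ _ _ _ h
  obtain ⟨h3, -⟩ := hp b b' [] [] (by simpa using h2)
  simp_all

theorem encBoxList_injective : Function.Injective (encList BoxCode.enc) := fun a b h =>
  (encList_selfDelimiting BoxCode.enc_selfDelimiting (fun K => ⟨_, rfl⟩) a b [] []
    (by simpa using h)).1

theorem encSubset_injective {n : ℕ} : Function.Injective (encSubset (n := n)) := by
  intro C D h
  ext i
  simpa using List.map_inj_left.1 h i (List.mem_finRange i)

theorem FinGraph.enc_injective : Function.Injective FinGraph.enc := by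
  have hcount : ∀ G : FinGraph, G.enc.count Γ'.comma = G.n := by
    intro G
    have : ∀ C : Set (Fin G.n), (encSubset C).count Γ'.comma = 0 := fun C =>
      List.count_eq_zero.2 (by simp [encSubset])
    simp [FinGraph.enc, List.count_flatMap, Function.comp_def, this]
  rintro ⟨n, G⟩ ⟨n', G'⟩ h
  obtain rfl : n = n' := by
    have h1 := hcount ⟨n, G⟩
    rw [h, hcount] at h1
    exact h1.symm
  have key : ∀ l : List (Fin n),
      (l.flatMap fun i => encSubset (G.neighborSet i) ++ [Γ'.comma]) =
        (l.flatMap fun i => encSubset (G'.neighborSet i) ++ [Γ'.comma]) →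
      ∀ i ∈ l, G.neighborSet i = G'.neighborSet i := by
    intro l
    induction l with
    | nil => simp
    | cons a l ih =>
      intro hl
      simp only [List.flatMap_cons] at hl
      obtain ⟨h1, h2⟩ := List.append_inj hl (by simp [encSubset])
      have h3 := encSubset_injective (List.append_cancel_right h1)
      simpa [h3] using ih h2
  congr 1
  ext i j
  have := key _ h i (List.mem_finRange i)
  exact Set.ext_iff.1 this j

end ClassCover

/-! A graph with `m` edges is turned into a point set such that a vertex cover `C` yields a class
cover with at most `|C| + m` members, and every class cover with `z` members yields a vertex cover
with at most `z - m` vertices. If every degree is at most `d`, then `m ≤ d * |C'|` for each vertex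
cover `C'`. Hence a class cover within `1 + ε` of the optimum gives `|C| ≤ (1 + ε) * (|C'| + m) - m
= (1 + ε) * |C'| + ε * m ≤ (1 + (d + 1) * ε) * |C'|`.

Each edge `(i, j)`, `i < j`, gets its own column of nine points, numbered from left to right, and
each vertex `v` a block of four horizontal levels, higher for larger `v`. The red points 0 and 2
represent the ends `i` and `j`, on level 1 of their blocks; the red point 3 lies on level 3 of block
`i`. All level 1 points of a vertex fit into one horizontal strip. Point 3 can share a vertical
strip with point 0 or with point 2, but no member of a class cover contains both 0 and 2, because
the blue point 1 lies in their bounding box. So one pays one strip per edge, which also covers one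
end, and one horizontal strip per vertex to which an end is left (`exists_classCover`).

For the converse, choose a member covering point 3 of each edge, and for that edge the end which
this member misses. The blue points 4 to 8 at the right of each column isolate the red points from
later columns: a member meets point 3 of at most one edge, no member meets point 3 of one edge and
an end of another, and ends of different edges share a member only if they belong to the same
vertex. Thus the members used for the edges and those covering one missed end per chosen vertex are
all distinct, which is `card_chosen_add_length_le`.

Only box convexity of interiors and the existence of suitable strips enter, and both hold for boxes
and for half-strips (`StripClass`). All points have the form `(2 ^ a, 2 ^ b)`, with the numbers `b`
distinct multiples of a number exceeding every `a`. This forces general position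
(`gadget_generalPosition`), so one construction serves all four hypotheses.

Polynomial time is proved for actual Turing machines. Structured stack programs with an oracle
instruction are compiled into multi-stack machines (`Prog.Runs.steps`), the predicate `PT` is closed
under the usual operations and under a call of the assumed approximation algorithm (`PT.oracle`),
and both the reduction and the extraction of the vertex cover are written as functions on words
covered by these closure rules. -/

namespace ClassCover
open Computability (Γ' encodeNat decode_encodeNat)

/-! ### Structured stack programs and their compilation to multi-stack Turing machines -/

/-- Structured programs acting on stacks numbered by natural numbers. `branch r P` pops stack `r`
and continues according to the popped symbol, `loop r P` pops stack `r` until it is empty, and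
`call r r'` hands the reversed content of `r` to an oracle machine, whose reversed answer is pushed
on `r'`. -/
inductive Prog
  | skip : Prog
  | push (r : ℕ) (a : Γ') : Prog
  | seq (P Q : Prog) : Prog
  | branch (r : ℕ) (P : Option Γ' → Prog) : Prog
  | loop (r : ℕ) (P : Γ' → Prog) : Prog
  | call (r r' : ℕ) : Prog

namespace Prog

open Turing Function

/-- All stacks used by the program have numbers below `N`. -/
def Below (N : ℕ) : Prog → Prop
  | skip => True
  | push r _ => r < N
  | seq P Q => P.Below N ∧ Q.Below N
  | branch r P => r < N ∧ ∀ a, (P a).Below N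
  | loop r P => r < N ∧ ∀ a, (P a).Below N
  | call r r' => r < N ∧ r' < N

theorem Below.mono {M N : ℕ} (h : M ≤ N) {P : Prog} (hP : P.Below M) : P.Below N := by
  induction P with
  | skip => trivial
  | push r a => exact lt_of_lt_of_le hP h
  | seq P Q ihP ihQ => exact ⟨ihP hP.1, ihQ hP.2⟩
  | branch r P ih => exact ⟨hP.1.trans_le h, fun a => ih a (hP.2 a)⟩
  | loop r P ih => exact ⟨hP.1.trans_le h, fun a => ih a (hP.2 a)⟩
  | call r r' => exact ⟨hP.1.trans_le h, hP.2.trans_le h⟩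

theorem exists_below (P : Prog) : ∃ N, P.Below N := by
  induction P with
  | skip => exact ⟨0, trivial⟩
  | push r a => exact ⟨r + 1, Nat.lt_succ_self r⟩
  | seq P Q ihP ihQ =>
    obtain ⟨m, hm⟩ := ihP
    obtain ⟨n, hn⟩ := ihQ
    exact ⟨max m n, hm.mono (le_max_left _ _), hn.mono (le_max_right _ _)⟩
  | branch r P ih =>
    choose m hm using ih
    refine ⟨r + 1 + ∑ a, m a, by omega, fun a => (hm a).mono ?_⟩
    have := Finset.single_le_sum (f := m) (fun _ _ => Nat.zero_le _) (Finset.mem_univ a)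
    omega
  | loop r P ih =>
    choose m hm using ih
    refine ⟨r + 1 + ∑ a, m a, by omega, fun a => (hm a).mono ?_⟩
    have := Finset.single_le_sum (f := m) (fun _ _ => Nat.zero_le _) (Finset.mem_univ a)
    omega
  | call r r' => exact ⟨r + r' + 1, by omega, by omega⟩

/-- The oracle machine answers `w'` on input `w` after exactly `t` steps. -/
def Answers (A : TM2ComputableAux Γ' Γ') (w w' : List Γ') (t : ℕ) : Prop :=
  (flip bind A.tm.step)^[t] (some (initList A.tm (w.map A.inputAlphabet.symm))) =
    some (haltList A.tm (w'.map A.outputAlphabet.symm))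

/-- `Runs A P s s' t`: started with stacks `s`, the program `P` with oracle `A` ends with stacks
`s'` after exactly `t` steps. -/
inductive Runs (A : TM2ComputableAux Γ' Γ') :
    Prog → (ℕ → List Γ') → (ℕ → List Γ') → ℕ → Prop
  | skip (s) : Runs A skip s s 1
  | push (r a s) : Runs A (push r a) s (update s r (a :: s r)) 1
  | seq {P Q s₁ s₂ s₃ t₁ t₂} : Runs A P s₁ s₂ t₁ → Runs A Q s₂ s₃ t₂ →
      Runs A (seq P Q) s₁ s₃ (t₁ + t₂)
  | branch {r P s s' t} : Runs A (P (s r).head?) (update s r (s r).tail) s' t →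
      Runs A (branch r P) s s' (1 + t)
  | loop_nil {r P s} : s r = [] → Runs A (loop r P) s s 1
  | loop_cons {r P s s₁ s₂ a l t₁ t₂} : s r = a :: l → Runs A (P a) (update s r l) s₁ t₁ →
      Runs A (loop r P) s₁ s₂ t₂ → Runs A (loop r P) s s₂ (1 + t₁ + t₂)
  | call {r r' s w w' t} : s r = w.reverse → Answers A w w' t →
      Runs A (call r r') s
        (update (update s r []) r' (w'.reverse ++ update s r [] r'))
        (w.length + 1 + t + (w'.length + 1))

section Compile

variable (A : TM2ComputableAux Γ' Γ') (N : ℕ)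

/-- The labels of the compiled program. -/
@[reducible] def Lab : Prog → Type
  | skip => Unit
  | push _ _ => Unit
  | seq P Q => Lab P ⊕ Lab Q
  | branch _ P => Option (Σ a, Lab (P a))
  | loop _ P => Option (Σ a, Lab (P a))
  | call _ _ => Bool ⊕ A.tm.Λ

/-- The label at which the compiled program starts. -/
def entry : (P : Prog) → Lab A P
  | skip => ()
  | push _ _ => ()
  | seq P _ => Sum.inl (entry P)
  | branch _ _ => none
  | loop _ _ => none
  | call _ _ => Sum.inl false

/-- Finiteness of the set of labels. -/
@[reducible]
noncomputable def labFintype : (P : Prog) → Fintype (Lab A P)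
  | skip => inferInstanceAs (Fintype Unit)
  | push _ _ => inferInstanceAs (Fintype Unit)
  | seq P Q =>
    haveI := labFintype P
    haveI := labFintype Q
    inferInstanceAs (Fintype (Lab A P ⊕ Lab A Q))
  | branch _ P =>
    haveI := fun a => labFintype (P a)
    inferInstanceAs (Fintype (Option (Σ a, Lab A (P a))))
  | loop _ P =>
    haveI := fun a => labFintype (P a)
    inferInstanceAs (Fintype (Option (Σ a, Lab A (P a))))
  | call _ _ =>
    haveI := A.tm.ΛFin
    inferInstanceAs (Fintype (Bool ⊕ A.tm.Λ))

/-- Stack alphabets of the compiled machine: `N` stacks of its own and those of the oracle. -/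
@[reducible] def Alph : Fin N ⊕ A.tm.K → Type
  | Sum.inl _ => Γ'
  | Sum.inr k => A.tm.Γ k

/-- Internal states of the compiled machine. -/
abbrev St : Type := Option Γ' × A.tm.σ

variable {N}

/-- Statements of the oracle machine, as statements of the compiled machine. -/
def translate {Λ : Type} (lab : A.tm.Λ → Λ) (exit : Λ) :
    TM2.Stmt A.tm.Γ A.tm.Λ A.tm.σ → TM2.Stmt (Alph A N) Λ (St A)
  | .push k f q => .push (Sum.inr k) (fun v => f v.2) (translate lab exit q)
  | .peek k f q => .peek (Sum.inr k) (fun v o => (v.1, f v.2 o)) (translate lab exit q)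
  | .pop k f q => .pop (Sum.inr k) (fun v o => (v.1, f v.2 o)) (translate lab exit q)
  | .load f q => .load (fun v => (v.1, f v.2)) (translate lab exit q)
  | .branch f q₁ q₂ => .branch (fun v => f v.2) (translate lab exit q₁) (translate lab exit q₂)
  | .goto f => .goto (fun v => lab (f v.2))
  | .halt => .goto (fun _ => exit)

/-- Pop one of the `N` own stacks into the internal state. -/
def popReg {Λ : Type} (r : Fin N) (q : TM2.Stmt (Alph A N) Λ (St A)) :
    TM2.Stmt (Alph A N) Λ (St A) :=
  .pop (Sum.inl r) (fun v (o : Option Γ') => (o, v.2)) q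

/-- Push a symbol on one of the `N` own stacks. -/
def pushReg {Λ : Type} (r : Fin N) (f : St A → Γ') (q : TM2.Stmt (Alph A N) Λ (St A)) :
    TM2.Stmt (Alph A N) Λ (St A) :=
  .push (Sum.inl r) (fun v => f v) q

variable [NeZero N]

/-- The compiled program. Its labels are embedded by `emb`; it ends by jumping to `exit`. -/
def code {Λ : Type} : (P : Prog) → (Lab A P → Λ) → Λ → Lab A P → TM2.Stmt (Alph A N) Λ (St A)
  | skip, _, exit, _ => .goto fun _ => exit
  | push r a, _, exit, _ => pushReg A (Fin.ofNat N r) (fun _ => a) (.goto fun _ => exit)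
  | seq P Q, emb, _, Sum.inl l =>
    code P (fun l => emb (Sum.inl l)) (emb (Sum.inr (entry A Q))) l
  | seq _ Q, emb, exit, Sum.inr l => code Q (fun l => emb (Sum.inr l)) exit l
  | branch r P, emb, _, none =>
    popReg A (Fin.ofNat N r) (.goto fun v => emb (some ⟨v.1, entry A (P v.1)⟩))
  | branch _ P, emb, exit, some ⟨a, l⟩ => code (P a) (fun l => emb (some ⟨a, l⟩)) exit l
  | loop r P, emb, exit, none =>
    popReg A (Fin.ofNat N r) (.goto fun v =>
      match v.1 with
      | none => exit
      | some a => emb (some ⟨a, entry A (P a)⟩))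
  | loop _ P, emb, _, some ⟨a, l⟩ => code (P a) (fun l => emb (some ⟨a, l⟩)) (emb none) l
  -- An oracle call has three phases: `Sum.inl false` moves stack `r` symbol by symbol onto the
  -- oracle's input stack, `Sum.inr l` runs the oracle, `Sum.inl true` unloads its output stack.
  -- Both moves reverse the word.
  | call r _, emb, _, Sum.inl false =>
    popReg A (Fin.ofNat N r) (.branch (fun v => v.1.isSome)
      (.push (Sum.inr A.tm.k₀) (fun v => A.inputAlphabet.symm (v.1.getD Γ'.blank))
        (.goto fun _ => emb (Sum.inl false)))
      (.goto fun _ => emb (Sum.inr A.tm.main)))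
  | call _ _, emb, _, Sum.inr l =>
    translate A (fun l => emb (Sum.inr l)) (emb (Sum.inl true)) (A.tm.m l)
  | call _ r', emb, exit, Sum.inl true =>
    .pop (Sum.inr A.tm.k₁) (fun v o => (o.map A.outputAlphabet, v.2))
      (.branch (fun v => v.1.isSome)
        (pushReg A (Fin.ofNat N r') (fun v => v.1.getD Γ'.blank) (.goto fun _ => emb (Sum.inl true)))
        (.goto fun _ => exit))

end Compile

/-- Exactly `n` steps lead from one configuration to the other. -/
def Steps {K : Type} [DecidableEq K] {Γ : K → Type} {Λ σ : Type} (M : Λ → TM2.Stmt Γ Λ σ) (n : ℕ)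
    (c c' : TM2.Cfg Γ Λ σ) : Prop :=
  (flip bind (TM2.step M))^[n] (some c) = some c'

section Steps

variable {K : Type} [DecidableEq K] {Γ : K → Type} {Λ σ : Type} {M : Λ → TM2.Stmt Γ Λ σ}

theorem Steps.trans {m n : ℕ} {c₁ c₂ c₃ : TM2.Cfg Γ Λ σ} (h₁ : Steps M m c₁ c₂)
    (h₂ : Steps M n c₂ c₃) : Steps M (m + n) c₁ c₃ := by
  unfold Steps at *
  rw [add_comm, iterate_add_apply, h₁, h₂]

theorem Steps.one {l : Λ} {v : σ} {S : ∀ k, List (Γ k)} {c : TM2.Cfg Γ Λ σ} {q : TM2.Stmt Γ Λ σ}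
    (hq : M l = q) (h : TM2.stepAux q v S = c) : Steps M 1 ⟨some l, v, S⟩ c := by
  subst hq h
  rfl

theorem iterate_none (n : ℕ) : (flip bind (TM2.step M))^[n] none = none :=
  iterate_fixed rfl n

end Steps

/-! ### Simulation of structured programs by the compiled machine. -/

section Simulation

variable {A : TM2ComputableAux Γ' Γ'} {N : ℕ}

/-- The stacks of the compiled machine. -/
def stks (N : ℕ) (s : ℕ → List Γ') (T : ∀ k, List (A.tm.Γ k)) :
    ∀ k : Fin N ⊕ A.tm.K, List (Alph A N k)
  | Sum.inl k => s k
  | Sum.inr k => T k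

theorem update_stks_inr (s : ℕ → List Γ') (T : ∀ k, List (A.tm.Γ k)) (k : A.tm.K)
    (l : List (A.tm.Γ k)) :
    update (stks N s T) (Sum.inr k) l = stks N s (update T k l) := by
  funext j
  rcases j with j | j
  · rw [update_of_ne (by simp)]; rfl
  · by_cases h : j = k
    · subst h
      simp [stks]
    · rw [update_of_ne (by simpa using h)]
      simp [stks, update_of_ne h]

theorem update_stks_inl [NeZero N] (s : ℕ → List Γ') (T : ∀ k, List (A.tm.Γ k)) {r : ℕ}
    (hr : r < N) (l : List Γ') :
    update (stks (A := A) N s T) (Sum.inl (Fin.ofNat N r)) l = stks N (update s r l) T := by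
  funext j
  rcases j with j | j
  · by_cases h : j = Fin.ofNat N r
    · subst h
      simp [stks, Nat.mod_eq_of_lt hr]
    · rw [update_of_ne (by simpa using h)]
      have : (j : ℕ) ≠ r := by
        intro h'
        apply h
        ext
        simp [h', Nat.mod_eq_of_lt hr]
      simp [stks, update_of_ne this]
  · rw [update_of_ne (by simp)]; rfl

theorem stks_inl [NeZero N] (s : ℕ → List Γ') (T : ∀ k, List (A.tm.Γ k)) {r : ℕ} (hr : r < N) :
    stks (A := A) N s T (Sum.inl (Fin.ofNat N r)) = s r := by
  simp [stks, Nat.mod_eq_of_lt hr]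

/-- A configuration of the oracle machine inside the compiled machine. -/
def lift (N : ℕ) {Λ : Type} (lab : A.tm.Λ → Λ) (exit : Λ) (s : ℕ → List Γ') (v : Option Γ')
    (c : A.tm.Cfg) : TM2.Cfg (Alph A N) Λ (St A) :=
  ⟨some (c.l.elim exit lab), (v, c.var), stks N s c.stk⟩

/-- One statement of the oracle corresponds to one statement of the compiled machine: halting is
replaced by a jump to `exit` inside the same step, so no time is lost, and the stacks outside the
oracle are untouched. -/
theorem stepAux_translate {Λ : Type} (lab : A.tm.Λ → Λ) (exit : Λ) (s : ℕ → List Γ')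
    (v : Option Γ') (q : TM2.Stmt A.tm.Γ A.tm.Λ A.tm.σ) (u : A.tm.σ) (T : ∀ k, List (A.tm.Γ k)) :
    TM2.stepAux (translate (N := N) A lab exit q) (v, u) (stks N s T) =
      lift N lab exit s v (TM2.stepAux q u T) := by
  induction q generalizing u T with
  | push k f q ih => simp only [translate, TM2.stepAux, update_stks_inr, ← ih]; rfl
  | peek k f q ih => simp only [translate, TM2.stepAux, ← ih]; rfl
  | pop k f q ih => simp only [translate, TM2.stepAux, update_stks_inr, ← ih]; rfl
  | load f q ih => simp only [translate, TM2.stepAux, ← ih]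
  | branch f q₁ q₂ ih₁ ih₂ =>
    simp only [translate, TM2.stepAux]
    cases f u
    · exact ih₂ _ _
    · exact ih₁ _ _
  | goto f => rfl
  | halt => rfl

theorem steps_lift {Λ : Type} {M : Λ → TM2.Stmt (Alph A N) Λ (St A)} {lab : A.tm.Λ → Λ} {exit : Λ}
    (hM : ∀ l, M (lab l) = translate A lab exit (A.tm.m l)) (s : ℕ → List Γ') (v : Option Γ')
    {n : ℕ} {c c' : A.tm.Cfg} (h : (flip bind A.tm.step)^[n] (some c) = some c') :
    Steps M n (lift N lab exit s v c) (lift N lab exit s v c') := by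
  induction n generalizing c with
  | zero =>
    obtain rfl : c = c' := by simpa using h
    rfl
  | succ n ih =>
    rw [iterate_succ_apply] at h
    obtain ⟨l, u, T⟩ := c
    cases l with
    | none =>
      have : (flip bind A.tm.step) (some ⟨none, u, T⟩) = none := rfl
      rw [this, show (flip bind A.tm.step)^[n] none = none from iterate_none n] at h
      cases h
    | some l =>
      have h1 : (flip bind A.tm.step) (some ⟨some l, u, T⟩) = some (TM2.stepAux (A.tm.m l) u T) :=
        rfl
      rw [h1] at h
      rw [add_comm]
      exact Steps.trans (Steps.one (hM l) (stepAux_translate lab exit s v _ u T)) (ih h)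

/-- A configuration of the compiled machine while its oracle is idle. -/
def idle (N : ℕ) {Λ : Type} (l : Λ) (v : Option Γ') (s : ℕ → List Γ') :
    TM2.Cfg (Alph A N) Λ (St A) :=
  ⟨some l, (v, A.tm.initialState), stks N s fun _ => []⟩

theorem initList_stk (tm : FinTM2) (w : List (tm.Γ tm.k₀)) :
    (initList tm w).stk = update (fun _ => []) tm.k₀ w := by
  funext k
  by_cases h : k = tm.k₀
  · subst h; simp [initList]
  · simp [initList, h]

theorem haltList_stk (tm : FinTM2) (w : List (tm.Γ tm.k₁)) :
    (haltList tm w).stk = update (fun _ => []) tm.k₁ w := by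
  funext k
  by_cases h : k = tm.k₁
  · subst h; simp [haltList]
  · simp [haltList, h]

variable [NeZero N] {Λ : Type} {M : Λ → TM2.Stmt (Alph A N) Λ (St A)}

theorem steps_load_input {r r' : ℕ} {emb : Lab A (call r r') → Λ} {exit : Λ}
    (hM : ∀ l, M (emb l) = code A (call r r') emb exit l) (hr : r < N) (s : ℕ → List Γ')
    (v : Option Γ') (l : List Γ') (w : List (A.tm.Γ A.tm.k₀)) (hs : s r = l) :
    Steps M (l.length + 1)
      ⟨some (emb (Sum.inl false)), (v, A.tm.initialState),
        stks N s (update (fun _ => []) A.tm.k₀ w)⟩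
      ⟨some (emb (Sum.inr A.tm.main)), (none, A.tm.initialState),
        stks N (update s r [])
          (update (fun _ => []) A.tm.k₀ ((l.map A.inputAlphabet.symm).reverse ++ w))⟩ := by
  induction l generalizing s w v with
  | nil =>
    refine Steps.one (hM (Sum.inl false)) ?_
    simp only [code, popReg, TM2.stepAux, stks_inl _ _ hr, hs]
    simp only [List.head?_nil, Option.isSome_none, cond_false, List.tail_nil, List.map_nil,
      List.reverse_nil, List.nil_append]
    exact congrArg _ (update_stks_inl _ _ hr _)
  | cons a l ih =>
    rw [List.length_cons, add_comm (_ + 1) 1]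
    refine Steps.trans (Steps.one (hM (Sum.inl false)) (c := ⟨some (emb (Sum.inl false)), (some a, A.tm.initialState),
        stks N (update s r l) (update (fun _ => []) A.tm.k₀ (A.inputAlphabet.symm a :: w))⟩) ?_) ?_
    · simp only [code, popReg, TM2.stepAux, stks_inl _ _ hr, hs]
      simp only [List.head?_cons, Option.isSome_some, cond_true, List.tail_cons]
      congr 1
      have := update_stks_inl (A := A) s (update (fun _ => []) A.tm.k₀ w) hr l
      rw [this, update_stks_inr]
      congr 1
      simp [stks]
    · have := ih (update s r l) (some a) (A.inputAlphabet.symm a :: w) (by simp)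
      simpa using this

theorem steps_store_output {r r' : ℕ} {emb : Lab A (call r r') → Λ} {exit : Λ}
    (hM : ∀ l, M (emb l) = code A (call r r') emb exit l) (hr : r' < N) (s : ℕ → List Γ')
    (v : Option Γ') (l : List Γ') :
    Steps M (l.length + 1)
      ⟨some (emb (Sum.inl true)), (v, A.tm.initialState),
        stks N s (update (fun _ => []) A.tm.k₁ (l.map A.outputAlphabet.symm))⟩
      (idle N exit none (update s r' (l.reverse ++ s r'))) := by
  induction l generalizing s v with
  | nil =>
    refine Steps.one (hM (Sum.inl true)) ?_
    simp [code, pushReg, TM2.stepAux, stks, update_stks_inr, idle]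
  | cons a l ih =>
    rw [List.length_cons, add_comm (_ + 1) 1]
    refine Steps.trans (Steps.one (hM (Sum.inl true)) (c := ⟨some (emb (Sum.inl true)), (some a, A.tm.initialState),
        stks N (update s r' (a :: s r'))
          (update (fun _ => []) A.tm.k₁ (l.map A.outputAlphabet.symm))⟩) ?_) ?_
    · simp only [code, pushReg, TM2.stepAux]
      have h1 : stks N s (update (fun _ => []) A.tm.k₁ ((a :: l).map A.outputAlphabet.symm))
          (Sum.inr A.tm.k₁) = (a :: l).map A.outputAlphabet.symm := by simp [stks]
      rw [h1]
      simp only [List.map_cons, List.head?_cons, Option.map_some, Option.isSome_some, cond_true,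
        List.tail_cons, Option.getD_some, Equiv.apply_symm_apply]
      rw [update_stks_inr, stks_inl _ _ hr, update_idem]
      exact congrArg _ (update_stks_inl _ _ hr _)
    · have := ih (update s r' (a :: s r')) (some a)
      simpa using this

/-- Induction on the run, with label embedding and exit arbitrary, so that the induction hypotheses
apply to subprograms with their own exits. The register holding the last popped symbol is left
unspecified on both sides because every later pop overwrites it before it is inspected. -/
theorem Runs.steps {P : Prog} {s s' : ℕ → List Γ'} {t : ℕ} (h : Runs A P s s' t)
    (hN : P.Below N) {emb : Lab A P → Λ} {exit : Λ} (hM : ∀ l, M (emb l) = code A P emb exit l)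
    (v : Option Γ') :
    ∃ v', Steps M t (idle N (emb (entry A P)) v s) (idle N exit v' s') := by
  induction h generalizing v exit with
  | skip s => exact ⟨v, Steps.one (hM ()) rfl⟩
  | push r a s =>
    refine ⟨v, Steps.one (hM ()) ?_⟩
    simp only [code, pushReg, TM2.stepAux, stks_inl _ _ hN]
    exact congrArg _ (update_stks_inl _ _ hN _)
  | @seq P Q s₁ s₂ s₃ t₁ t₂ _ _ ih₁ ih₂ =>
    obtain ⟨v₁, h₁⟩ := ih₁ hN.1 (emb := fun l => emb (Sum.inl l)) (exit := emb (Sum.inr (entry A Q)))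
      (fun l => hM (Sum.inl l)) v
    obtain ⟨v₂, h₂⟩ := ih₂ hN.2 (emb := fun l => emb (Sum.inr l)) (exit := exit)
      (fun l => hM (Sum.inr l)) v₁
    exact ⟨v₂, h₁.trans h₂⟩
  | @branch r P s s' t _ ih =>
    obtain ⟨v₁, h₁⟩ := ih (hN.2 _) (emb := fun l => emb (some ⟨(s r).head?, l⟩)) (exit := exit)
      (fun l => hM (some ⟨_, l⟩)) (s r).head?
    refine ⟨v₁, Steps.trans (Steps.one (hM none) ?_) h₁⟩
    simp only [code, popReg, TM2.stepAux]
    rw [stks_inl _ _ hN.1]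
    exact congrArg _ (update_stks_inl _ _ hN.1 _)
  | @loop_nil r P s hs =>
    refine ⟨none, Steps.one (hM none) ?_⟩
    simp only [code, popReg, TM2.stepAux, stks_inl _ _ hN.1, hs]
    refine congrArg _ ((update_stks_inl _ _ hN.1 _).trans ?_)
    rw [update_eq_self_iff.2 (by rw [hs, List.tail_nil])]
  | @loop_cons r P s s₁ s₂ a l t₁ t₂ hs _ _ ih₁ ih₂ =>
    obtain ⟨v₁, h₁⟩ := ih₁ (hN.2 _) (emb := fun l => emb (some ⟨a, l⟩)) (exit := emb none)
      (fun l => hM (some ⟨_, l⟩)) (some a)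
    obtain ⟨v₂, h₂⟩ := ih₂ hN hM v₁
    refine ⟨v₂, ((Steps.one (hM none) ?_).trans h₁).trans h₂⟩
    simp only [code, popReg, TM2.stepAux, stks_inl _ _ hN.1, hs]
    exact congrArg _ (update_stks_inl _ _ hN.1 _)
  -- The oracle starts and halts with its other stacks empty and in its initial internal state, so
  -- the machine is idle again afterwards. Loading reverses `w.reverse` into the true input `w`.
  | @call r r' s w w' t hs ht =>
    have h₁ := steps_load_input hM hN.1 s v w.reverse [] hs
    have h₂ := steps_lift (N := N) (M := M) (lab := fun l => emb (Sum.inr l))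
      (exit := emb (Sum.inl true)) (fun l => hM (Sum.inr l)) (update s r []) none ht
    have h₃ := steps_store_output hM hN.2 (update s r []) none w'
    refine ⟨none, ?_⟩
    rw [List.length_reverse] at h₁
    have e₁ : idle N (emb (entry A (Prog.call r r'))) v s = ⟨some (emb (Sum.inl false)),
        (v, A.tm.initialState), stks N s (update (fun _ => []) A.tm.k₀ [])⟩ := by
      rw [update_eq_self_iff.2 rfl]
      rfl
    have e₂ : lift N (fun l => emb (Sum.inr l)) (emb (Sum.inl true)) (update s r []) none
        (initList A.tm (w.map A.inputAlphabet.symm)) = ⟨some (emb (Sum.inr A.tm.main)),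
        (none, A.tm.initialState), stks N (update s r []) (update (fun _ => []) A.tm.k₀
          ((w.reverse.map A.inputAlphabet.symm).reverse ++ []))⟩ := by
      rw [List.map_reverse, List.reverse_reverse, List.append_nil, ← initList_stk]
      rfl
    have e₃ : lift N (fun l => emb (Sum.inr l)) (emb (Sum.inl true)) (update s r []) none
        (haltList A.tm (w'.map A.outputAlphabet.symm)) = ⟨some (emb (Sum.inl true)),
        (none, A.tm.initialState), stks N (update s r []) (update (fun _ => []) A.tm.k₁
          (w'.map A.outputAlphabet.symm))⟩ := by
      rw [← haltList_stk]
      rfl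
    rw [← e₁, ← e₂] at h₁
    rw [← e₃] at h₃
    exact (h₁.trans h₂).trans h₃

end Simulation

end Prog
end ClassCover

/-! ### Length of oracle answers and the finished machine. -/

namespace ClassCover
open Computability (Γ' encodeNat decode_encodeNat)

namespace Prog

open Turing Function

/-- The number of push instructions in a statement. -/
def pushes {K : Type} {Γ : K → Type} {Λ σ : Type} : TM2.Stmt Γ Λ σ → ℕ
  | .push _ _ q => pushes q + 1
  | .peek _ _ q => pushes q
  | .pop _ _ q => pushes q
  | .load _ q => pushes q
  | .branch _ q₁ q₂ => pushes q₁ + pushes q₂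
  | .goto _ => 0
  | .halt => 0

theorem length_stepAux_le {K : Type} [DecidableEq K] {Γ : K → Type} {Λ σ : Type}
    (q : TM2.Stmt Γ Λ σ) (v : σ) (S : ∀ k, List (Γ k)) (k : K) :
    ((TM2.stepAux q v S).stk k).length ≤ (S k).length + pushes q := by
  induction q generalizing v S with
  | push k' f q ih =>
    refine (ih _ _).trans ?_
    by_cases h : k = k'
    · subst h; simp [pushes]; omega
    · simp [update_of_ne h, pushes]
  | peek k' f q ih => exact ih _ _
  | pop k' f q ih =>
    refine (ih _ _).trans ?_
    by_cases h : k = k'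
    · subst h; simp [pushes]
    · simp [update_of_ne h, pushes]
  | load f q ih => exact ih _ _
  | branch f q₁ q₂ ih₁ ih₂ =>
    simp only [TM2.stepAux, pushes]
    cases f v
    · exact (ih₂ _ _).trans (by omega)
    · exact (ih₁ _ _).trans (by omega)
  | goto f => simp
  | halt => simp

/-- A step executes a single statement, so it lengthens a stack by at most the total number of push
instructions of the machine. This turns a time bound for the oracle into a size bound for its
answers. -/
theorem Answers.length_le (A : TM2ComputableAux Γ' Γ') :
    ∃ c, ∀ w w' t, Answers A w w' t → w'.length ≤ w.length + t * c := by
  have := A.tm.ΛFin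
  refine ⟨∑ l, pushes (A.tm.m l), ?_⟩
  have key : ∀ n (c c' : A.tm.Cfg), (flip bind A.tm.step)^[n] (some c) = some c' → ∀ k,
      (c'.stk k).length ≤ (c.stk k).length + n * ∑ l, pushes (A.tm.m l) := by
    intro n
    induction n with
    | zero =>
      intro c c' h k
      obtain rfl : c = c' := by simpa using h
      simp
    | succ n ih =>
      rintro ⟨l, u, T⟩ c' h k
      rw [iterate_succ_apply] at h
      cases l with
      | none =>
        have : (flip bind A.tm.step) (some ⟨none, u, T⟩) = none := rfl
        rw [this, show (flip bind A.tm.step)^[n] none = none from iterate_none n] at h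
        cases h
      | some l =>
        have h1 := ih (TM2.stepAux (A.tm.m l) u T) c' h k
        have h2 := length_stepAux_le (A.tm.m l) u T k
        have h3 := Finset.single_le_sum (f := fun l => pushes (A.tm.m l))
          (fun _ _ => Nat.zero_le _) (Finset.mem_univ l)
        simp only at h3 ⊢
        rw [add_mul]
        refine h1.trans ?_
        refine (Nat.add_le_add_right h2 _).trans ?_
        omega
  intro w w' t h
  have := key t _ _ h A.tm.k₁
  rw [haltList_stk, initList_stk] at this
  simp only [update_self, List.length_map] at this
  refine this.trans (Nat.add_le_add_right ?_ _)
  -- The output stack may be the input stack, which then starts with the input; otherwise it starts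
  -- empty.
  by_cases hk : A.tm.k₁ = A.tm.k₀
  · have : ∀ k, k = A.tm.k₀ → (update (fun _ => []) A.tm.k₀
        (w.map A.inputAlphabet.symm) k : List (A.tm.Γ k)).length ≤ w.length := by
      rintro k rfl
      simp
    exact this _ hk
  · simp [update_of_ne hk]

/-- The compiled machine: input on stack `0`, output on stack `1`. -/
noncomputable def machine (A : TM2ComputableAux Γ' Γ') (P : Prog) (N : ℕ) [NeZero N] : FinTM2 where
  K := Fin N ⊕ A.tm.K
  kFin := haveI := A.tm.kFin; inferInstance
  k₀ := Sum.inl (Fin.ofNat N 0)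
  k₁ := Sum.inl (Fin.ofNat N 1)
  Γ := Alph A N
  Λ := Option (Lab A P)
  main := some (entry A P)
  ΛFin := haveI := labFintype A P; inferInstance
  σ := St A
  initialState := (none, A.tm.initialState)
  σFin := haveI := A.tm.σFin; inferInstance
  Γk₀Fin := inferInstanceAs (Fintype Γ')
  m
    | none => .load (fun _ => (none, A.tm.initialState)) .halt
    | some l => code A P some none l

theorem stks_single {A : TM2ComputableAux Γ' Γ'} {N : ℕ} [NeZero N] {r : ℕ} (hr : r < N)
    (w : List Γ') :
    stks (A := A) N (update (fun _ => []) r w) (fun _ => []) =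
      update (β := fun k => List (Alph A N k)) (fun _ => []) (Sum.inl (Fin.ofNat N r)) w := by
  have h := update_stks_inl (A := A) (fun _ => []) (fun _ => []) hr w
  rw [← h]
  congr 1
  funext k
  rcases k with k | k <;> rfl

/-- A halting configuration must have every stack empty except the output stack and the initial
internal state. The first demand is put on the program; the second is met by one extra step, which
accounts for the `p + 1`. -/
theorem computableInPolyTime {α : Type} {enc : α → List Γ'} {f : α → List Γ'}
    (A : TM2ComputableAux Γ' Γ') (P : Prog) (p : Polynomial ℕ)
    (h : ∀ a, ∃ t ≤ p.eval (enc a).length,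
      Runs A P (update (fun _ => []) 0 (enc a)) (update (fun _ => []) 1 (f a)) t) :
    Nonempty (TM2ComputableInPolyTime enc (id : List Γ' → List Γ') f) := by
  obtain ⟨N, hN⟩ := P.exists_below
  -- Two extra stacks make sure that the input stack 0 and the output stack 1 exist and differ.
  replace hN : P.Below (N + 2) := hN.mono (by omega)
  refine ⟨⟨⟨machine A P (N + 2), Equiv.refl Γ', Equiv.refl Γ'⟩, p + 1, fun a => ?_⟩⟩
  have key : ∃ t ≤ p.eval (enc a).length, (flip bind (machine A P (N + 2)).step)^[t + 1]
      (some (initList (machine A P (N + 2)) (enc a))) =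
      some (haltList (machine A P (N + 2)) (f a)) := by
    obtain ⟨t, ht, hr⟩ := h a
    refine ⟨t, ht, ?_⟩
    obtain ⟨v, hv⟩ := hr.steps (M := (machine A P (N + 2)).m) hN (emb := some) (exit := none)
      (fun _ => rfl) none
    have e₁ : initList (machine A P (N + 2)) (enc a) =
        idle (N + 2) (some (entry A P)) none (update (fun _ => []) 0 (enc a)) := by
      have h2 := initList_stk (machine A P (N + 2)) (enc a)
      unfold idle
      rw [stks_single (by omega)]
      exact congrArg (TM2.Cfg.mk (some (some (entry A P))) (none, A.tm.initialState)) h2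
    have e₂ : Steps (machine A P (N + 2)).m 1
        (idle (N + 2) none v (update (fun _ => []) 1 (f a)))
        (haltList (machine A P (N + 2)) (f a)) := by
      have h2 := haltList_stk (machine A P (N + 2)) (f a)
      refine Steps.one rfl ?_
      rw [stks_single (by omega)]
      exact congrArg (TM2.Cfg.mk none (none, A.tm.initialState)) h2.symm
    rw [e₁]
    exact hv.trans e₂
  refine Classical.choice ?_
  obtain ⟨t, ht, hk⟩ := key
  refine ⟨⟨⟨t + 1, ?_⟩, ?_⟩⟩
  · convert hk using 2
    · exact congrArg (fun w => some (initList (machine A P (N + 2)) w)) (List.map_id _)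
    · exact congrArg (fun w => some (haltList (machine A P (N + 2)) w)) (List.map_id _)
  · simpa using ht

end Prog
end ClassCover

namespace ClassCover
open Computability (Γ' encodeNat decode_encodeNat)

namespace Prog

open Turing Function

variable {A : TM2ComputableAux Γ' Γ'}

/-! ### Basic programs -/

/-- Empty a stack. -/
def clear (r : ℕ) : Prog := loop r fun _ => skip

/-- Move a stack onto another one, reversing it. -/
def move (r r' : ℕ) : Prog := loop r fun a => push r' a

/-- Move a stack onto another one, using the empty stack `c`. -/
def transfer (c r r' : ℕ) : Prog := seq (move r c) (move c r')

/-- Copy a stack onto another one, using the empty stack `c`. -/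
def copy (c r r' : ℕ) : Prog := seq (move r c) (loop c fun a => seq (push r a) (push r' a))

theorem Runs.cast {P : Prog} {s s₁ s₂ : ℕ → List Γ'} {t₁ t₂ : ℕ} (h : Runs A P s s₁ t₁)
    (hs : ∀ r, s₁ r = s₂ r) (ht : t₁ = t₂) : Runs A P s s₂ t₂ := by
  obtain rfl := funext hs
  exact ht ▸ h

theorem runs_clear (r : ℕ) (s : ℕ → List Γ') :
    Runs A (clear r) s (update s r []) (2 * (s r).length + 1) := by
  generalize hl : s r = l
  induction l generalizing s with
  | nil => exact Runs.cast (.loop_nil hl) (fun k => by by_cases h : k = r <;> simp_all) rfl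
  | cons a l ih =>
    have h := ih (update s r l) (by simp)
    exact Runs.cast (.loop_cons hl (.skip _) h) (fun k => by simp)
      (by rw [List.length_cons]; ring)

theorem runs_move {r r' : ℕ} (hr : r ≠ r') (s : ℕ → List Γ') :
    Runs A (move r r') s (update (update s r []) r' ((s r).reverse ++ s r'))
      (2 * (s r).length + 1) := by
  generalize hl : s r = l
  induction l generalizing s with
  | nil =>
    exact Runs.cast (.loop_nil hl)
      (fun k => by by_cases h : k = r <;> by_cases h' : k = r' <;> simp_all) rfl
  | cons a l ih =>
    have h := ih (update (update s r l) r' (a :: update s r l r')) (by simp [hr])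
    exact Runs.cast (.loop_cons hl (.push _ _ _) h)
      (fun k => by by_cases h : k = r <;> by_cases h' : k = r' <;> simp_all [hr.symm])
      (by rw [List.length_cons]; ring)

theorem runs_transfer {c r r' : ℕ} (hcr : c ≠ r) (hcr' : c ≠ r') (hr : r ≠ r') {s : ℕ → List Γ'}
    (hc : s c = []) :
    Runs A (transfer c r r') s (update (update s r []) r' (s r ++ s r'))
      (4 * (s r).length + 2) := by
  have h₁ := runs_move (A := A) hcr.symm s
  have h₂ := runs_move (A := A) hcr' (update (update s r []) c ((s r).reverse ++ s c))
  refine Runs.cast (.seq h₁ h₂) (fun k => ?_) (by simp [hc]; ring)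
  by_cases h1 : k = r'
  · subst h1; simp [hc, hcr'.symm, hr.symm]
  · by_cases h2 : k = c
    · subst h2; simp [h1, hcr, hc]
    · simp [h1, h2, update_apply]

theorem runs_copy {c r r' : ℕ} (hcr : c ≠ r) (hcr' : c ≠ r') (hr : r ≠ r') {s : ℕ → List Γ'}
    (hc : s c = []) :
    Runs A (copy c r r') s (update s r' (s r ++ s r')) (5 * (s r).length + 2) := by
  have h₁ := runs_move (A := A) hcr.symm s
  have key : ∀ (l : List Γ') (s : ℕ → List Γ'), s c = l →
      Runs A (loop c fun a => seq (push r a) (push r' a)) s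
        (update (update (update s c []) r (l.reverse ++ s r)) r' (l.reverse ++ s r'))
        (3 * l.length + 1) := by
    intro l
    induction l with
    | nil =>
      intro s hs
      refine Runs.cast (.loop_nil hs) (fun k => ?_) rfl
      by_cases h : k = r <;> by_cases h' : k = r' <;> by_cases h'' : k = c <;> simp_all
    | cons a l ih =>
      intro s hs
      have h := ih (update (update (update s c l) r (a :: update s c l r)) r'
        (a :: update (update s c l) r (a :: update s c l r) r')) (by simp [hcr, hcr'])
      refine Runs.cast (.loop_cons hs (.seq (.push _ _ _) (.push _ _ _)) h) (fun k => ?_)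
        (by rw [List.length_cons]; ring)
      by_cases h1 : k = r'
      · subst h1; simp [hcr'.symm, hr.symm]
      · by_cases h2 : k = r
        · subst h2; simp [h1, hcr.symm]
        · simp only [update_of_ne h1, update_of_ne h2]
          by_cases h3 : k = c
          · subst h3; simp
          · simp [h1, h2, h3]
  have h₂ := key _ (update (update s r []) c ((s r).reverse ++ s c)) rfl
  refine Runs.cast (.seq h₁ h₂) (fun k => ?_) (by simp [hc]; ring)
  by_cases h1 : k = r'
  · subst h1; simp [hc, hcr'.symm, hr.symm]
  · by_cases h2 : k = r
    · subst h2; simp [h1, hcr.symm, hc]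
    · by_cases h3 : k = c
      · subst h3; simp [h1, h2, hc]
      · simp [h1, h2, h3]

/-- Empty several stacks. -/
def clearAll : List ℕ → Prog
  | [] => skip
  | r :: rs => seq (clear r) (clearAll rs)

/-- Copy several stacks. -/
def copyAll (c : ℕ) : List ℕ → List ℕ → Prog
  | r :: rs, o :: os => seq (copy c r o) (copyAll c rs os)
  | _, _ => skip

/-- Move several stacks. -/
def transferAll (c : ℕ) : List ℕ → List ℕ → Prog
  | r :: rs, o :: os => seq (transfer c r o) (transferAll c rs os)
  | _, _ => skip

/-- Push a word on a stack, last symbol first. -/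
def write (r : ℕ) : List Γ' → Prog
  | [] => skip
  | a :: w => seq (write r w) (push r a)

/-- Write several words. -/
def writeAll : List ℕ → List (List Γ') → Prog
  | r :: rs, w :: ws => seq (write r w) (writeAll rs ws)
  | _, _ => skip

/-- Total length of a list of words. -/
def total (ws : List (List Γ')) : ℕ := (ws.map List.length).sum

@[simp] theorem total_nil : total [] = 0 := rfl

@[simp] theorem total_cons (w : List Γ') (ws : List (List Γ')) :
    total (w :: ws) = w.length + total ws := by simp [total]

@[simp] theorem total_append (v w : List (List Γ')) : total (v ++ w) = total v + total w := by
  simp [total]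

theorem runs_clearAll (rs : List ℕ) (s : ℕ → List Γ') :
    ∃ s' t, t ≤ 2 * total (rs.map s) + rs.length + 1 ∧ Runs A (clearAll rs) s s' t ∧
      (∀ r ∈ rs, s' r = []) ∧ ∀ r ∉ rs, s' r = s r := by
  induction rs generalizing s with
  | nil => exact ⟨s, 1, by simp, .skip _, by simp, by simp⟩
  | cons r rs ih =>
    obtain ⟨s', t, ht, hr, h1, h2⟩ := ih (update s r [])
    refine ⟨s', _, ?_, .seq (runs_clear r s) hr, ?_, ?_⟩
    · have : total (rs.map (update s r [])) ≤ total (rs.map s) := by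
        unfold total
        rw [List.map_map, List.map_map]
        refine List.sum_le_sum fun i _ => ?_
        by_cases h : i = r
        · subst h; simp
        · simp [h]
      simp only [List.map_cons, total_cons, List.length_cons]
      omega
    · intro q hq
      by_cases h : q ∈ rs
      · exact h1 q h
      · rw [h2 q h]
        obtain rfl : q = r := by simpa [h] using hq
        simp
    · intro q hq
      simp only [List.mem_cons, not_or] at hq
      rw [h2 q hq.2, update_of_ne hq.1]

theorem runs_copyAll {c : ℕ} (rs os : List ℕ) (hl : rs.length = os.length) (hos : os.Nodup)
    (hd : ∀ r ∈ rs, r ∉ os) (hrs : ∀ r ∈ rs, r < c) (hos' : ∀ r ∈ os, r < c) (s : ℕ → List Γ')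
    (hc : s c = []) (he : ∀ r ∈ os, s r = []) :
    ∃ s' t, t ≤ 5 * total (rs.map s) + 2 * rs.length + 1 ∧ Runs A (copyAll c rs os) s s' t ∧
      os.map s' = rs.map s ∧ ∀ r ∉ os, s' r = s r := by
  induction rs generalizing s os with
  | nil =>
    cases os with
    | cons o os => simp at hl
    | nil => exact ⟨s, 1, by simp, .skip _, by simp, by simp⟩
  | cons r rs ih =>
    cases os with
    | nil => simp at hl
    | cons o os =>
    simp only [List.mem_cons, forall_eq_or_imp, List.nodup_cons, not_or] at *
    have hrs' : ∀ q ∈ rs, update s o (s r ++ s o) q = s q := fun q hq =>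
      update_of_ne (hd.2 q hq).1 _ _
    obtain ⟨s', t, ht, hr, h1, h2⟩ := ih os (by simpa using hl) hos.2 (fun q hq => (hd.2 q hq).2)
      hrs.2 hos'.2 (update s o (s r ++ s o)) (by rw [update_of_ne hos'.1.ne']; exact hc)
      (fun q hq => by rw [update_of_ne (by rintro rfl; exact hos.1 hq)]; exact he.2 q hq)
    refine ⟨s', _, ?_, .seq (runs_copy hrs.1.ne' hos'.1.ne' hd.1.1 hc) hr, ?_, ?_⟩
    · rw [List.map_congr_left hrs'] at ht
      simp only [List.map_cons, total_cons, List.length_cons]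
      omega
    · rw [List.map_cons, List.map_cons, h1, List.map_congr_left hrs', h2 o hos.1]
      simp [he.1]
    · intro q hq
      rw [h2 q hq.2, update_of_ne hq.1]

theorem runs_transferAll {c : ℕ} (rs os : List ℕ) (hl : rs.length = os.length) (hos : os.Nodup)
    (hrn : rs.Nodup)
    (hd : ∀ r ∈ rs, r ∉ os) (hrs : ∀ r ∈ rs, r < c) (hos' : ∀ r ∈ os, r < c) (s : ℕ → List Γ')
    (hc : s c = []) (he : ∀ r ∈ os, s r = []) :
    ∃ s' t, t ≤ 4 * total (rs.map s) + 2 * rs.length + 1 ∧ Runs A (transferAll c rs os) s s' t ∧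
      os.map s' = rs.map s ∧ (∀ r ∈ rs, s' r = []) ∧ ∀ r, r ∉ os → r ∉ rs → s' r = s r := by
  induction rs generalizing s os with
  | nil =>
    cases os with
    | cons o os => simp at hl
    | nil => exact ⟨s, 1, by simp, .skip _, by simp, by simp, by simp⟩
  | cons r rs ih =>
    cases os with
    | nil => simp at hl
    | cons o os =>
    simp only [List.mem_cons, forall_eq_or_imp, List.nodup_cons, not_or] at *
    have hrs' : ∀ q ∈ rs, update (update s r []) o (s r ++ s o) q = s q := fun q hq => by
      rw [update_of_ne (hd.2 q hq).1, update_of_ne (by rintro rfl; exact hrn.1 hq)]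
    obtain ⟨s', t, ht, hr, h1, h2, h3⟩ := ih os (by simpa using hl) hos.2 hrn.2
      (fun q hq => (hd.2 q hq).2)
      hrs.2 hos'.2 (update (update s r []) o (s r ++ s o))
      (by rw [update_of_ne hos'.1.ne', update_of_ne hrs.1.ne']; exact hc)
      (fun q hq => by
        rw [update_of_ne (by rintro rfl; exact hos.1 hq),
          update_of_ne (by rintro rfl; exact hd.1.2 hq)]
        exact he.2 q hq)
    refine ⟨s', _, ?_, .seq (runs_transfer hrs.1.ne' hos'.1.ne' hd.1.1 hc) hr, ?_, ⟨?_, h2⟩, ?_⟩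
    · rw [List.map_congr_left hrs'] at ht
      simp only [List.map_cons, total_cons, List.length_cons]
      omega
    · rw [List.map_cons, List.map_cons, h1, List.map_congr_left hrs',
        h3 o hos.1 (fun h => (hd.2 o h).1 rfl)]
      simp [he.1]
    · rw [h3 r hd.1.2 hrn.1, update_of_ne hd.1.1, update_self]
    · intro q hq hq'
      rw [h3 q hq.2 hq'.2, update_of_ne hq.1, update_of_ne hq'.1]

theorem runs_write (r : ℕ) (w : List Γ') (s : ℕ → List Γ') :
    Runs A (write r w) s (update s r (w ++ s r)) (w.length + 1) := by
  induction w with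
  | nil => rw [List.nil_append, update_eq_self]; exact .skip _
  | cons a w ih =>
    exact Runs.cast (.seq ih (.push r a _)) (fun k => by simp) rfl

theorem runs_writeAll (os : List ℕ) (ws : List (List Γ')) (hl : ws.length = os.length)
    (hos : os.Nodup) (s : ℕ → List Γ') (he : ∀ r ∈ os, s r = []) :
    ∃ s' t, t ≤ total ws + ws.length + 1 ∧ Runs A (writeAll os ws) s s' t ∧
      os.map s' = ws ∧ ∀ r ∉ os, s' r = s r := by
  induction ws generalizing s os with
  | nil =>
    cases os with
    | cons o os => simp at hl
    | nil => exact ⟨s, 1, by simp, .skip _, by simp, by simp⟩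
  | cons w ws ih =>
    cases os with
    | nil => simp at hl
    | cons o os =>
    simp only [List.mem_cons, forall_eq_or_imp, List.nodup_cons, not_or] at *
    obtain ⟨s', t, ht, hr, h1, h2⟩ := ih os (by simpa using hl) hos.2 (update s o (w ++ s o))
      (fun q hq => by rw [update_of_ne (by rintro rfl; exact hos.1 hq)]; exact he.2 q hq)
    refine ⟨s', _, ?_, .seq (runs_write o w s) hr, ?_, ?_⟩
    · simp only [total_cons, List.length_cons]
      omega
    · rw [List.map_cons, h1, h2 o hos.1]
      simp [he.1]
    · intro q hq
      rw [h2 q hq.2, update_of_ne hq.1]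

end Prog
end ClassCover

namespace ClassCover
open Computability (Γ' encodeNat decode_encodeNat)

open Turing Function Prog

/-! ### Functions computable in polynomial time, on data kept in several stacks -/

/-- Data represented by a fixed number of words. -/
class Ctx (α : Type) where
  size : ℕ
  regs : α → List (List Γ')
  length_regs : ∀ x, (regs x).length = size

/-- The total length of the words representing `x`. -/
def len {α : Type} [Ctx α] (x : α) : ℕ := total (Ctx.regs x)

instance : Ctx (List Γ') := ⟨1, fun l => [l], fun _ => rfl⟩

/-- Numbers are kept in unary. Indices, lengths and exponents are polynomially bounded, so this
costs nothing essential; the binary numbers of the encodings are handled as words. -/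
instance : Ctx ℕ := ⟨1, fun n => [List.replicate n Γ'.blank], fun _ => rfl⟩

instance : Ctx Bool := ⟨1, fun b => [if b then [Γ'.blank] else []], fun _ => rfl⟩

instance {α β : Type} [Ctx α] [Ctx β] : Ctx (α × β) :=
  ⟨Ctx.size α + Ctx.size β, fun x => Ctx.regs x.1 ++ Ctx.regs x.2, fun x => by
    simp [Ctx.length_regs]⟩

@[simp] theorem len_list (l : List Γ') : len l = l.length := by simp [len, Ctx.regs]

@[simp] theorem len_nat (n : ℕ) : len n = n := by simp [len, Ctx.regs]

@[simp] theorem len_prod {α β : Type} [Ctx α] [Ctx β] (x : α × β) : len x = len x.1 + len x.2 := by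
  simp [len, Ctx.regs]

theorem len_bool_le (b : Bool) : len b ≤ 1 := by cases b <;> simp [len, Ctx.regs]

/-- Input and output stacks of a program which may use the stacks from `b` on as scratch space. -/
structure Layout (ins outs : List ℕ) (b : ℕ) : Prop where
  nodup : outs.Nodup
  disj : ∀ r ∈ ins, r ∉ outs
  ins_lt : ∀ r ∈ ins, r < b
  outs_lt : ∀ r ∈ outs, r < b

/-- `f` is computed in polynomial time by stack programs with oracle `A`, for all choices of the
input and output stacks. -/
@[fun_prop]
def PT (A : TM2ComputableAux Γ' Γ') {α β : Type} [Ctx α] [Ctx β] (f : α → β) : Prop :=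
  -- The same polynomial bounds output size and running time. Inputs survive and scratch stacks are
  -- returned empty, which makes programs freely composable.
  ∃ p : Polynomial ℕ, (∀ x, len (f x) ≤ p.eval (len x)) ∧
    ∀ (ins outs : List ℕ) (b : ℕ), ins.length = Ctx.size α → outs.length = Ctx.size β →
      Layout ins outs b → ∃ P : Prog, ∀ (s : ℕ → List Γ') (x : α), ins.map s = Ctx.regs x →
        (∀ r ∈ outs, s r = []) → (∀ r, b ≤ r → s r = []) →
        ∃ s' t, t ≤ p.eval (len x) ∧ Runs A P s s' t ∧ outs.map s' = Ctx.regs (f x) ∧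
          ∀ r ∉ outs, s' r = s r

theorem eval_mono (p : Polynomial ℕ) {m n : ℕ} (h : m ≤ n) : p.eval m ≤ p.eval n := by
  rw [Polynomial.eval_eq_sum, Polynomial.eval_eq_sum]
  exact Finset.sum_le_sum fun i _ => Nat.mul_le_mul_left _ (Nat.pow_le_pow_left h i)

theorem total_map_of_eq {α : Type} [Ctx α] {ins : List ℕ} {s : ℕ → List Γ'} {x : α}
    (h : ins.map s = Ctx.regs x) : total (ins.map s) = len x := by rw [h]; rfl

namespace PT

variable {A : TM2ComputableAux Γ' Γ'} {α β γ δ σ : Type} [Ctx α] [Ctx β] [Ctx γ] [Ctx δ] [Ctx σ]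

/-- Only the representation of the values matters. -/
theorem of_regs {f : α → β} {g : α → γ} (hf : PT A f) (hs : Ctx.size β = Ctx.size γ)
    (h : ∀ x, Ctx.regs (f x) = Ctx.regs (g x)) : PT A g := by
  obtain ⟨p, hp, hP⟩ := hf
  refine ⟨p, fun x => ?_, fun ins outs b hi ho hl => ?_⟩
  · have := hp x
    unfold len at *
    rwa [← h]
  · obtain ⟨P, hP⟩ := hP ins outs b hi (ho.trans hs.symm) hl
    refine ⟨P, fun s x => ?_⟩
    rw [← h]
    exact hP s x

@[fun_prop]
theorem id : PT A (fun x : α => x) := by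
  refine ⟨5 * .X + .C (2 * Ctx.size α + 1), fun x => ?_, fun ins outs b hi ho hl => ?_⟩
  · simp; omega
  · refine ⟨copyAll b ins outs, fun s x hx he hb => ?_⟩
    obtain ⟨s', t, ht, hr, h1, h2⟩ := runs_copyAll (A := A) ins outs (hi.trans ho.symm) hl.nodup
      hl.disj hl.ins_lt hl.outs_lt s (hb b le_rfl) he
    rw [total_map_of_eq hx, hi] at ht
    exact ⟨s', t, by simp; omega, hr, h1.trans hx, h2⟩

theorem fst : PT A (fun x : α × β => x.1) := by
  refine ⟨5 * .X + .C (2 * Ctx.size α + 1), fun x => ?_, fun ins outs b hi ho hl => ?_⟩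
  · simp; omega
  · have hi' : (ins.take (Ctx.size α)).length = Ctx.size α := by
      rw [List.length_take, hi]; exact min_eq_left (Nat.le_add_right _ _)
    refine ⟨copyAll b (ins.take (Ctx.size α)) outs, fun s x hx he hb => ?_⟩
    have hx' : (ins.take (Ctx.size α)).map s = Ctx.regs x.1 := by
      rw [List.map_take, hx]
      exact List.take_left' (Ctx.length_regs _)
    obtain ⟨s', t, ht, hr, h1, h2⟩ := runs_copyAll (A := A) (ins.take (Ctx.size α)) outs
      (hi'.trans ho.symm) hl.nodup
      (fun r h => hl.disj r (List.mem_of_mem_take h))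
      (fun r h => hl.ins_lt r (List.mem_of_mem_take h)) hl.outs_lt s (hb b le_rfl) he
    rw [total_map_of_eq hx', hi'] at ht
    exact ⟨s', t, by simp; omega, hr, h1.trans hx', h2⟩

theorem snd : PT A (fun x : α × β => x.2) := by
  refine ⟨5 * .X + .C (2 * Ctx.size β + 1), fun x => ?_, fun ins outs b hi ho hl => ?_⟩
  · simp; omega
  · have hi' : (ins.drop (Ctx.size α)).length = Ctx.size β := by
      rw [List.length_drop, hi]; exact Nat.add_sub_cancel_left _ _
    refine ⟨copyAll b (ins.drop (Ctx.size α)) outs, fun s x hx he hb => ?_⟩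
    have hx' : (ins.drop (Ctx.size α)).map s = Ctx.regs x.2 := by
      rw [List.map_drop, hx]
      exact List.drop_left' (Ctx.length_regs _)
    obtain ⟨s', t, ht, hr, h1, h2⟩ := runs_copyAll (A := A) (ins.drop (Ctx.size α)) outs
      (hi'.trans ho.symm) hl.nodup
      (fun r h => hl.disj r (List.mem_of_mem_drop h))
      (fun r h => hl.ins_lt r (List.mem_of_mem_drop h)) hl.outs_lt s (hb b le_rfl) he
    rw [total_map_of_eq hx', hi'] at ht
    exact ⟨s', t, by simp; omega, hr, h1.trans hx', h2⟩

@[fun_prop]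
theorem const (c : β) : PT A (fun _ : α => c) := by
  refine ⟨.C (len c + Ctx.size β + 1), fun x => by simp; omega, fun ins outs b hi ho hl => ?_⟩
  refine ⟨writeAll outs (Ctx.regs c), fun s x hx he hb => ?_⟩
  obtain ⟨s', t, ht, hr, h1, h2⟩ := runs_writeAll (A := A) outs (Ctx.regs c)
    ((Ctx.length_regs c).trans ho.symm) hl.nodup s he
  rw [Ctx.length_regs] at ht
  exact ⟨s', t, by simpa [len] using ht, hr, h1, h2⟩

-- The intermediate value lives in the fresh stacks from `b` to `b + k - 1`, which both programs
-- treat as ordinary stacks below the new scratch boundary `b + k`; they are cleared at the end.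
@[fun_prop]
theorem comp {f : β → γ} {g : α → β} (hf : PT A f) (hg : PT A g) : PT A (fun x => f (g x)) := by
  obtain ⟨p, hp, hP⟩ := hf
  obtain ⟨q, hq, hQ⟩ := hg
  refine ⟨q + p.comp q + 2 * q + .C (Ctx.size β + 1), fun x => ?_, fun ins outs b hi ho hl => ?_⟩
  · have := (hp (g x)).trans (eval_mono p (hq x))
    simp only [Polynomial.eval_add, Polynomial.eval_comp]
    omega
  set k := Ctx.size β with hk
  have hm : ∀ r, r ∈ List.range' b k ↔ b ≤ r ∧ r < b + k := fun r => by simp [List.mem_range'_1]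
  obtain ⟨Q, hQ⟩ := hQ ins (List.range' b k) (b + k) hi (by simp [hk])
    ⟨List.nodup_range', fun r h h' => by have := hl.ins_lt r h; rw [hm] at h'; omega,
      fun r h => by have := hl.ins_lt r h; omega, fun r h => by rw [hm] at h; omega⟩
  obtain ⟨P, hP⟩ := hP (List.range' b k) outs (b + k) (by simp [hk]) ho
    ⟨hl.nodup, fun r h h' => by have := hl.outs_lt r h'; rw [hm] at h; omega,
      fun r h => by rw [hm] at h; omega, fun r h => by have := hl.outs_lt r h; omega⟩
  refine ⟨.seq Q (.seq P (clearAll (List.range' b k))), fun s x hx he hb => ?_⟩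
  obtain ⟨s₁, t₁, ht₁, hr₁, h₁, h₁'⟩ := hQ s x hx (fun r h => hb r (by rw [hm] at h; omega))
    (fun r h => hb r (by omega))
  obtain ⟨s₂, t₂, ht₂, hr₂, h₂, h₂'⟩ := hP s₁ (g x) h₁
    (fun r h => by
      rw [h₁' r (fun h' => by have := hl.outs_lt r h; rw [hm] at h'; omega)]; exact he r h)
    (fun r h => by rw [h₁' r (fun h' => by rw [hm] at h'; omega)]; exact hb r (by omega))
  obtain ⟨s₃, t₃, ht₃, hr₃, h₃, h₃'⟩ := runs_clearAll (A := A) (List.range' b k) s₂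
  have hd : ∀ r ∈ List.range' b k, r ∉ outs := fun r h h' => by
    have := hl.outs_lt r h'; rw [hm] at h; omega
  have e : (List.range' b k).map s₂ = Ctx.regs (g x) :=
    (List.map_congr_left fun r h => h₂' r (hd r h)).trans h₁
  refine ⟨s₃, _, ?_, .seq hr₁ (.seq hr₂ hr₃), ?_, fun r hr => ?_⟩
  · rw [total_map_of_eq e, List.length_range'] at ht₃
    have h4 := hq x
    have h5 := eval_mono p h4
    simp only [Polynomial.eval_add, Polynomial.eval_comp, Polynomial.eval_mul, Polynomial.eval_C,
      Polynomial.eval_ofNat]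
    omega
  · rw [← h₂]
    exact List.map_congr_left fun r h => h₃' r fun h' => hd r h' h
  · by_cases h : r ∈ List.range' b k
    · rw [h₃ r h]
      rw [hm] at h
      exact (hb r h.1).symm
    · rw [h₃' r h, h₂' r hr, h₁' r h]

@[fun_prop]
theorem pair {f : α → β} {g : α → γ} (hf : PT A f) (hg : PT A g) :
    PT A (fun x => (f x, g x)) := by
  obtain ⟨p, hp, hP⟩ := hf
  obtain ⟨q, hq, hQ⟩ := hg
  refine ⟨p + q, fun x => ?_, fun ins outs b hi ho hl => ?_⟩
  · have := hp x
    have := hq x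
    simp only [len_prod, Polynomial.eval_add]
    omega
  have h1 : (outs.take (Ctx.size β)).length = Ctx.size β := by
    rw [List.length_take, ho]; exact min_eq_left (Nat.le_add_right _ _)
  have h2 : (outs.drop (Ctx.size β)).length = Ctx.size γ := by
    rw [List.length_drop, ho]; exact Nat.add_sub_cancel_left _ _
  obtain ⟨os, os', rfl, h1, h2⟩ : ∃ os os', outs = os ++ os' ∧ os.length = Ctx.size β ∧
      os'.length = Ctx.size γ := ⟨_, _, (List.take_append_drop _ _).symm, h1, h2⟩
  have hn := List.nodup_append'.1 hl.nodup
  obtain ⟨P, hP⟩ := hP ins os b hi h1 ⟨hn.1,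
    fun r h h' => hl.disj r h (List.mem_append_left _ h'), hl.ins_lt,
    fun r h => hl.outs_lt r (List.mem_append_left _ h)⟩
  obtain ⟨Q, hQ⟩ := hQ ins os' b hi h2 ⟨hn.2.1,
    fun r h h' => hl.disj r h (List.mem_append_right _ h'), hl.ins_lt,
    fun r h => hl.outs_lt r (List.mem_append_right _ h)⟩
  refine ⟨.seq P Q, fun s x hx he hb => ?_⟩
  obtain ⟨s₁, t₁, ht₁, hr₁, h₁, h₁'⟩ := hP s x hx (fun r h => he r (List.mem_append_left _ h)) hb
  obtain ⟨s₂, t₂, ht₂, hr₂, h₂, h₂'⟩ := hQ s₁ x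
    (by
      rw [← hx]
      exact List.map_congr_left fun r h => h₁' r fun h' => hl.disj r h (List.mem_append_left _ h'))
    (fun r h => by
      rw [h₁' r (fun h' => hn.2.2 h' h)]
      exact he r (List.mem_append_right _ h))
    (fun r h => by
      rw [h₁' r (fun h' => by have := hl.outs_lt r (List.mem_append_left _ h'); omega)]
      exact hb r h)
  refine ⟨s₂, _, ?_, .seq hr₁ hr₂, ?_, fun r hr => ?_⟩
  · simp only [Polynomial.eval_add]
    omega
  · rw [List.map_append, h₂]
    refine congrArg (· ++ _) ?_
    rw [← h₁]
    exact List.map_congr_left fun r h => h₂' r fun h' => hn.2.2 h h'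
  · simp only [List.mem_append, not_or] at hr
    rw [h₂' r hr.2, h₁' r hr.1]

@[fun_prop]
theorem push (a : Γ') {f : α → List Γ'} (hf : PT A f) : PT A (fun x => a :: f x) := by
  obtain ⟨p, hp, hP⟩ := hf
  refine ⟨p + 1, fun x => ?_, fun ins outs b hi ho hl => ?_⟩
  · simpa using hp x
  obtain ⟨o, rfl⟩ := List.length_eq_one_iff.1 ho
  obtain ⟨P, hP⟩ := hP ins [o] b hi ho hl
  refine ⟨.seq P (.push o a), fun s x hx he hb => ?_⟩
  obtain ⟨s₁, t₁, ht₁, hr₁, h₁, h₁'⟩ := hP s x hx he hb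
  refine ⟨_, _, ?_, .seq hr₁ (.push _ _ _), ?_, fun r hr => ?_⟩
  · simpa using ht₁
  · simp only [Ctx.regs, List.map_cons, List.map_nil, List.cons.injEq, and_true] at h₁ ⊢
    simp [h₁]
  · rw [update_of_ne (by simpa using hr), h₁' r hr]

/-- Case distinction on the first symbol of a word. -/
theorem cases {l : α → List Γ'} {f : α → β} {g : Γ' → α × List Γ' → β} (hl : PT A l)
    (hf : PT A f) (hg : ∀ a, PT A (g a)) :
    PT A (fun x => match l x with | [] => f x | a :: t => g a (x, t)) := by
  obtain ⟨p, hp, hP⟩ := hl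
  obtain ⟨q, hq, hQ⟩ := hf
  choose u hu hU using hg
  have hle : ∀ a n, (u a).eval n ≤ (∑ a, u a).eval n := fun a n => by
    rw [Polynomial.eval_finsetSum]
    exact Finset.single_le_sum (f := fun a => (u a).eval n) (fun _ _ => Nat.zero_le _)
      (Finset.mem_univ a)
  -- Summing over the finite alphabet bounds all branches at once. The argument `X + p` allows for
  -- the tail handed to the branch, and `2 * p` pays for clearing that tail.
  refine ⟨p + q + (∑ a, u a).comp (.X + p) + 2 * p + 2, fun x => ?_,
    fun ins outs b hi ho hL => ?_⟩
  · have h1 := hp x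
    have h2 := hq x
    simp only [Polynomial.eval_add, Polynomial.eval_comp, Polynomial.eval_X]
    generalize l x = m at h1
    cases m with
    | nil => exact h2.trans (by omega)
    | cons a t =>
      have h3 := (hu a (x, t)).trans (hle a _)
      simp only [len_prod, len_list, List.length_cons] at h1 h3
      have h4 := eval_mono (∑ a, u a) (show len x + t.length ≤ len x + p.eval (len x) by omega)
      simp only
      omega
  obtain ⟨P, hP⟩ := hP ins [b] (b + 1) hi rfl ⟨by simp,
    fun r h h' => by have := hL.ins_lt r h; simp at h'; omega,
    fun r h => by have := hL.ins_lt r h; omega, by simp⟩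
  obtain ⟨Q, hQ⟩ := hQ ins outs b hi ho hL
  have hU' := fun a => hU a (ins ++ [b]) outs (b + 1) (by simp [hi, Ctx.size]) ho ⟨hL.nodup,
    fun r h => by
      rcases List.mem_append.1 h with h | h
      · exact hL.disj r h
      · intro h'
        have := hL.outs_lt r h'
        simp at h
        omega,
    fun r h => by
      rcases List.mem_append.1 h with h | h
      · have := hL.ins_lt r h; omega
      · simp at h; omega,
    fun r h => by have := hL.outs_lt r h; omega⟩
  choose U hU' using hU'
  refine ⟨.seq P (.branch b fun o => o.elim Q fun a => .seq (U a) (clear b)),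
    fun s x hx he hb => ?_⟩
  obtain ⟨s₁, t₁, ht₁, hr₁, h₁, h₁'⟩ := hP s x hx (fun r h => hb r (by simp at h; omega))
    (fun r h => hb r (by omega))
  simp only [Ctx.regs, List.map_cons, List.map_nil, List.cons.injEq, and_true] at h₁
  have h1 := hp x
  simp only [Polynomial.eval_add, Polynomial.eval_comp, Polynomial.eval_X, Polynomial.eval_mul,
    Polynomial.eval_ofNat]
  have hins : ∀ v, ins.map (update s₁ b v) = Ctx.regs x := fun v => by
    rw [← hx]
    refine List.map_congr_left fun r h => ?_
    have := hL.ins_lt r h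
    rw [update_of_ne (by omega), h₁' r (by simp; omega)]
  have houts : ∀ v, ∀ r ∈ outs, update s₁ b v r = [] := fun v r h => by
    have := hL.outs_lt r h
    rw [update_of_ne (by omega), h₁' r (by simp; omega)]
    exact he r h
  generalize l x = m at h1 h₁
  cases m with
  | nil =>
    obtain ⟨s₂, t₂, ht₂, hr₂, h₂, h₂'⟩ := hQ (update s₁ b (s₁ b).tail) x (hins _) (houts _)
      (fun r h => by
        by_cases hrb : r = b
        · subst hrb; simp [h₁]
        · rw [update_of_ne hrb, h₁' r (by simpa using hrb)]; exact hb r h)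
    refine ⟨s₂, t₁ + (1 + t₂), by omega, .seq hr₁ (.branch ?_), h₂, fun r hr => ?_⟩
    · rw [h₁] at hr₂ ⊢
      exact hr₂
    · rw [h₂' r hr]
      by_cases hrb : r = b
      · subst hrb; simp [h₁, hb r le_rfl]
      · rw [update_of_ne hrb, h₁' r (by simpa using hrb)]
  | cons a t =>
    obtain ⟨s₂, t₂, ht₂, hr₂, h₂, h₂'⟩ := hU' a (update s₁ b (s₁ b).tail) (x, t)
      (by rw [List.map_append, hins]; simp [Ctx.regs, h₁]) (houts _)
      (fun r h => by
        rw [update_of_ne (by omega), h₁' r (by simp; omega)]; exact hb r (by omega))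
    have hbo : b ∉ outs := fun h => (hL.outs_lt b h).false
    have hsb : s₂ b = t := by rw [h₂' b hbo, update_self, h₁, List.tail_cons]
    refine ⟨update s₂ b [], t₁ + (1 + (t₂ + (2 * (s₂ b).length + 1))), ?_,
      .seq hr₁ (.branch ?_), ?_, fun r hr => ?_⟩
    rotate_left
    · rw [h₁] at hr₂ ⊢
      exact .seq hr₂ (runs_clear b s₂)
    · rw [← h₂]
      refine List.map_congr_left fun r h => update_of_ne (by rintro rfl; exact hbo h) _ _
    · by_cases hrb : r = b
      · subst hrb; simp [hb r le_rfl]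
      · rw [update_of_ne hrb, h₂' r hr, update_of_ne hrb, h₁' r (by simpa using hrb)]
    · rw [hsb]
      have h3 := hle a (len (x, t))
      simp only [len_prod, len_list, List.length_cons] at h1 h3 ht₂
      have h4 := eval_mono (∑ a, u a) (show len x + t.length ≤ len x + p.eval (len x) by omega)
      omega

end PT
end ClassCover

/-! ### Bounded iteration, oracle calls, and the passage to Turing machines. -/

namespace ClassCover
open Computability (Γ' encodeNat decode_encodeNat)

open Turing Function Prog

namespace PT

variable {A : TM2ComputableAux Γ' Γ'} {α β γ δ σ : Type} [Ctx α] [Ctx β] [Ctx γ] [Ctx δ] [Ctx σ]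

/-- Bounded iteration of a function whose iterates stay polynomially small. -/
theorem iterate {f : α × σ → σ} {i : α → σ} {n : α → List Γ'} (hf : PT A f) (hi : PT A i) (hn : PT A n)
    (B : Polynomial ℕ)
    (hB : ∀ x k, k ≤ (n x).length → len ((fun y => f (x, y))^[k] (i x)) ≤ B.eval (len x)) :
    PT A (fun x => (fun y => f (x, y))^[(n x).length] (i x)) := by
  obtain ⟨p, hp, hP⟩ := hf
  obtain ⟨q, hq, hQ⟩ := hi
  obtain ⟨u, hu, hU⟩ := hn
  set k := Ctx.size σ with hk
  -- There are at most `u` rounds. Each computes `f` on data of size at most `X + B`, erases the old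
  -- state and moves the new one into its place; the last two cost at most `6 * B` plus a constant.
  refine ⟨B + q + u + 1 + u * (p.comp (.X + B) + 6 * B + .C (3 * k + 4)), fun x => ?_,
    fun ins outs b hi' ho hl => ?_⟩
  · refine (hB x _ le_rfl).trans ?_
    simp only [Polynomial.eval_add]
    omega
  obtain ⟨Q, hQ⟩ := hQ ins outs b hi' ho hl
  have hm : ∀ r, r ∈ List.range' (b + 1) k ↔ b + 1 ≤ r ∧ r < b + 1 + k :=
    fun r => by simp [List.mem_range'_1]
  have hbo : b ∉ outs := fun h => (hl.outs_lt b h).false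
  obtain ⟨U, hU⟩ := hU ins [b] (b + 1) hi' rfl ⟨by simp,
    fun r h h' => by have := hl.ins_lt r h; simp at h'; omega,
    fun r h => by have := hl.ins_lt r h; omega, by simp⟩
  obtain ⟨P, hP⟩ := hP (ins ++ outs) (List.range' (b + 1) k) (b + 1 + k)
    (by simp [hi', ho, Ctx.size]) (by simp [hk]) ⟨List.nodup_range', fun r h h' => by
      rw [hm] at h'
      rcases List.mem_append.1 h with h | h
      · have := hl.ins_lt r h; omega
      · have := hl.outs_lt r h; omega,
      fun r h => by
        rcases List.mem_append.1 h with h | h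
        · have := hl.ins_lt r h; omega
        · have := hl.outs_lt r h; omega,
      fun r h => by rw [hm] at h; omega⟩
  set body : Prog := .seq P (.seq (clearAll outs)
    (transferAll (b + 1 + k) (List.range' (b + 1) k) outs)) with hbody
  -- one round of the loop
  have round : ∀ (s : ℕ → List Γ') (x : α) (y : σ) (M : ℕ), ins.map s = Ctx.regs x →
      outs.map s = Ctx.regs y → (∀ r, b + 1 ≤ r → s r = []) → len y ≤ M → len (f (x, y)) ≤ M →
      ∃ s' t, t ≤ p.eval (len x + M) + 6 * M + (3 * k + 2) + 1 ∧ Runs A body s s' t ∧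
        outs.map s' = Ctx.regs (f (x, y)) ∧ ∀ r ∉ outs, s' r = s r := by
    intro s x y M hx hy hb hM hM'
    obtain ⟨s₁, t₁, ht₁, hr₁, h₁, h₁'⟩ := hP s (x, y) (by rw [List.map_append, hx, hy]; rfl)
      (fun r h => hb r (by rw [hm] at h; omega)) (fun r h => hb r (by omega))
    obtain ⟨s₂, t₂, ht₂, hr₂, h₂, h₂'⟩ := runs_clearAll (A := A) outs s₁
    have hd : ∀ r ∈ List.range' (b + 1) k, r ∉ outs := fun r h h' => by
      have := hl.outs_lt r h'; rw [hm] at h; omega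
    have e₁ : outs.map s₁ = Ctx.regs y := by
      rw [← hy]
      exact List.map_congr_left fun r h => h₁' r fun h' => hd r h' h
    have e₂ : (List.range' (b + 1) k).map s₂ = Ctx.regs (f (x, y)) := by
      rw [← h₁]
      exact List.map_congr_left fun r h => h₂' r (hd r h)
    have hnb : b + 1 + k ∉ outs := fun h => by have := hl.outs_lt _ h; omega
    obtain ⟨s₃, t₃, ht₃, hr₃, h₃, h₃', h₃''⟩ := runs_transferAll (A := A) (c := b + 1 + k)
      (List.range' (b + 1) k) outs (by rw [List.length_range', ho]) hl.nodup List.nodup_range' hd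
      (fun r h => by rw [hm] at h; omega) (fun r h => by have := hl.outs_lt r h; omega) s₂
      (by rw [h₂' _ hnb, h₁' _ (fun h => by rw [hm] at h; omega)]; exact hb _ (by omega)) h₂
    refine ⟨s₃, _, ?_, .seq hr₁ (.seq hr₂ hr₃), h₃.trans e₂, fun r hr => ?_⟩
    · rw [total_map_of_eq e₁, ho, ← hk] at ht₂
      rw [total_map_of_eq e₂, List.length_range'] at ht₃
      rw [len_prod] at ht₁
      have := eval_mono p (show len x + len y ≤ len x + M by omega)
      simp only at ht₁
      omega
    · by_cases h : r ∈ List.range' (b + 1) k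
      · rw [h₃' r h]
        rw [hm] at h
        exact (hb r h.1).symm
      · rw [h₃'' r hr h, h₂' r hr, h₁' r h]
  have loop : ∀ (x : α) (M m : ℕ) (s : ℕ → List Γ') (y : σ), ins.map s = Ctx.regs x →
      outs.map s = Ctx.regs y → (s b).length = m → (∀ r, b + 1 ≤ r → s r = []) →
      (∀ j ≤ m, len ((fun y => f (x, y))^[j] y) ≤ M) →
      ∃ s' t, t ≤ m * (p.eval (len x + M) + 6 * M + (3 * k + 4)) + 1 ∧
        Runs A (.loop b fun _ => body) s s' t ∧
        outs.map s' = Ctx.regs ((fun y => f (x, y))^[m] y) ∧ s' b = [] ∧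
        ∀ r ∉ outs, r ≠ b → s' r = s r := by
    intro x M m
    induction m with
    | zero =>
      intro s y hx hy hs hb hM
      exact ⟨s, 1, by simp, .loop_nil (List.length_eq_zero_iff.1 hs), hy, List.length_eq_zero_iff.1 hs, fun _ _ _ => rfl⟩
    | succ m ih =>
      intro s y hx hy hs hb hM
      obtain ⟨a, w, hw⟩ := List.exists_cons_of_length_eq_add_one hs
      have hwm : w.length = m := by simpa [hw] using hs
      have hu' : ∀ r ∈ ins, update s b (w) r = s r := fun r h => by
        have := hl.ins_lt r h
        rw [update_of_ne (by omega)]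
      have hu'' : ∀ r ∈ outs, update s b (w) r = s r := fun r h => by
        have := hl.outs_lt r h
        rw [update_of_ne (by omega)]
      obtain ⟨s₁, t₁, ht₁, hr₁, h₁, h₁'⟩ := round (update s b (w)) x y M
        (by rw [List.map_congr_left hu', hx]) (by rw [List.map_congr_left hu'', hy])
        (fun r h => by rw [update_of_ne (by omega)]; exact hb r h) (hM 0 (by omega))
        (hM 1 (by omega))
      obtain ⟨s₂, t₂, ht₂, hr₂, h₂, h₂b, h₂'⟩ := ih s₁ (f (x, y))
        (by
          rw [← hx]
          exact List.map_congr_left fun r h => (h₁' r (hl.disj r h)).trans (hu' r h))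
        h₁ (by rw [h₁' b hbo, update_self, hwm])
        (fun r h => by
          rw [h₁' r (fun h' => by have := hl.outs_lt r h'; omega), update_of_ne (by omega)]
          exact hb r h)
        (fun j hj => by
          have := hM (j + 1) (by omega)
          rwa [iterate_succ_apply] at this)
      refine ⟨s₂, _, ?_, .loop_cons hw hr₁ hr₂, ?_, h₂b,
        fun r hr hrb => ?_⟩
      · rw [add_mul]
        omega
      · rw [h₂, iterate_succ_apply]
      · rw [h₂' r hr hrb, h₁' r hr, update_of_ne hrb]
  refine ⟨.seq Q (.seq U (.loop b fun _ => body)), fun s x hx he hb => ?_⟩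
  obtain ⟨s₁, t₁, ht₁, hr₁, h₁, h₁'⟩ := hQ s x hx he hb
  have hsb : ∀ r, b ≤ r → s₁ r = [] := fun r h => by
    rw [h₁' r (fun h' => by have := hl.outs_lt r h'; omega)]
    exact hb r h
  have hx₁ : ins.map s₁ = Ctx.regs x := by
    rw [← hx]
    exact List.map_congr_left fun r h => h₁' r (hl.disj r h)
  obtain ⟨s₂, t₂, ht₂, hr₂, h₂, h₂'⟩ := hU s₁ x hx₁
    (fun r h => hsb r (by simp at h; omega)) (fun r h => hsb r (by omega))
  obtain ⟨s₃, t₃, ht₃, hr₃, h₃, h₃b, h₃'⟩ := loop x (B.eval (len x)) (n x).length s₂ (i x)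
    (by
      rw [← hx₁]
      exact List.map_congr_left fun r h => h₂' r (by have := hl.ins_lt r h; simp; omega))
    (by
      rw [← h₁]
      exact List.map_congr_left fun r h => h₂' r (by have := hl.outs_lt r h; simp; omega))
    (congrArg List.length (by simpa [Ctx.regs] using h₂))
    (fun r h => by rw [h₂' r (by simp; omega)]; exact hsb r (by omega))
    (fun j hj => hB x j hj)
  refine ⟨s₃, _, ?_, .seq hr₁ (.seq hr₂ hr₃), h₃, fun r hr => ?_⟩
  · have h4 := hu x
    rw [len_list] at h4
    have h5 := Nat.mul_le_mul_right (p.eval (len x + B.eval (len x)) + 6 * B.eval (len x) +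
      (3 * k + 4)) h4
    simp only [Polynomial.eval_add, Polynomial.eval_mul, Polynomial.eval_comp, Polynomial.eval_X,
      Polynomial.eval_C, Polynomial.eval_ofNat, Polynomial.eval_one]
    omega
  · by_cases hrb : r = b
    · subst hrb
      rw [h₃b, hb r le_rfl]
    · rw [h₃' r hr hrb, h₂' r (by simpa using hrb), h₁' r hr]

/-- The machine of the oracle may be called. -/
theorem oracle {X : Type} {enc : X → List Γ'} {f : X → List Γ'}
    (T : TM2ComputableInPolyTime enc (_root_.id : List Γ' → List Γ') f) {h : α → X}
    (hh : PT T.toTM2ComputableAux (fun x => enc (h x))) :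
    PT T.toTM2ComputableAux (fun x => f (h x)) := by
  obtain ⟨p, hp, hP⟩ := hh
  obtain ⟨c, hc⟩ := Answers.length_le T.toTM2ComputableAux
  have ans : ∀ a, ∃ t ≤ T.time.eval (enc a).length, Answers T.toTM2ComputableAux (enc a) (f a) t :=
    fun a => ⟨_, (T.outputsFun a).steps_le_m, (T.outputsFun a).evals_in_steps⟩
  have hlen : ∀ x, (f (h x)).length ≤ p.eval (len x) + T.time.eval (p.eval (len x)) * c := by
    intro x
    obtain ⟨t, ht, ha⟩ := ans (h x)
    have h1 : (enc (h x)).length ≤ _ := len_list (enc (h x)) ▸ hp x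
    exact (hc _ _ _ ha).trans (add_le_add h1 (Nat.mul_le_mul_right _ (ht.trans (eval_mono _ h1))))
  refine ⟨7 * p + T.time.comp p + 3 * (p + T.time.comp p * .C c) + 6, fun x => ?_,
    fun ins outs b hi ho hl => ?_⟩
  · rw [len_list]
    refine (hlen x).trans ?_
    simp only [Polynomial.eval_add, Polynomial.eval_mul, Polynomial.eval_comp, Polynomial.eval_C,
      Polynomial.eval_ofNat]
    omega
  obtain ⟨o, rfl⟩ := List.length_eq_one_iff.1 ho
  have hob : o < b := hl.outs_lt o (by simp)
  obtain ⟨P, hP⟩ := hP ins [b] (b + 1) hi rfl ⟨by simp,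
    fun r h h' => by have := hl.ins_lt r h; simp at h'; omega,
    fun r h => by have := hl.ins_lt r h; omega, by simp⟩
  -- Each `move` reverses a word. The first compensates the reversal on loading the oracle, the last
  -- the reversal on unloading it.
  refine ⟨.seq P (.seq (move b (b + 1)) (.seq (.call (b + 1) (b + 2)) (move (b + 2) o))),
    fun s x hx he hb => ?_⟩
  obtain ⟨s₁, t₁, ht₁, hr₁, h₁, h₁'⟩ := hP s x hx (fun r h => hb r (by simp at h; omega))
    (fun r h => hb r (by omega))
  simp only [Ctx.regs, List.map_cons, List.map_nil, List.cons.injEq, and_true] at h₁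
  have hs₁ : ∀ r, b + 1 ≤ r → s₁ r = [] := fun r h => by
    rw [h₁' r (by simp; omega)]
    exact hb r (by omega)
  have hso : s₁ o = [] := by
    rw [h₁' o (by simp; omega)]
    exact he o (by simp)
  obtain ⟨t, ht, ha⟩ := ans (h x)
  have hr₂ := runs_move (A := T.toTM2ComputableAux) (show b ≠ b + 1 by omega) s₁
  set s₂ := update (update s₁ b []) (b + 1) ((s₁ b).reverse ++ s₁ (b + 1)) with hs₂
  have hr₃ := Runs.call (A := T.toTM2ComputableAux) (r := b + 1) (r' := b + 2) (s := s₂)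
    (by rw [hs₂, update_self, hs₁ _ le_rfl, List.append_nil, h₁]) ha
  set s₃ := update (update s₂ (b + 1) []) (b + 2)
    ((f (h x)).reverse ++ update s₂ (b + 1) [] (b + 2)) with hs₃
  have hr₄ := runs_move (A := T.toTM2ComputableAux) (show b + 2 ≠ o by omega) s₃
  have e₃ : s₃ (b + 2) = (f (h x)).reverse := by
    simp [hs₃, hs₂, hs₁]
  have e₃' : s₃ o = [] := by
    simp [hs₃, hs₂, hso, show o ≠ b + 2 by omega, show o ≠ b + 1 by omega, show o ≠ b by omega]
  refine ⟨_, _, ?_, .seq hr₁ (.seq hr₂ (.seq hr₃ hr₄)), ?_, fun r hr => ?_⟩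
  · rw [e₃, h₁, List.length_reverse]
    have h1 : (enc (h x)).length ≤ _ := len_list (enc (h x)) ▸ hp x
    have h2 := hlen x
    have h3 := eval_mono T.time h1
    simp only [Polynomial.eval_add, Polynomial.eval_mul, Polynomial.eval_comp, Polynomial.eval_C,
      Polynomial.eval_ofNat]
    omega
  · simp [Ctx.regs, e₃, e₃']
  · have hro : r ≠ o := by simpa using hr
    rw [update_of_ne hro]
    by_cases h0 : r = b + 2
    · subst h0; simp [hb]
    · rw [update_of_ne h0, hs₃, update_of_ne h0]
      by_cases h1 : r = b + 1
      · subst h1; simp [hb]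
      · rw [update_of_ne h1, hs₂, update_of_ne h1]
        by_cases h2 : r = b
        · subst h2; simp [hb]
        · rw [update_of_ne h2, h₁' r (by simpa using h2)]

/-- Functions computable in polynomial time by stack programs are computable in polynomial time
by multi-stack Turing machines. -/
theorem computable {X : Type} {enc : X → List Γ'} {f : X → List Γ'}
    (hf : @PT A X (List Γ') ⟨1, fun x => [enc x], fun _ => rfl⟩ _ f) :
    Nonempty (TM2ComputableInPolyTime enc (_root_.id : List Γ' → List Γ') f) := by
  let _ : Ctx X := ⟨1, fun x => [enc x], fun _ => rfl⟩
  have hlen : ∀ x : X, len x = (enc x).length := fun x => by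
    change total [enc x] = _
    simp
  obtain ⟨p, hp, hP⟩ := hf
  obtain ⟨P, hP⟩ := hP [0] [1] 2 rfl rfl ⟨by simp, by simp, by simp, by simp⟩
  -- Programs behind `PT` preserve their input, so it has to be erased before halting.
  refine computableInPolyTime A (.seq P (clear 0)) (p + 2 * .X + 1) fun a => ?_
  obtain ⟨s, t, ht, hr, h1, h2⟩ := hP (update (fun _ => []) 0 (enc a)) a (by simp [Ctx.regs])
    (by simp) (fun r hr => by rw [update_of_ne (by omega)])
  have h0 : s 0 = enc a := by rw [h2 0 (by simp), update_self]
  refine ⟨_, ?_, Runs.cast (.seq hr (runs_clear 0 s)) (fun r => ?_) rfl⟩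
  · rw [h0]
    rw [hlen] at ht
    simp only [Polynomial.eval_add, Polynomial.eval_mul, Polynomial.eval_X, Polynomial.eval_one,
      Polynomial.eval_ofNat]
    omega
  · by_cases hr0 : r = 0
    · subst hr0; simp
    · rw [update_of_ne hr0]
      by_cases hr1 : r = 1
      · subst hr1; simpa [Ctx.regs] using h1
      · rw [h2 r (by simpa using hr1), update_of_ne hr0, update_of_ne hr1]

end PT
end ClassCover

/-! ### A library of polynomial time functions. -/

namespace ClassCover
open Computability (Γ' encodeNat decode_encodeNat)

open Turing Function Prog

namespace PT

variable {A : TM2ComputableAux Γ' Γ'} {α β γ δ σ : Type} [Ctx α] [Ctx β] [Ctx γ] [Ctx δ] [Ctx σ]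

theorem of_eq {f g : α → β} (hf : PT A f) (h : ∀ x, f x = g x) : PT A g := funext h ▸ hf

theorem bound {f : α → β} (hf : PT A f) :
    ∃ p : Polynomial ℕ, ∀ x, len (f x) ≤ p.eval (len x) := ⟨_, hf.choose_spec.1⟩

@[fun_prop]
theorem prodFst {f : α → β × γ} (hf : PT A f) : PT A fun x => (f x).1 := fst.comp hf

@[fun_prop]
theorem prodSnd {f : α → β × γ} (hf : PT A f) : PT A fun x => (f x).2 := snd.comp hf

/-- Bounded iteration, with the size bound derived from an invariant. -/
theorem iterate_of_invariant {f : α × σ → σ} {i : α → σ} {n : α → List Γ'} (hf : PT A f)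
    (hi : PT A i) (hn : PT A n) (I : α → σ → Prop) (h0 : ∀ x, I x (i x))
    (hI : ∀ x y, I x y → I x (f (x, y))) (B : Polynomial ℕ)
    (hB : ∀ x y, I x y → len y ≤ B.eval (len x)) :
    PT A (fun x => (fun y => f (x, y))^[(n x).length] (i x)) := by
  refine iterate hf hi hn B fun x k hk => hB x _ ?_
  clear hk
  induction k with
  | zero => exact h0 x
  | succ k ih =>
    rw [iterate_succ_apply']
    exact hI x _ ih

/-- Bounded iteration of a function that does not increase the size. -/
theorem iterate_of_le {f : α × σ → σ} {i : α → σ} {n : α → List Γ'} (hf : PT A f)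
    (hi : PT A i) (hn : PT A n) (hle : ∀ x y, len (f (x, y)) ≤ len y) :
    PT A (fun x => (fun y => f (x, y))^[(n x).length] (i x)) := by
  obtain ⟨p, hp⟩ := hi.bound
  exact iterate_of_invariant hf hi hn (fun x y => len y ≤ len (i x)) (fun _ => le_rfl)
    (fun x y h => (hle x y).trans h) p fun x y h => h.trans (hp x)

/-! ### Words and numbers -/

@[fun_prop]
theorem listTail {l : α → List Γ'} (hl : PT A l) : PT A fun x => (l x).tail :=
  (cases hl (const []) fun _ => snd).of_eq fun x => by cases l x <;> rfl

theorem pop_push : PT A fun y : List Γ' × List Γ' =>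
    match y.1 with | [] => (([], y.2) : List Γ' × List Γ') | a :: t => (t, a :: y.2) :=
  cases (g := fun a (z : (List Γ' × List Γ') × List Γ') => (z.2, a :: z.1.2)) fst
    ((const []).pair snd) fun a => by fun_prop

theorem iterate_pop_push (l m : List Γ') :
    (fun y : List Γ' × List Γ' => match y.1 with
      | [] => (([], y.2) : List Γ' × List Γ') | a :: t => (t, a :: y.2))^[l.length] (l, m) =
    ([], l.reverse ++ m) := by
  induction l generalizing m with
  | nil => rfl
  | cons a l ih => rw [List.length_cons, iterate_succ_apply]; simpa using ih (a :: m)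

theorem reverseAux {l m : α → List Γ'} (hl : PT A l) (hm : PT A m) :
    PT A fun x => (l x).reverse ++ m x := by
  have h := iterate_of_le (n := l) (i := fun x => (l x, m x)) (pop_push.comp (snd (α := α)))
    (hl.pair hm) hl fun x y => by
      obtain ⟨_ | ⟨a, t⟩, u⟩ := y <;> simp
      omega
  refine (snd.comp h).of_eq fun x => ?_
  simp only [iterate_pop_push]

@[fun_prop]
theorem append {l m : α → List Γ'} (hl : PT A l) (hm : PT A m) : PT A fun x => l x ++ m x :=
  (reverseAux (reverseAux hl (const [])) hm).of_eq fun x => by simp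

theorem unary {n : α → ℕ} (hn : PT A n) : PT A fun x => List.replicate (n x) Γ'.blank :=
  hn.of_regs rfl fun _ => rfl

theorem of_unary {n : α → ℕ} (hn : PT A fun x => List.replicate (n x) Γ'.blank) : PT A n :=
  hn.of_regs rfl fun _ => rfl

@[fun_prop]
theorem succ {n : α → ℕ} (hn : PT A n) : PT A fun x => n x + 1 :=
  of_unary ((push Γ'.blank (unary hn)).of_eq fun _ => (List.replicate_succ).symm)

/-- Bounded iteration, counted by a number. -/
theorem iterate_nat {f : α × σ → σ} {i : α → σ} {n : α → ℕ} (hf : PT A f) (hi : PT A i)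
    (hn : PT A n) (B : Polynomial ℕ)
    (hB : ∀ x k, k ≤ n x → len ((fun y => f (x, y))^[k] (i x)) ≤ B.eval (len x)) :
    PT A (fun x => (fun y => f (x, y))^[n x] (i x)) :=
  (iterate hf hi (unary hn) B fun x k hk => hB x k (by simpa using hk)).of_eq fun x => by
    rw [List.length_replicate]

@[fun_prop]
theorem length {l : α → List Γ'} (hl : PT A l) : PT A fun x => (l x).length := by
  obtain ⟨p, hp⟩ := hl.bound
  have e : ∀ k, (fun y : ℕ => y + 1)^[k] 0 = k := fun k => by
    induction k with
    | zero => rfl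
    | succ k ih => rw [iterate_succ_apply', ih]
  refine (iterate (f := fun y : α × ℕ => y.2 + 1) (i := fun _ => 0) (by fun_prop) (const 0) hl p
    fun x k hk => ?_).of_eq fun x => e _
  rw [e, len_nat]
  exact hk.trans ((len_list _).symm.trans_le (hp x))

@[fun_prop]
theorem add {m n : α → ℕ} (hm : PT A m) (hn : PT A n) : PT A fun x => m x + n x :=
  of_unary (((unary hm).append (unary hn)).of_eq fun _ => (List.replicate_add ..).symm)

@[fun_prop]
theorem mul {m n : α → ℕ} (hm : PT A m) (hn : PT A n) : PT A fun x => m x * n x := by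
  obtain ⟨p, hp⟩ := hm.bound
  obtain ⟨q, hq⟩ := hn.bound
  have e : ∀ m k, (fun y : ℕ => y + m)^[k] 0 = m * k := fun m k => by
    induction k with
    | zero => rfl
    | succ k ih => rw [iterate_succ_apply', ih, mul_add_one]
  refine (iterate_nat (f := fun y : α × ℕ => y.2 + m y.1) (i := fun _ => 0) (by fun_prop) (const 0)
    hn (p * q) fun x k hk => ?_).of_eq fun x => e (m x) (n x)
  refine (congrArg len (e (m x) k)).trans_le ?_
  rw [len_nat, Polynomial.eval_mul]
  have h1 := hp x
  have h2 := hq x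
  rw [len_nat] at h1 h2
  exact Nat.mul_le_mul h1 (hk.trans h2)

@[fun_prop]
theorem replicate (a : Γ') {n : α → ℕ} (hn : PT A n) : PT A fun x => List.replicate (n x) a := by
  obtain ⟨p, hp⟩ := hn.bound
  have e : ∀ k, (fun y : List Γ' => a :: y)^[k] [] = List.replicate k a := fun k => by
    induction k with
    | zero => rfl
    | succ k ih => rw [iterate_succ_apply', ih, List.replicate_succ]
  refine (iterate_nat (f := fun y : α × List Γ' => a :: y.2) (i := fun _ => []) (by fun_prop)
    (const []) hn p fun x k hk => ?_).of_eq fun x => e _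
  rw [e, len_list, List.length_replicate]
  exact hk.trans ((len_nat _).symm.trans_le (hp x))

@[fun_prop]
theorem drop {n : α → ℕ} {l : α → List Γ'} (hn : PT A n) (hl : PT A l) :
    PT A fun x => (l x).drop (n x) := by
  refine (iterate_of_le (f := fun y : α × List Γ' => y.2.tail) (i := l) (by fun_prop) hl (unary hn)
    fun x y => by simp).of_eq fun x => ?_
  rw [List.length_replicate]
  generalize n x = k
  generalize l x = m
  induction k generalizing m with
  | zero => rfl
  | succ k ih => rw [iterate_succ_apply, ← List.drop_tail]; exact ih _

/-! ### Boolean functions -/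

@[fun_prop]
theorem cond {c : α → Bool} {f g : α → β} (hc : PT A c) (hf : PT A f) (hg : PT A g) :
    PT A fun x => bif c x then f x else g x :=
  (cases (l := fun x => if c x then [Γ'.blank] else []) (hc.of_regs rfl fun _ => rfl) hg
    fun _ => hf.comp fst).of_eq fun x => by cases c x <;> rfl

@[fun_prop]
theorem and {c d : α → Bool} (hc : PT A c) (hd : PT A d) : PT A fun x => c x && d x :=
  (cond hc hd (const false)).of_eq fun x => by cases c x <;> rfl

@[fun_prop]
theorem or {c d : α → Bool} (hc : PT A c) (hd : PT A d) : PT A fun x => c x || d x :=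
  (cond hc (const true) hd).of_eq fun x => by cases c x <;> rfl

@[fun_prop]
theorem not {c : α → Bool} (hc : PT A c) : PT A fun x => !c x :=
  (cond hc (const false) (const true)).of_eq fun x => by cases c x <;> rfl

@[fun_prop]
theorem head_eq (a : Γ') {l : α → List Γ'} (hl : PT A l) : PT A fun x => (l x).head? == some a :=
  (cases hl (const false) fun b => const (b == a)).of_eq fun x => by cases l x <;> rfl

@[fun_prop]
theorem isEmpty {l : α → List Γ'} (hl : PT A l) : PT A fun x => (l x).isEmpty :=
  (cases hl (const true) fun _ => const false).of_eq fun x => by cases l x <;> rfl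

-- For unary numbers, `m < n` says that removing `m` blanks from `n` blanks leaves something.
@[fun_prop]
theorem lt {m n : α → ℕ} (hm : PT A m) (hn : PT A n) : PT A fun x => decide (m x < n x) :=
  (not (isEmpty (drop hm (replicate Γ'.blank hn)))).of_eq fun x => by
    rw [Bool.eq_iff_iff]
    simp
    omega

@[fun_prop]
theorem eq {m n : α → ℕ} (hm : PT A m) (hn : PT A n) : PT A fun x => decide (m x = n x) :=
  (and (not (lt hm hn)) (not (lt hn hm))).of_eq fun x => by
    rw [Bool.eq_iff_iff]
    simp
    omega

/-! ### Loops -/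

/-- Concatenation of the words `g x k`, `k < n x`. -/
theorem flatMap_range {n : α → ℕ} {g : α → ℕ → List Γ'} (hn : PT A n)
    (hg : PT A fun y : α × ℕ => g y.1 y.2) :
    PT A fun x => (List.range (n x)).flatMap (g x) := by
  obtain ⟨p, hp⟩ := hn.bound
  obtain ⟨q, hq⟩ := hg.bound
  have e : ∀ x k, (fun y : ℕ × List Γ' => (y.1 + 1, y.2 ++ g x y.1))^[k] (0, []) =
      (k, (List.range k).flatMap (g x)) := fun x k => by
    induction k with
    | zero => rfl
    | succ k ih => rw [iterate_succ_apply', ih, List.range_succ]; simp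
  refine (snd.comp (iterate_nat (f := fun y : α × ℕ × List Γ' =>
    (y.2.1 + 1, y.2.2 ++ g y.1 y.2.1)) (i := fun _ => (0, [])) ?_ (const (0, [])) hn
    (p + p * q.comp (.X + p)) fun x k hk => ?_)).of_eq fun x => by simp only [e]
  · have : PT A fun y : α × ℕ × List Γ' => g y.1 y.2.1 :=
      hg.comp (g := fun y : α × ℕ × List Γ' => (y.1, y.2.1)) (by fun_prop)
    fun_prop
  · rw [e, len_prod, len_nat, len_list, List.length_flatMap, Polynomial.eval_add,
      Polynomial.eval_mul, Polynomial.eval_comp, Polynomial.eval_add, Polynomial.eval_X]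
    have hk' : k ≤ p.eval (len x) := hk.trans ((len_nat _).symm.trans_le (hp x))
    refine add_le_add hk' ?_
    have : ∀ y ∈ (List.range k).map fun i => (g x i).length,
        y ≤ q.eval (len x + p.eval (len x)) := by
      intro y hy
      obtain ⟨i, hi, rfl⟩ := List.mem_map.1 hy
      have hi' := List.mem_range.1 hi
      have h := hq (x, i)
      rw [len_list, len_prod, len_nat] at h
      exact h.trans (eval_mono q (by simp only; omega))
    refine (List.sum_le_card_nsmul _ _ this).trans ?_
    rw [List.length_map, List.length_range, smul_eq_mul]
    exact Nat.mul_le_mul_right _ hk'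

/-- Bounded quantification. -/
theorem any_range {n : α → ℕ} {c : α → ℕ → Bool} (hn : PT A n)
    (hc : PT A fun y : α × ℕ => c y.1 y.2) :
    PT A fun x => (List.range (n x)).any (c x) := by
  refine (not (isEmpty (flatMap_range (g := fun x k => bif c x k then [Γ'.blank] else []) hn
    (by fun_prop)))).of_eq fun x => ?_
  induction List.range (n x) with
  | nil => rfl
  | cons k l ih =>
    rw [List.flatMap_cons, List.any_cons, ← ih]
    cases c x k <;> simp

/-- Number of occurrences of a symbol. -/
@[fun_prop]
theorem count (a : Γ') {l : α → List Γ'} (hl : PT A l) : PT A fun x => (l x).count a := by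
  have e : ∀ l : List Γ', (List.range l.length).flatMap
      (fun k => bif (l.drop k).head? == some a then [a] else []) = List.replicate (l.count a) a := by
    intro l
    induction l with
    | nil => rfl
    | cons b l ih =>
      rw [List.length_cons, List.range_succ_eq_map, List.flatMap_cons, List.flatMap_map]
      simp only [List.drop_succ_cons, ih, List.drop_zero, List.head?_cons]
      by_cases h : b = a
      · subst h
        simp [List.replicate_succ]
      · have : (some b == some a) = false := by simpa using h
        rw [this, List.count_cons_of_ne h]
        rfl
  exact (length (flatMap_range (g := fun x k => bif ((l x).drop k).head? == some a then [a] else [])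
    (length hl) (by fun_prop))).of_eq fun x => by rw [e, List.length_replicate]

/-- The part of a word behind the first occurrence of the symbol `a`. -/
def _root_.ClassCover.after (a : Γ') : List Γ' → List Γ'
  | [] => []
  | b :: l => if b = a then l else after a l

-- Symbols are discarded until `a` is in front, after which the iteration is stationary; a last
-- `tail` removes `a` itself. The length of the word is therefore always a sufficient number of
-- rounds.
@[fun_prop]
theorem after (a : Γ') {l : α → List Γ'} (hl : PT A l) : PT A fun x => ClassCover.after a (l x) := by
  have e : ∀ l k, l.length ≤ k →
      ((fun y : List Γ' => bif y.head? == some a then y else y.tail)^[k] l).tail =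
        ClassCover.after a l := by
    intro l
    induction l with
    | nil =>
      intro k _
      rw [iterate_fixed (by rfl)]
      rfl
    | cons b l ih =>
      intro k hk
      by_cases h : b = a
      · subst h
        rw [iterate_fixed (by simp)]
        simp [ClassCover.after]
      · obtain ⟨k, rfl⟩ : ∃ j, k = j + 1 := ⟨k - 1, by simp at hk; omega⟩
        rw [iterate_succ_apply]
        have h' : (some b == some a) = false := by simpa using h
        simpa [ClassCover.after, h, h'] using ih k (by simpa using hk)
  refine (listTail (iterate_of_le (f := fun y : α × List Γ' =>
    bif y.2.head? == some a then y.2 else y.2.tail) (i := l) (by fun_prop) hl hl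
    fun x y => ?_)).of_eq fun x => e _ _ le_rfl
  simp only [len_list]
  cases y.head? == some a <;> simp

end PT

/-! ### Comparison of binary numbers -/

/-- The number written in binary, least significant digit first, at the beginning of a word. -/
def binVal : List Γ' → ℕ
  | Γ'.bit b :: l => b.toNat + 2 * binVal l
  | _ => 0

/-- First digit. -/
def digit (l : List Γ') : Bool := l.head? == some (Γ'.bit true)

/-- Remove the first digit, if there is one. -/
def dropDigit (l : List Γ') : List Γ' :=
  bif l.head? == some (Γ'.bit true) || l.head? == some (Γ'.bit false) then l.tail else l

theorem binVal_eq (l : List Γ') : binVal l = (digit l).toNat + 2 * binVal (dropDigit l) := by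
  rcases l with _ | ⟨_ | (_ | _) | _ | _ | _, l⟩ <;> rfl

/-- One step of the comparison of two binary numbers. -/
def ltStep (y : (List Γ' × List Γ') × Bool) : (List Γ' × List Γ') × Bool :=
  ((dropDigit y.1.1, dropDigit y.1.2),
    bif digit y.1.1 then (digit y.1.2 && y.2) else (digit y.1.2 || y.2))

/-- Comparison of two binary numbers. -/
def binLt (u v : List Γ') : Bool := (ltStep^[(u ++ v).length] ((u, v), false)).2

/-- Number of digits at the beginning of a word. -/
def digits : List Γ' → ℕ
  | Γ'.bit _ :: l => digits l + 1
  | _ => 0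

theorem digits_le (l : List Γ') : digits l ≤ l.length := by
  induction l with
  | nil => rfl
  | cons a l ih => cases a <;> simp [digits, ih]

theorem digits_dropDigit (l : List Γ') : digits (dropDigit l) = digits l - 1 := by
  rcases l with _ | ⟨_ | (_ | _) | _ | _ | _, l⟩ <;> rfl

theorem binVal_of_digits (l : List Γ') (h : digits l = 0) : binVal l = 0 := by
  rcases l with _ | ⟨_ | (_ | _) | _ | _ | _, l⟩ <;> first | rfl | simp [digits] at h

/-- Digits arrive least significant first, so every new pair of digits overrides the verdict so far
unless they agree. With an arbitrary initial verdict `c` this becomes an induction: `c` decides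
exactly in case of equality. -/
theorem iterate_ltStep (k : ℕ) (u v : List Γ') (c : Bool) (hu : digits u ≤ k)
    (hv : digits v ≤ k) : (ltStep^[k] ((u, v), c)).2 =
      (decide (binVal u < binVal v) || (decide (binVal u = binVal v) && c)) := by
  induction k generalizing u v c with
  | zero => simp [binVal_of_digits u (by omega), binVal_of_digits v (by omega)]
  | succ k ih =>
    rw [iterate_succ_apply]
    refine (ih _ _ _ ((digits_dropDigit u).trans_le (by omega))
      ((digits_dropDigit v).trans_le (by omega))).trans ?_
    rw [binVal_eq u, binVal_eq v, Bool.eq_iff_iff]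
    generalize binVal (dropDigit u) = x
    generalize binVal (dropDigit v) = y
    cases digit u <;> cases digit v <;> cases c <;> simp <;> omega

theorem binLt_eq (u v : List Γ') : binLt u v = decide (binVal u < binVal v) := by
  rw [binLt, iterate_ltStep _ _ _ _ ((digits_le u).trans (by simp)) ((digits_le v).trans (by simp))]
  simp

@[fun_prop]
theorem PT.binLt {A : TM2ComputableAux Γ' Γ'} {α : Type} [Ctx α] {u v : α → List Γ'} (hu : PT A u)
    (hv : PT A v) : PT A fun x => ClassCover.binLt (u x) (v x) := by
  obtain ⟨p, hp⟩ := hu.bound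
  obtain ⟨q, hq⟩ := hv.bound
  have hd : ∀ l, (dropDigit l).length ≤ l.length := fun l => by
    unfold dropDigit
    cases l.head? == some (Γ'.bit true) || l.head? == some (Γ'.bit false) <;> simp
  refine snd.comp (iterate_of_invariant (f := fun y : α × (List Γ' × List Γ') × Bool => ltStep y.2)
    (i := fun x => ((u x, v x), false)) (by unfold ltStep dropDigit digit; fun_prop)
    (by fun_prop) (hu.append hv)
    (fun x y => y.1.1.length ≤ (u x).length ∧ y.1.2.length ≤ (v x).length) (fun x => by simp)
    (fun x y h => ⟨(hd _).trans h.1, (hd _).trans h.2⟩) (p + q + 1) fun x y h => ?_)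
  have h1 := hp x
  have h2 := hq x
  have h3 := len_bool_le y.2
  simp only [len_prod, len_list, Polynomial.eval_add, Polynomial.eval_one] at *
  omega

end ClassCover

namespace ClassCover
open Computability (Γ' encodeNat decode_encodeNat)

/-! ### The reduction and the extraction of a vertex cover, on words -/

/-- The column used by the pair `(i, j)`. -/
def pos (n i j : ℕ) : ℕ := i * (n + 1) + j

/-- Binary logarithm of the first coordinate of the points with index `c` in column `(i, j)`. -/
def xExp (n i j c : ℕ) : ℕ := 9 * pos n i j + c + 1

/-- Binary logarithm of the second coordinate of the points of column `(i, j)` at level `(k, s)` of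
the block of rows which belongs to the vertex `v`. -/
def yExp (n i j v k s : ℕ) : ℕ :=
  -- Heights are ordered lexicographically by the level `4 * v + k`, then by the column, then by `s
  -- < 3`. The factor `10 * (n * (n + 1))` exceeds all exponents of first coordinates, for the sake
  -- of general position.
  10 * (n * (n + 1)) * (3 * ((4 * v + k) * (n * (n + 1)) + pos n i j) + s + 1)

/-- The word for the number `2 ^ a`. -/
def powWord (a : ℕ) : List Γ' :=
  [Γ'.bra, Γ'.bit false] ++ List.replicate a (Γ'.bit false) ++
    [Γ'.bit true, Γ'.comma, Γ'.bit true, Γ'.ket]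

/-- The word for the point `(2 ^ a, 2 ^ b)`. -/
def pointWord (a b : ℕ) : List Γ' := [Γ'.bra] ++ powWord a ++ powWord b ++ [Γ'.ket]

/-- The red points of column `(i, j)`. -/
def redWord (n i j : ℕ) : List Γ' :=
  -- Points 0 and 2 stand for the ends `i` and `j`; point 3 forces one region per edge.
  pointWord (xExp n i j 0) (yExp n i j i 1 0) ++ pointWord (xExp n i j 2) (yExp n i j j 1 0) ++
    pointWord (xExp n i j 3) (yExp n i j i 3 0)

/-- The blue points of column `(i, j)`. -/
def blueWord (n i j : ℕ) : List Γ' :=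
  -- Point 1 separates the two ends. The others lie to the right of all red points of the column: 4
  -- and 5 below and above the level of point 0, 7 and 8 below and above that of point 2, and 6 just
  -- above point 3, where 5 also serves as lower guard.
  pointWord (xExp n i j 1) (yExp n i j i 3 1) ++ pointWord (xExp n i j 4) (yExp n i j i 0 0) ++
    pointWord (xExp n i j 5) (yExp n i j i 2 0) ++ pointWord (xExp n i j 6) (yExp n i j i 3 2) ++
    pointWord (xExp n i j 7) (yExp n i j j 0 0) ++ pointWord (xExp n i j 8) (yExp n i j j 2 0)

/-- Adjacency of `i < j`, read off from the adjacency matrix. -/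
def isEdge (w : List Γ') (n i j : ℕ) : Bool :=
  decide (i < j) && (w.drop (pos n i j)).head? == some (Γ'.bit true)

/-- Concatenation over all edges. -/
def overEdges (g : ℕ → ℕ → ℕ → List Γ') (w : List Γ') (n : ℕ) : List Γ' :=
  (List.range n).flatMap fun i => (List.range n).flatMap fun j =>
    bif isEdge w n i j then g n i j else []

/-- The reduction from graphs to bichromatic point sets. -/
def reductionWord (w : List Γ') : List Γ' :=
  [Γ'.bra] ++ overEdges redWord w (w.count Γ'.comma) ++ [Γ'.ket] ++
    ([Γ'.bra] ++ overEdges blueWord w (w.count Γ'.comma) ++ [Γ'.ket])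

/-- For the word of a side of a box: is this side missing or smaller than `2 ^ a`? -/
def sideBelow (s : List Γ') (a : ℕ) : Bool :=
  -- A nonnegative side is below `2 ^ a` when its numerator is less than `2 ^ a` times its
  -- denominator. With least significant digits first, this multiplication is prefixing `a` zeros,
  -- and `binVal` stops at the separator behind a number.
  s.head? == some Γ'.blank || ((s.drop 1).head? == some (Γ'.bit true) ||
    binLt (s.drop 2) (List.replicate a (Γ'.bit false) ++ after Γ'.comma s))

/-- For the word of a side of a box: is this side missing or larger than `2 ^ a`? -/
def sideAbove (s : List Γ') (a : ℕ) : Bool :=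
  s.head? == some Γ'.blank || (!((s.drop 1).head? == some (Γ'.bit true)) &&
    binLt (List.replicate a (Γ'.bit false) ++ after Γ'.comma s) (s.drop 2))

/-- Skip a side of a box. -/
def skipSide (s : List Γ') : List Γ' :=
  bif s.head? == some Γ'.blank then s.tail else after Γ'.ket s

/-- Does the box at the beginning of the word cover the point `(2 ^ a, 2 ^ b)`? -/
def boxCovers (s : List Γ') (a b : ℕ) : Bool :=
  sideBelow s.tail a && (sideAbove (skipSide s.tail) a &&
    (sideBelow (skipSide (skipSide s.tail)) b && sideAbove (skipSide (skipSide (skipSide s.tail))) b))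

/-- Does the word begin with a box? -/
def isBox (s : List Γ') : Bool :=
  -- A rational number also opens with a bracket, but a sign digit follows; in a box the next symbol
  -- is a bracket or a blank.
  s.head? == some Γ'.bra &&
    (!((s.drop 1).head? == some (Γ'.bit true)) && !((s.drop 1).head? == some (Γ'.bit false)))

/-- A digit for a word that begins with a box covering `(2 ^ a, 2 ^ b)`, telling whether it also
covers `(2 ^ a', 2 ^ b')`. -/
def judge (a b a' b' : ℕ) (s : List Γ') : List Γ' :=
  bif isBox s && boxCovers s a b then (bif boxCovers s a' b' then [Γ'.bit true] else [Γ'.bit false])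
  else []

/-- Does the first box covering `(2 ^ a, 2 ^ b)` also cover `(2 ^ a', 2 ^ b')`? -/
def firstCovers (u : List Γ') (a b a' b' : ℕ) : Bool :=
  -- All suffixes are tested. The opening bracket of the list must go first, since followed by a box
  -- it would itself look like the start of a box.
  ((List.range u.tail.length).flatMap fun k => judge a b a' b' (u.tail.drop k)).head? ==
    some (Γ'.bit true)

/-- The vertex chosen for the edge `(i, j)` is `v`. -/
def isChosen (u : List Γ') (n i j v : ℕ) : Bool :=
  bif firstCovers u (xExp n i j 3) (yExp n i j i 3 0) (xExp n i j 0) (yExp n i j i 1 0) then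
    decide (j = v) else decide (i = v)

/-- The vertex cover extracted from a class cover. -/
def coverWord (w u : List Γ') : List Γ' :=
  (List.range (w.count Γ'.comma)).flatMap fun v =>
    bif (List.range (w.count Γ'.comma)).any fun i => (List.range (w.count Γ'.comma)).any fun j =>
      isEdge w (w.count Γ'.comma) i j && isChosen u (w.count Γ'.comma) i j v
    then [Γ'.bit true] else [Γ'.bit false]

/-! ### The reduction and the extraction run in polynomial time. -/

namespace PT

open Turing

variable {A : TM2ComputableAux Γ' Γ'} {α : Type} [Ctx α]

@[fun_prop]
theorem xExp {n i j c : α → ℕ} (hn : PT A n) (hi : PT A i) (hj : PT A j) (hc : PT A c) :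
    PT A fun x => ClassCover.xExp (n x) (i x) (j x) (c x) := by
  unfold ClassCover.xExp pos
  fun_prop

@[fun_prop]
theorem yExp {n i j v k s : α → ℕ} (hn : PT A n) (hi : PT A i) (hj : PT A j) (hv : PT A v)
    (hk : PT A k) (hs : PT A s) :
    PT A fun x => ClassCover.yExp (n x) (i x) (j x) (v x) (k x) (s x) := by
  unfold ClassCover.yExp pos
  fun_prop

@[fun_prop]
theorem pointWord {a b : α → ℕ} (ha : PT A a) (hb : PT A b) :
    PT A fun x => ClassCover.pointWord (a x) (b x) := by
  unfold ClassCover.pointWord powWord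
  fun_prop

@[fun_prop]
theorem redWord {n i j : α → ℕ} (hn : PT A n) (hi : PT A i) (hj : PT A j) :
    PT A fun x => ClassCover.redWord (n x) (i x) (j x) := by
  unfold ClassCover.redWord
  fun_prop

@[fun_prop]
theorem blueWord {n i j : α → ℕ} (hn : PT A n) (hi : PT A i) (hj : PT A j) :
    PT A fun x => ClassCover.blueWord (n x) (i x) (j x) := by
  unfold ClassCover.blueWord
  fun_prop

@[fun_prop]
theorem isEdge {w : α → List Γ'} {n i j : α → ℕ} (hw : PT A w) (hn : PT A n) (hi : PT A i)
    (hj : PT A j) : PT A fun x => ClassCover.isEdge (w x) (n x) (i x) (j x) := by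
  unfold ClassCover.isEdge pos
  fun_prop

theorem overEdges {g : ℕ → ℕ → ℕ → List Γ'} {w : α → List Γ'} {n : α → ℕ} (hw : PT A w)
    (hn : PT A n) (hg : PT A fun x : ℕ × ℕ × ℕ => g x.1 x.2.1 x.2.2) :
    PT A fun x => ClassCover.overEdges g (w x) (n x) := by
  refine flatMap_range hn (flatMap_range (by fun_prop) (cond (by fun_prop) ?_ (const [])))
  exact hg.comp (g := fun y : (α × ℕ) × ℕ => (n y.1.1, y.1.2, y.2)) (by fun_prop)

theorem reductionWord : PT A ClassCover.reductionWord := by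
  have h1 : PT A fun w => ClassCover.overEdges ClassCover.redWord w (w.count Γ'.comma) :=
    overEdges id (by fun_prop) (by fun_prop)
  have h2 : PT A fun w => ClassCover.overEdges ClassCover.blueWord w (w.count Γ'.comma) :=
    overEdges id (by fun_prop) (by fun_prop)
  unfold ClassCover.reductionWord
  fun_prop

@[fun_prop]
theorem sideBelow {s : α → List Γ'} {a : α → ℕ} (hs : PT A s) (ha : PT A a) :
    PT A fun x => ClassCover.sideBelow (s x) (a x) := by
  unfold ClassCover.sideBelow
  fun_prop

@[fun_prop]
theorem sideAbove {s : α → List Γ'} {a : α → ℕ} (hs : PT A s) (ha : PT A a) :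
    PT A fun x => ClassCover.sideAbove (s x) (a x) := by
  unfold ClassCover.sideAbove
  fun_prop

@[fun_prop]
theorem skipSide {s : α → List Γ'} (hs : PT A s) : PT A fun x => ClassCover.skipSide (s x) := by
  unfold ClassCover.skipSide
  fun_prop

@[fun_prop]
theorem boxCovers {s : α → List Γ'} {a b : α → ℕ} (hs : PT A s) (ha : PT A a) (hb : PT A b) :
    PT A fun x => ClassCover.boxCovers (s x) (a x) (b x) := by
  unfold ClassCover.boxCovers
  fun_prop

@[fun_prop]
theorem isBox {s : α → List Γ'} (hs : PT A s) : PT A fun x => ClassCover.isBox (s x) := by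
  unfold ClassCover.isBox
  fun_prop

@[fun_prop]
theorem firstCovers {u : α → List Γ'} {a b a' b' : α → ℕ} (hu : PT A u) (ha : PT A a)
    (hb : PT A b) (ha' : PT A a') (hb' : PT A b') :
    PT A fun x => ClassCover.firstCovers (u x) (a x) (b x) (a' x) (b' x) := by
  refine head_eq _ (flatMap_range (by fun_prop) ?_)
  unfold ClassCover.judge
  fun_prop

@[fun_prop]
theorem isChosen {u : α → List Γ'} {n i j v : α → ℕ} (hu : PT A u) (hn : PT A n) (hi : PT A i)
    (hj : PT A j) (hv : PT A v) :
    PT A fun x => ClassCover.isChosen (u x) (n x) (i x) (j x) (v x) := by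
  unfold ClassCover.isChosen
  fun_prop

theorem coverWord {w u : α → List Γ'} (hw : PT A w) (hu : PT A u) :
    PT A fun x => ClassCover.coverWord (w x) (u x) :=
  flatMap_range (by fun_prop) (cond (any_range (by fun_prop) (any_range (by fun_prop) (by fun_prop)))
    (const _) (const _))

end PT
end ClassCover

namespace ClassCover
open Computability (Γ' encodeNat decode_encodeNat)

/-! ### The bichromatic point set of a graph -/

theorem pos_lt {n i j : ℕ} (hi : i < n) (hj : j < n) : pos n i j < n * (n + 1) := by
  unfold pos
  nlinarith

theorem le_of_pos_lt {n i j i' j' : ℕ} (hj' : j' < n) (h : pos n i j < pos n i' j') : i ≤ i' := by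
  unfold pos at h
  by_contra! hlt
  nlinarith

theorem pos_inj {n i j i' j' : ℕ} (hj : j < n) (hj' : j' < n) (h : pos n i j = pos n i' j') :
    i = i' ∧ j = j' := by
  unfold pos at h
  rcases lt_trichotomy i i' with h1 | rfl | h1
  · nlinarith
  · exact ⟨rfl, by omega⟩
  · nlinarith

/-- Binary logarithm of the second coordinate of the point with index `c` in column `(i, j)`. -/
def rowExp (n i j : ℕ) : ℕ → ℕ
  | 0 => yExp n i j i 1 0
  | 1 => yExp n i j i 3 1
  | 2 => yExp n i j j 1 0
  | 3 => yExp n i j i 3 0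
  | 4 => yExp n i j i 0 0
  | 5 => yExp n i j i 2 0
  | 6 => yExp n i j i 3 2
  | 7 => yExp n i j j 0 0
  | _ => yExp n i j j 2 0

theorem yExp_lt_iff {n i j v k s i' j' v' k' s' : ℕ} (hn : 0 < n) :
    yExp n i j v k s < yExp n i' j' v' k' s' ↔
      3 * ((4 * v + k) * (n * (n + 1)) + pos n i j) + s <
        3 * ((4 * v' + k') * (n * (n + 1)) + pos n i' j') + s' := by
  unfold yExp
  rw [Nat.mul_lt_mul_left (by positivity)]
  omega

/-- A level contains fewer than `n * (n + 1)` columns with three slots each, so a difference in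
level outweighs everything else. -/
theorem yExp_lt_of_level {n i j v k s i' j' v' k' s' : ℕ} (hi : i < n) (hj : j < n) (hs : s < 3)
    (h : 4 * v + k < 4 * v' + k') : yExp n i j v k s < yExp n i' j' v' k' s' := by
  rw [yExp_lt_iff (by omega)]
  have h1 := pos_lt hi hj
  have h2 := Nat.mul_le_mul_right (n * (n + 1)) (Nat.succ_le_of_lt h)
  rw [Nat.succ_mul] at h2
  omega

theorem yExp_lt_of_pos {n i j v k s i' j' s' : ℕ} (hn : 0 < n) (hs : s < 3)
    (h : pos n i j < pos n i' j') : yExp n i j v k s < yExp n i' j' v k s' := by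
  rw [yExp_lt_iff hn]
  omega

theorem yExp_lt_of_lt {n i j v k s s' : ℕ} (hn : 0 < n) (h : s < s') :
    yExp n i j v k s < yExp n i j v k s' := by
  rw [yExp_lt_iff hn]
  omega

theorem yExp_inj {n i j v k s i' j' v' k' s' : ℕ} (hi : i < n) (hj : j < n) (hi' : i' < n)
    (hj' : j' < n) (hs : s < 3) (hs' : s' < 3) (h : yExp n i j v k s = yExp n i' j' v' k' s') :
    i = i' ∧ j = j' ∧ 4 * v + k = 4 * v' + k' ∧ s = s' := by
  have hn : 0 < n := by omega
  have h1 : 4 * v + k = 4 * v' + k' := by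
    by_contra hne
    rcases lt_or_gt_of_ne hne with h1 | h1
    · exact (yExp_lt_of_level hi hj hs h1).ne h
    · exact (yExp_lt_of_level hi' hj' hs' h1).ne' h
  have h2 : 3 * ((4 * v + k) * (n * (n + 1)) + pos n i j) + s =
      3 * ((4 * v' + k') * (n * (n + 1)) + pos n i' j') + s' :=
    le_antisymm (not_lt.1 fun h' => ((yExp_lt_iff hn).2 h').ne' h)
      (not_lt.1 fun h' => ((yExp_lt_iff hn).2 h').ne h)
  rw [h1] at h2
  obtain ⟨h3, h4⟩ := pos_inj hj hj' (show pos n i j = pos n i' j' by omega)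
  exact ⟨h3, h4, h1, by omega⟩

/-- Within a column the nine pairs of level and slot are distinct, where `i < j` keeps the blocks of
the two ends apart; the column itself can be read off the height. -/
theorem rowExp_inj {n i j c i' j' c' : ℕ} (hij : i < j) (hj : j < n) (hij' : i' < j') (hj' : j' < n)
    (hc : c < 9) (hc' : c' < 9) (h : rowExp n i j c = rowExp n i' j' c') :
    i = i' ∧ j = j' ∧ c = c' := by
  have key : ∀ {v k s v' k' s'}, s < 3 → s' < 3 → yExp n i j v k s = yExp n i' j' v' k' s' →
      i = i' ∧ j = j' ∧ 4 * v + k = 4 * v' + k' ∧ s = s' := fun hs hs' h => yExp_inj (hij.trans hj) hj (hij'.trans hj') hj' hs hs' h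
  interval_cases c <;> interval_cases c' <;>
    · simp only [rowExp] at h
      have := key (by decide) (by decide) h
      omega

theorem xExp_inj {n i j c i' j' c' : ℕ} (hj : j < n) (hj' : j' < n) (hc : c < 9) (hc' : c' < 9)
    (h : xExp n i j c = xExp n i' j' c') : i = i' ∧ j = j' ∧ c = c' := by
  unfold xExp at h
  obtain ⟨h1, h2⟩ := pos_inj hj hj' (show pos n i j = pos n i' j' by omega)
  exact ⟨h1, h2, by omega⟩

theorem exists_rowExp (n i j c : ℕ) : ∃ r, rowExp n i j c = 10 * (n * (n + 1)) * (r + 1) := by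
  unfold rowExp
  split <;> exact ⟨_, rfl⟩

/-- The point `(2 ^ a, 2 ^ b)`. -/
def ratPoint (p : ℕ × ℕ) : ℚ × ℚ := (2 ^ p.1, 2 ^ p.2)

/-- The exponents of the point with index `c` in column `e`. -/
def pointExp (n : ℕ) (e : ℕ × ℕ) (c : ℕ) : ℕ × ℕ := (xExp n e.1 e.2 c, rowExp n e.1 e.2 c)

theorem ratPoint_injective : Function.Injective ratPoint := by
  intro p q h
  simp only [ratPoint, Prod.mk.injEq] at h
  exact Prod.ext (pow_right_injective₀ (by norm_num) (by norm_num) h.1)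
    (pow_right_injective₀ (by norm_num) (by norm_num) h.2)

/-- The points with indices `cs` in the columns `l`. -/
def colPoints (n : ℕ) (l : List (ℕ × ℕ)) (cs : List ℕ) : List (ℚ × ℚ) :=
  l.flatMap fun e => cs.map fun c => ratPoint (pointExp n e c)

/-- Lists of pairs `(i, j)` with `i < j < n`. -/
structure IsEdgeList (n : ℕ) (l : List (ℕ × ℕ)) : Prop where
  nodup : l.Nodup
  lt : ∀ e ∈ l, e.1 < e.2
  lt_n : ∀ e ∈ l, e.2 < n

theorem pointExp_inj {n : ℕ} {l : List (ℕ × ℕ)} (hl : IsEdgeList n l) {e e' : ℕ × ℕ} {c c' : ℕ}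
    (he : e ∈ l) (he' : e' ∈ l) (hc : c < 9) (hc' : c' < 9)
    (h : ratPoint (pointExp n e c) = ratPoint (pointExp n e' c')) : e = e' ∧ c = c' := by
  have h1 := congrArg Prod.fst (ratPoint_injective h)
  obtain ⟨h2, h3, h4⟩ := xExp_inj (hl.lt_n e he) (hl.lt_n e' he') hc hc' h1
  exact ⟨Prod.ext h2 h3, h4⟩

theorem colPoints_nodup {n : ℕ} {l : List (ℕ × ℕ)} (hl : IsEdgeList n l) {cs : List ℕ}
    (hcs : cs.Nodup) (hlt : ∀ c ∈ cs, c < 9) : (colPoints n l cs).Nodup := by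
  refine List.nodup_flatMap.2 ⟨fun e he => ?_, ?_⟩
  · refine List.Nodup.map_on (fun c hc c' hc' h => ?_) hcs
    exact (pointExp_inj hl he he (hlt c hc) (hlt c' hc') h).2
  · refine List.Pairwise.imp_of_mem ?_ hl.nodup
    intro e e' he he' hne p hp hp'
    obtain ⟨c, hc, rfl⟩ := List.mem_map.1 hp
    obtain ⟨c', hc', h⟩ := List.mem_map.1 hp'
    exact hne (pointExp_inj hl he' he (hlt c' hc') (hlt c hc) h).1.symm

theorem red_lt : ∀ c ∈ [0, 2, 3], c < 9 := by decide

theorem blue_lt : ∀ c ∈ [1, 4, 5, 6, 7, 8], c < 9 := by decide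

/-- The bichromatic point set of a graph with edge list `l`. -/
def gadget {n : ℕ} {l : List (ℕ × ℕ)} (hl : IsEdgeList n l) : BichromaticSet where
  red := colPoints n l [0, 2, 3]
  blue := colPoints n l [1, 4, 5, 6, 7, 8]
  red_nodup := colPoints_nodup hl (by decide) (by decide)
  blue_nodup := colPoints_nodup hl (by decide) (by decide)
  disjoint := by
    intro p hp hp'
    simp only [colPoints, List.mem_flatMap, List.mem_map] at hp hp'
    obtain ⟨e, he, c, hc, rfl⟩ := hp
    obtain ⟨e', he', c', hc', h⟩ := hp'
    have h1 := red_lt c hc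
    have h2 := blue_lt c' hc'
    obtain ⟨-, rfl⟩ := pointExp_inj hl he' he h2 h1 h
    simp at hc hc'
    omega

/-- The point with index `c` in column `e`. -/
noncomputable def colPoint (n : ℕ) (e : ℕ × ℕ) (c : ℕ) : ℝ × ℝ :=
  (2 ^ xExp n e.1 e.2 c, 2 ^ rowExp n e.1 e.2 c)

theorem toPlane_ratPoint (n : ℕ) (e : ℕ × ℕ) (c : ℕ) :
    toPlane (ratPoint (pointExp n e c)) = colPoint n e c := by
  simp [toPlane, ratPoint, pointExp, colPoint]

theorem exists_mem_colPoints {n : ℕ} {l : List (ℕ × ℕ)} {cs : List ℕ} {x : ℝ × ℝ} :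
    (∃ p ∈ colPoints n l cs, toPlane p = x) ↔ ∃ e ∈ l, ∃ c ∈ cs, colPoint n e c = x := by
  simp only [colPoints, List.mem_flatMap, List.mem_map]
  constructor
  · rintro ⟨_, ⟨e, he, c, hc, rfl⟩, rfl⟩
    exact ⟨e, he, c, hc, (toPlane_ratPoint n e c).symm⟩
  · rintro ⟨e, he, c, hc, rfl⟩
    exact ⟨_, ⟨e, he, c, hc, rfl⟩, toPlane_ratPoint n e c⟩

theorem mem_gadget_R {n : ℕ} {l : List (ℕ × ℕ)} (hl : IsEdgeList n l) {x : ℝ × ℝ} :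
    x ∈ (gadget hl).R ↔ ∃ e ∈ l, ∃ c ∈ [0, 2, 3], colPoint n e c = x :=
  exists_mem_colPoints

theorem mem_gadget_B {n : ℕ} {l : List (ℕ × ℕ)} (hl : IsEdgeList n l) {x : ℝ × ℝ} :
    x ∈ (gadget hl).B ↔ ∃ e ∈ l, ∃ c ∈ [1, 4, 5, 6, 7, 8], colPoint n e c = x :=
  exists_mem_colPoints

/-! ### General position -/

/-- When the third height dwarfs the second, the term containing `b₃` wins: its factor `a₂ - a₁` is
at least 1 in absolute value, whereas the other side is at most `T * (b₂ - b₁)`. -/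
theorem det_ne_zero {a₁ a₂ a₃ b₁ b₂ b₃ T : ℝ} (h12 : 1 ≤ |a₂ - a₁|) (h13 : |a₃ - a₁| ≤ T)
    (hT : 1 ≤ T) (hb : b₁ < b₂) (hb₁ : 0 < b₁) (h : 2 * T * b₂ ≤ b₃) :
    (a₂ - a₁) * (b₃ - b₁) ≠ (a₃ - a₁) * (b₂ - b₁) := by
  intro heq
  have h1 := congrArg abs heq
  have h3 : 0 < b₃ - b₁ := by nlinarith
  rw [abs_mul, abs_mul, abs_of_pos h3, abs_of_pos (sub_pos.2 hb)] at h1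
  have h4 : |a₂ - a₁| * (b₃ - b₁) ≥ 1 * (b₃ - b₁) := mul_le_mul_of_nonneg_right h12 h3.le
  have h5 : |a₃ - a₁| * (b₂ - b₁) ≤ T * (b₂ - b₁) :=
    mul_le_mul_of_nonneg_right h13 (sub_pos.2 hb).le
  nlinarith

theorem det_of_collinear {x y z : ℝ × ℝ} (h : Collinear ℝ ({x, y, z} : Set (ℝ × ℝ))) :
    (y.1 - x.1) * (z.2 - x.2) = (z.1 - x.1) * (y.2 - x.2) := by
  obtain ⟨v, hv⟩ := (collinear_iff_of_mem (p₀ := x) (by simp)).1 h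
  obtain ⟨r, rfl⟩ := hv y (by simp)
  obtain ⟨t, rfl⟩ := hv z (by simp)
  simp
  ring

theorem not_collinear_pow {M : ℕ} (hM : 0 < M) {a b r : Fin 3 → ℕ} (ha : a.Injective)
    (haM : ∀ i, a i < M) (hb : ∀ i, b i = M * (r i + 1)) (hbi : b.Injective) :
    ¬ Collinear ℝ ({((2 : ℝ) ^ a 0, (2 : ℝ) ^ b 0), (2 ^ a 1, 2 ^ b 1), (2 ^ a 2, 2 ^ b 2)} :
      Set (ℝ × ℝ)) := by
  intro h
  have hdet := det_of_collinear h
  simp only at hdet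
  have key : ∀ i j k : Fin 3, i ≠ j → b i < b j → b j < b k →
      ((2 : ℝ) ^ a j - 2 ^ a i) * (2 ^ b k - 2 ^ b i) ≠
        (2 ^ a k - 2 ^ a i) * (2 ^ b j - 2 ^ b i) := by
    intro i j k hij h1 h2
    have hpow : ∀ i, (2 : ℝ) ^ a i ≤ 2 ^ (M - 1) := fun i =>
      pow_le_pow_right₀ (by norm_num) (by have := haM i; omega)
    have hpos : ∀ m : ℕ, (0 : ℝ) < 2 ^ m := fun m => by positivity
    -- First coordinates are at most `2 ^ (M - 1)`, and distinct powers of two differ by at least 1.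
    -- Distinct multiples of `M` as exponents make consecutive heights differ by a factor of at
    -- least `2 ^ M = 2 * T`.
    refine det_ne_zero (T := 2 ^ (M - 1)) ?_ ?_ (one_le_pow₀ (by norm_num))
      (pow_lt_pow_right₀ (by norm_num) h1) (hpos _) ?_
    · have hne : ((2 : ℤ) ^ a j - 2 ^ a i) ≠ 0 := fun h0 =>
        hij (ha (pow_right_injective₀ (by norm_num) (by norm_num) (sub_eq_zero.1 h0))).symm
      exact_mod_cast Int.one_le_abs hne
    · rw [abs_le]
      constructor <;> linarith [hpow i, hpow k, hpos (a i), hpos (a k)]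
    · rw [← pow_succ', ← pow_add]
      refine pow_le_pow_right₀ (by norm_num) ?_
      rw [hb, hb] at h2 ⊢
      have h3 : r j + 1 + 1 ≤ r k + 1 := Nat.lt_of_mul_lt_mul_left h2
      have h4 := Nat.mul_le_mul_left M h3
      rw [Nat.mul_succ] at h4
      omega
  have hne : ∀ i j, i ≠ j → b i ≠ b j := fun i j h h' => h (hbi h')
  -- The estimate needs the three points sorted by height; the determinant only changes sign.
  rcases lt_or_gt_of_ne (hne 0 1 (by decide)) with h01 | h01 <;>
  rcases lt_or_gt_of_ne (hne 0 2 (by decide)) with h02 | h02 <;>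
  rcases lt_or_gt_of_ne (hne 1 2 (by decide)) with h12 | h12
  · exact key 0 1 2 (by decide) h01 h12 (by linear_combination hdet)
  · exact key 0 2 1 (by decide) h02 h12 (by linear_combination -hdet)
  · omega
  · exact key 2 0 1 (by decide) h02 h01 (by linear_combination hdet)
  · exact key 1 0 2 (by decide) h01 h02 (by linear_combination -hdet)
  · omega
  · exact key 1 2 0 (by decide) h12 h02 (by linear_combination hdet)
  · exact key 2 1 0 (by decide) h12 h01 (by linear_combination -hdet)

theorem gadget_generalPosition {n : ℕ} {l : List (ℕ × ℕ)} (hl : IsEdgeList n l) :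
    (gadget hl).GeneralPosition := by
  have hmem : ∀ x ∈ (gadget hl).R ∪ (gadget hl).B, ∃ e ∈ l, ∃ c < 9, colPoint n e c = x := by
    rintro x (hx | hx)
    · obtain ⟨e, he, c, hc, rfl⟩ := (mem_gadget_R hl).1 hx
      exact ⟨e, he, c, red_lt c hc, rfl⟩
    · obtain ⟨e, he, c, hc, rfl⟩ := (mem_gadget_B hl).1 hx
      exact ⟨e, he, c, blue_lt c hc, rfl⟩
  intro x hx y hy z hz hxy hxz hyz
  obtain ⟨e₀, he₀, c₀, hc₀, rfl⟩ := hmem x hx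
  obtain ⟨e₁, he₁, c₁, hc₁, rfl⟩ := hmem y hy
  obtain ⟨e₂, he₂, c₂, hc₂, rfl⟩ := hmem z hz
  set e : Fin 3 → ℕ × ℕ := ![e₀, e₁, e₂] with hedef
  set c : Fin 3 → ℕ := ![c₀, c₁, c₂] with hcdef
  have he : ∀ i, e i ∈ l := by intro i; fin_cases i <;> assumption
  have hc : ∀ i, c i < 9 := by intro i; fin_cases i <;> assumption
  have hinj : ∀ i j, e i = e j ∧ c i = c j → i = j := by
    intro i j h
    have : colPoint n (e i) (c i) = colPoint n (e j) (c j) := by rw [h.1, h.2]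
    fin_cases i <;> fin_cases j <;> first
      | rfl
      | exact absurd this hxy
      | exact absurd this hxz
      | exact absurd this hyz
      | exact absurd this.symm hxy
      | exact absurd this.symm hxz
      | exact absurd this.symm hyz
  have hn : 0 < n := (Nat.zero_le _).trans_lt (hl.lt_n _ he₀)
  choose r hr using fun i => exists_rowExp n (e i).1 (e i).2 (c i)
  refine not_collinear_pow (M := 10 * (n * (n + 1))) (by positivity)
    (a := fun i => xExp n (e i).1 (e i).2 (c i)) (b := fun i => rowExp n (e i).1 (e i).2 (c i))
    (r := r) (fun i j h => ?_) (fun i => ?_) hr fun i j h => ?_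
  · obtain ⟨h1, h2, h3⟩ := xExp_inj (hl.lt_n _ (he i)) (hl.lt_n _ (he j)) (hc i) (hc j) h
    exact hinj i j ⟨Prod.ext h1 h2, h3⟩
  · have h1 := pos_lt ((hl.lt _ (he i)).trans (hl.lt_n _ (he i))) (hl.lt_n _ (he i))
    have h2 := hc i
    simp only [xExp]
    omega
  · obtain ⟨h1, h2, h3⟩ := rowExp_inj (hl.lt _ (he i)) (hl.lt_n _ (he i)) (hl.lt _ (he j))
      (hl.lt_n _ (he j)) (hc i) (hc j) h
    exact hinj i j ⟨Prod.ext h1 h2, h3⟩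

end ClassCover

namespace ClassCover
open Computability (Γ' encodeNat decode_encodeNat)

/-! ### Boxes and half-strips -/

/-- A set which contains the bounding box of any two of its points. -/
def BoxConvex (U : Set (ℝ × ℝ)) : Prop :=
  ∀ p ∈ U, ∀ q ∈ U, ∀ r : ℝ × ℝ, r.1 ∈ Set.uIcc p.1 q.1 → r.2 ∈ Set.uIcc p.2 q.2 → r ∈ U

theorem BoxConvex.prod {s t : Set ℝ} (hs : s.OrdConnected) (ht : t.OrdConnected) :
    BoxConvex (s ×ˢ t) :=
  fun _ hp _ hq _ h1 h2 => ⟨hs.uIcc_subset hp.1 hq.1 h1, ht.uIcc_subset hp.2 hq.2 h2⟩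

/-- What is used about boxes and half-strips: their interiors are box convex, and inside of
`(0, T) × (0, T)` one finds all horizontal strips and all downward and upward half-strips. -/
structure StripClass (𝒦 : Set (Set (ℝ × ℝ))) : Prop where
  boxConvex : ∀ K ∈ 𝒦, BoxConvex (interior K)
  horizontal : ∀ T c d : ℝ, 0 < T → c < d → ∃ K ∈ 𝒦, ∀ p : ℝ × ℝ, 0 < p.1 → p.1 < T →
    (p ∈ interior K ↔ c < p.2 ∧ p.2 < d)
  downward : ∀ a b d : ℝ, a < b → 0 < d → ∃ K ∈ 𝒦, ∀ p : ℝ × ℝ, 0 < p.2 →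
    (p ∈ interior K ↔ (a < p.1 ∧ p.1 < b) ∧ p.2 < d)
  upward : ∀ T a b c : ℝ, a < b → c < T → ∃ K ∈ 𝒦, ∀ p : ℝ × ℝ, p.2 < T →
    (p ∈ interior K ↔ (a < p.1 ∧ p.1 < b) ∧ c < p.2)

theorem stripClass_boxes : StripClass boxes where
  boxConvex := by
    rintro _ ⟨a, b, c, d, -, -, rfl⟩
    rw [interior_prod_eq, interior_Icc, interior_Icc]
    exact BoxConvex.prod Set.ordConnected_Ioo Set.ordConnected_Ioo
  horizontal T c d hT hcd := by
    refine ⟨_, ⟨0, T, c, d, hT, hcd, rfl⟩, fun p h1 h2 => ?_⟩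
    rw [interior_prod_eq, interior_Icc, interior_Icc, Set.mem_prod, Set.mem_Ioo, Set.mem_Ioo]
    tauto
  downward a b d hab hd := by
    refine ⟨_, ⟨a, b, 0, d, hab, hd, rfl⟩, fun p h1 => ?_⟩
    rw [interior_prod_eq, interior_Icc, interior_Icc, Set.mem_prod, Set.mem_Ioo, Set.mem_Ioo]
    tauto
  upward T a b c hab hc := by
    refine ⟨_, ⟨a, b, c, T, hab, hc, rfl⟩, fun p h1 => ?_⟩
    rw [interior_prod_eq, interior_Icc, interior_Icc, Set.mem_prod, Set.mem_Ioo, Set.mem_Ioo]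
    tauto

theorem stripClass_halfStrips : StripClass halfStrips where
  boxConvex := by
    rintro _ ⟨a, b, c, -, rfl | rfl | rfl | rfl⟩ <;> rw [interior_prod_eq]
    · rw [interior_Icc, interior_Ici]
      exact BoxConvex.prod Set.ordConnected_Ioo Set.ordConnected_Ioi
    · rw [interior_Icc, interior_Iic]
      exact BoxConvex.prod Set.ordConnected_Ioo Set.ordConnected_Iio
    · rw [interior_Icc, interior_Ici]
      exact BoxConvex.prod Set.ordConnected_Ioi Set.ordConnected_Ioo
    · rw [interior_Icc, interior_Iic]
      exact BoxConvex.prod Set.ordConnected_Iio Set.ordConnected_Ioo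
  horizontal T c d _ hcd := by
    refine ⟨_, ⟨c, d, 0, hcd, .inr (.inr (.inl rfl))⟩, fun p h1 _ => ?_⟩
    rw [interior_prod_eq, interior_Icc, interior_Ici, Set.mem_prod, Set.mem_Ioi, Set.mem_Ioo]
    tauto
  downward a b d hab _ := by
    refine ⟨_, ⟨a, b, d, hab, .inr (.inl rfl)⟩, fun p _ => ?_⟩
    rw [interior_prod_eq, interior_Icc, interior_Iic, Set.mem_prod, Set.mem_Ioo, Set.mem_Iio]
  upward _ a b c hab _ := by
    refine ⟨_, ⟨a, b, c, hab, .inl rfl⟩, fun p _ => ?_⟩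
    rw [interior_prod_eq, interior_Icc, interior_Ici, Set.mem_prod, Set.mem_Ioo, Set.mem_Ioi]

/-! ### A class cover from a vertex cover -/

theorem xExp_lt_of_lt {n i j c c' : ℕ} (h : c < c') : xExp n i j c < xExp n i j c' := by
  unfold xExp
  omega

theorem rowExp_level {n i j : ℕ} {c : ℕ} (hc : c ∈ [1, 4, 5, 6, 7, 8]) :
    ∃ v k s, rowExp n i j c = yExp n i j v k s ∧ s < 3 ∧ (k = 0 ∨ k = 2 ∨ k = 3) := by
  simp only [List.mem_cons, List.not_mem_nil, or_false] at hc
  rcases hc with rfl | rfl | rfl | rfl | rfl | rfl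
  · exact ⟨i, 3, 1, rfl, by simp, by simp⟩
  · exact ⟨i, 0, 0, rfl, by simp, by simp⟩
  · exact ⟨i, 2, 0, rfl, by simp, by simp⟩
  · exact ⟨i, 3, 2, rfl, by simp, by simp⟩
  · exact ⟨j, 0, 0, rfl, by simp, by simp⟩
  · exact ⟨j, 2, 0, rfl, by simp, by simp⟩

theorem pow_two_lt_iff {a b : ℕ} : (2 : ℝ) ^ a < 2 ^ b ↔ a < b :=
  pow_lt_pow_iff_right₀ (by norm_num)

/-- Exponent of the lower side of the horizontal strip of the vertex `v`. -/
def stripLow (n v : ℕ) : ℕ := 10 * (n * (n + 1)) * (3 * ((4 * v + 1) * (n * (n + 1))))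

/-- Exponent of the upper side of the horizontal strip of the vertex `v`. -/
def stripHigh (n v : ℕ) : ℕ := 10 * (n * (n + 1)) * (3 * ((4 * v + 2) * (n * (n + 1))) + 1)

/-- The lower side lies below the first slot of level `4 * v + 1`, and the upper side is exactly the
first slot of the next level, excluded by strictness. -/
theorem mem_strip_iff {n i j w k s v : ℕ} (hi : i < n) (hj : j < n) (hs : s < 3) :
    stripLow n v < yExp n i j w k s ∧ yExp n i j w k s < stripHigh n v ↔ 4 * w + k = 4 * v + 1 := by
  have hp := pos_lt hi hj
  have hW : 0 < 10 * (n * (n + 1)) := by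
    have : 0 < n := by omega
    positivity
  unfold stripLow stripHigh yExp
  rw [Nat.mul_lt_mul_left hW, Nat.mul_lt_mul_left hW]
  generalize n * (n + 1) = W at *
  constructor
  · rintro ⟨h1, h2⟩
    by_contra hne
    rcases lt_or_gt_of_ne hne with h | h
    · have h3 := Nat.mul_le_mul_right W (Nat.succ_le_of_lt h)
      rw [Nat.succ_mul] at h3
      omega
    · have h3 := Nat.mul_le_mul_right W (show 4 * v + 2 ≤ 4 * w + k by omega)
      omega
  · intro h
    have h1 : (4 * v + 2) * W = (4 * v + 1) * W + W := Nat.succ_mul _ _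
    rw [h]
    omega

/-- One horizontal strip for each vertex in `C` covers the ends at these vertices, and one vertical
strip for each edge covers point 3 together with an end outside `C`, of which there is at most one.
-/
theorem exists_classCover {𝒦 : Set (Set (ℝ × ℝ))} (h𝒦 : StripClass 𝒦) {n : ℕ} {l : List (ℕ × ℕ)}
    (hl : IsEdgeList n l) (C : Finset ℕ) (hC : ∀ e ∈ l, e.1 ∈ C ∨ e.2 ∈ C) :
    ∃ Z, IsClassCover 𝒦 (gadget hl) Z ∧ Z.ncard ≤ C.card + l.length := by
  classical
  -- For boxes the strips have to be cut off somewhere; one more than the sum of all coordinates is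
  -- beyond every point.
  obtain ⟨T, hT0, hT⟩ : ∃ T : ℝ, 0 < T ∧ ∀ e ∈ l, ∀ c < 9,
      (colPoint n e c).1 < T ∧ (colPoint n e c).2 < T := by
    have hpos : ∀ e c, 0 < (colPoint n e c).1 ∧ 0 < (colPoint n e c).2 := fun e c => by
      constructor <;> simp [colPoint]
    refine ⟨1 + ∑ e ∈ l.toFinset, ∑ c ∈ Finset.range 9,
      ((colPoint n e c).1 + (colPoint n e c).2), ?_, fun e he c hc => ?_⟩
    · have : 0 ≤ ∑ e ∈ l.toFinset, ∑ c ∈ Finset.range 9,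
          ((colPoint n e c).1 + (colPoint n e c).2) :=
        Finset.sum_nonneg fun e _ => Finset.sum_nonneg fun c _ =>
          (add_pos (hpos e c).1 (hpos e c).2).le
      linarith
    · have h1 := Finset.single_le_sum (f := fun e => ∑ c ∈ Finset.range 9,
        ((colPoint n e c).1 + (colPoint n e c).2)) (fun e _ => Finset.sum_nonneg fun c _ =>
          (add_pos (hpos e c).1 (hpos e c).2).le) (List.mem_toFinset.2 he)
      have h2 := Finset.single_le_sum (f := fun c => (colPoint n e c).1 + (colPoint n e c).2)
        (fun c _ => (add_pos (hpos e c).1 (hpos e c).2).le) (Finset.mem_range.2 hc)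
      have h3 := hpos e c
      constructor <;> linarith
  have hx0 : ∀ e c, 0 < (colPoint n e c).1 := fun e c => by simp [colPoint]
  have hy0 : ∀ e c, 0 < (colPoint n e c).2 := fun e c => by simp [colPoint]
  -- the horizontal strips of the vertices
  have hH : ∀ v, ∃ K ∈ 𝒦, ∀ e ∈ l, ∀ c < 9, (colPoint n e c ∈ interior K ↔
      stripLow n v < rowExp n e.1 e.2 c ∧ rowExp n e.1 e.2 c < stripHigh n v) := by
    intro v
    -- For `n = 0` both sides of the strip coincide, but then there are no edges and any member will
    -- do.
    obtain rfl | hn := Nat.eq_zero_or_pos n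
    · obtain ⟨K, hK, -⟩ := h𝒦.horizontal 1 0 1 (by norm_num) (by norm_num)
      exact ⟨K, hK, fun e he => absurd (hl.lt_n e he) (by omega)⟩
    obtain ⟨K, hK, h⟩ := h𝒦.horizontal T (2 ^ stripLow n v) (2 ^ stripHigh n v) hT0 (by
      rw [pow_two_lt_iff]
      unfold stripLow stripHigh
      rw [Nat.mul_lt_mul_left (by positivity)]
      have := Nat.mul_le_mul_right (n * (n + 1)) (show 4 * v + 1 ≤ 4 * v + 2 by omega)
      omega)
    refine ⟨K, hK, fun e he c hc => ?_⟩
    rw [h _ (hx0 e c) (hT e he c hc).1]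
    simp only [colPoint, pow_two_lt_iff]
  choose H hH𝒦 hH using hH
  -- the half-strips of the edges
  have hD : ∀ e ∈ l, ∃ K ∈ 𝒦, (∀ e' ∈ l, ∀ c ∈ [1, 4, 5, 6, 7, 8], colPoint n e' c ∉ interior K) ∧
      colPoint n e 3 ∈ interior K ∧ (e.1 ∉ C → colPoint n e 0 ∈ interior K) ∧
      (e.2 ∉ C → colPoint n e 2 ∈ interior K) := by
    intro e he
    have hi := (hl.lt e he).trans (hl.lt_n e he)
    have hn : 0 < n := by omega
    -- From point 0 up to, but excluding, point 4, the only blue point of the whole configuration is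
    -- point 1 of the same column.
    have hlast : ∀ e' ∈ l, ∀ c ∈ [1, 4, 5, 6, 7, 8],
        xExp n e.1 e.2 0 ≤ xExp n e'.1 e'.2 c → xExp n e'.1 e'.2 c < xExp n e.1 e.2 4 →
        e' = e ∧ c = 1 := by
      intro e' he' c hc h1 h2
      have hc9 := blue_lt c hc
      unfold xExp at h1 h2
      obtain ⟨h3, h4⟩ := pos_inj (hl.lt_n e' he') (hl.lt_n e he)
        (show pos n e'.1 e'.2 = pos n e.1 e.2 by omega)
      simp only [List.mem_cons, List.not_mem_nil, or_false] at hc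
      rw [h3, h4] at h2
      exact ⟨Prod.ext h3 h4, by omega⟩
    by_cases h1 : e.1 ∈ C
    -- Point 0 is left to the strip of `e.1`. An upward strip strictly between points 1 and 4 meets
    -- no blue point and contains points 2 and 3.
    · obtain ⟨K, hK, h⟩ := h𝒦.upward T (2 ^ xExp n e.1 e.2 1) (2 ^ xExp n e.1 e.2 4)
        (2 ^ rowExp n e.1 e.2 0) (pow_two_lt_iff.2 (xExp_lt_of_lt (by norm_num)))
        (hT e he 0 (by norm_num)).2
      refine ⟨K, hK, fun e' he' c hc hmem => ?_, ?_, fun h' => absurd h1 h', fun _ => ?_⟩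
      · rw [h _ (hT e' he' c (blue_lt c hc)).2] at hmem
        simp only [colPoint, pow_two_lt_iff] at hmem
        obtain ⟨rfl, rfl⟩ := hlast e' he' c hc
          ((xExp_lt_of_lt (by norm_num)).trans hmem.1.1).le hmem.1.2
        exact hmem.1.1.false
      · rw [h _ (hT e he 3 (by norm_num)).2]
        simp only [colPoint, pow_two_lt_iff, rowExp]
        exact ⟨⟨xExp_lt_of_lt (by norm_num), xExp_lt_of_lt (by norm_num)⟩,
          yExp_lt_of_level hi (hl.lt_n e he) (by norm_num) (by omega)⟩
      · rw [h _ (hT e he 2 (by norm_num)).2]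
        simp only [colPoint, pow_two_lt_iff, rowExp]
        exact ⟨⟨xExp_lt_of_lt (by norm_num), xExp_lt_of_lt (by norm_num)⟩,
          yExp_lt_of_level hi (hl.lt_n e he) (by norm_num) (by have := hl.lt e he; omega)⟩
    · have h2 : e.2 ∈ C := (hC e he).resolve_left h1
      obtain ⟨K, hK, h⟩ := h𝒦.downward (2 ^ (xExp n e.1 e.2 0 - 1)) (2 ^ xExp n e.1 e.2 4)
        (2 ^ rowExp n e.1 e.2 1) (pow_two_lt_iff.2 (by unfold xExp; omega)) (by positivity)
      refine ⟨K, hK, fun e' he' c hc hmem => ?_, ?_, fun _ => ?_, fun h' => absurd h2 h'⟩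
      · rw [h _ (hy0 e' c)] at hmem
        simp only [colPoint, pow_two_lt_iff] at hmem
        obtain ⟨rfl, rfl⟩ := hlast e' he' c hc
          (by have := hmem.1.1; omega) hmem.1.2
        exact hmem.2.false
      · rw [h _ (hy0 e 3)]
        simp only [colPoint, pow_two_lt_iff, rowExp]
        exact ⟨⟨by unfold xExp; omega, xExp_lt_of_lt (by norm_num)⟩,
          yExp_lt_of_lt hn (by norm_num)⟩
      · rw [h _ (hy0 e 0)]
        simp only [colPoint, pow_two_lt_iff, rowExp]
        exact ⟨⟨by unfold xExp; omega, xExp_lt_of_lt (by norm_num)⟩,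
          yExp_lt_of_level hi (hl.lt_n e he) (by norm_num) (by omega)⟩
  choose! D hD𝒦 hDB hD3 hD0 hD2 using hD
  refine ⟨↑(C.image H ∪ l.toFinset.image D), ⟨Finset.finite_toSet _, ?_, ?_, ?_⟩, ?_⟩
  · intro K hK
    simp only [Finset.coe_union, Finset.coe_image, List.coe_toFinset] at hK
    obtain ⟨v, _, rfl⟩ | ⟨e, he, rfl⟩ := hK
    · exact hH𝒦 v
    · exact hD𝒦 e he
  · intro p hp
    obtain ⟨e, he, c, hc, rfl⟩ := (mem_gadget_R hl).1 hp
    have hi := (hl.lt e he).trans (hl.lt_n e he)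
    have hcov : ∀ v ∈ C, ∀ c < 9, rowExp n e.1 e.2 c = yExp n e.1 e.2 v 1 0 →
        ∃ K ∈ (↑(C.image H ∪ l.toFinset.image D) : Set (Set (ℝ × ℝ))),
          colPoint n e c ∈ interior K := by
      intro v hv c hc hrow
      refine ⟨H v, by simp; exact .inl ⟨v, hv, rfl⟩, (hH v e he c hc).2 ?_⟩
      rw [hrow]
      exact (mem_strip_iff hi (hl.lt_n e he) (by norm_num)).2 rfl
    have hcov' : colPoint n e c ∈ interior (D e) →
        ∃ K ∈ (↑(C.image H ∪ l.toFinset.image D) : Set (Set (ℝ × ℝ))),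
          colPoint n e c ∈ interior K :=
      fun h => ⟨D e, by simp only [Finset.coe_union, Finset.coe_image, List.coe_toFinset]; exact .inr ⟨e, he, rfl⟩, h⟩
    simp only [List.mem_cons, List.not_mem_nil, or_false] at hc
    rcases hc with rfl | rfl | rfl
    · by_cases h : e.1 ∈ C
      · exact hcov _ h 0 (by norm_num) rfl
      · exact hcov' (hD0 e he h)
    · by_cases h : e.2 ∈ C
      · exact hcov _ h 2 (by norm_num) rfl
      · exact hcov' (hD2 e he h)
    · exact hcov' (hD3 e he)
  · intro K hK p hp hmem
    obtain ⟨e, he, c, hc, rfl⟩ := (mem_gadget_B hl).1 hp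
    simp only [Finset.coe_union, Finset.coe_image, List.coe_toFinset] at hK
    obtain ⟨v, _, rfl⟩ | ⟨e', he', rfl⟩ := hK
    · rw [hH v e he c (blue_lt c hc)] at hmem
      obtain ⟨w, k, s, hrow, hs, hk⟩ := rowExp_level (n := n) (i := e.1) (j := e.2) hc
      rw [hrow, mem_strip_iff ((hl.lt e he).trans (hl.lt_n e he)) (hl.lt_n e he) hs] at hmem
      omega
    · exact hDB e' he' e he c hc hmem
  · rw [Set.ncard_coe_finset]
    exact (Finset.card_union_le _ _).trans (add_le_add Finset.card_image_le
      (Finset.card_image_le.trans (List.toFinset_card_le l)))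

end ClassCover

namespace ClassCover
open Computability (Γ' encodeNat decode_encodeNat)

/-! ### A vertex cover from a class cover -/

/-- `U` could be the interior of a member of a class cover of the point set of a graph. -/
structure IsFree (n : ℕ) (l : List (ℕ × ℕ)) (U : Set (ℝ × ℝ)) : Prop where
  boxConvex : BoxConvex U
  avoids : ∀ e ∈ l, ∀ c ∈ [1, 4, 5, 6, 7, 8], colPoint n e c ∉ U

/-- The red point with index `c` in column `e` belongs to the end `w` of `e`. -/
def IsEnd (e : ℕ × ℕ) (c w : ℕ) : Prop := c = 0 ∧ w = e.1 ∨ c = 2 ∧ w = e.2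

section

variable {n : ℕ} {l : List (ℕ × ℕ)} {U : Set (ℝ × ℝ)} {e e' : ℕ × ℕ} {c c' w w' : ℕ}

theorem IsEnd.le (h : IsEnd e c w) : c ≤ 3 := by
  obtain ⟨rfl, -⟩ | ⟨rfl, -⟩ := h <;> omega

theorem IsEnd.rowExp_eq (h : IsEnd e c w) : rowExp n e.1 e.2 c = yExp n e.1 e.2 w 1 0 := by
  obtain ⟨rfl, rfl⟩ | ⟨rfl, rfl⟩ := h <;> rfl

theorem IsEnd.exists_below (h : IsEnd e c w) :
    ∃ d ∈ [4, 5, 6, 7, 8], rowExp n e.1 e.2 d = yExp n e.1 e.2 w 0 0 := by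
  obtain ⟨rfl, rfl⟩ | ⟨rfl, rfl⟩ := h
  exacts [⟨4, by simp, rfl⟩, ⟨7, by simp, rfl⟩]

theorem IsEnd.exists_above (h : IsEnd e c w) :
    ∃ d ∈ [4, 5, 6, 7, 8], rowExp n e.1 e.2 d = yExp n e.1 e.2 w 2 0 := by
  obtain ⟨rfl, rfl⟩ | ⟨rfl, rfl⟩ := h
  exacts [⟨5, by simp, rfl⟩, ⟨8, by simp, rfl⟩]

/-- A blue point in the bounding box of two points of `U` would belong to `U` by box convexity. -/
theorem IsFree.not_between (hU : IsFree n l U) {f : ℕ × ℕ} {d : ℕ} (hf : f ∈ l)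
    (hd : d ∈ [1, 4, 5, 6, 7, 8]) (hc : colPoint n e c ∈ U) (hc' : colPoint n e' c' ∈ U)
    (hx : xExp n e.1 e.2 c ≤ xExp n f.1 f.2 d) (hx' : xExp n f.1 f.2 d ≤ xExp n e'.1 e'.2 c')
    (hy : rowExp n e.1 e.2 c < rowExp n f.1 f.2 d ∧ rowExp n f.1 f.2 d < rowExp n e'.1 e'.2 c' ∨
      rowExp n e'.1 e'.2 c' < rowExp n f.1 f.2 d ∧ rowExp n f.1 f.2 d < rowExp n e.1 e.2 c) :
    False := by
  refine hU.avoids f hf d hd (hU.boxConvex _ hc _ hc' _ ?_ ?_)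
  · exact Set.mem_uIcc.2 (.inl ⟨pow_le_pow_right₀ (by norm_num) hx,
      pow_le_pow_right₀ (by norm_num) hx'⟩)
  · refine Set.mem_uIcc.2 (hy.imp ?_ ?_) <;>
      exact fun h => ⟨(pow_two_lt_iff.2 h.1).le, (pow_two_lt_iff.2 h.2).le⟩

/-- The blue points behind the red points of a column separate these from all later columns. -/
theorem IsFree.not_mem_of_pos_lt (hU : IsFree n l U) (he : e ∈ l)
    (hpos : pos n e.1 e.2 < pos n e'.1 e'.2) (hc3 : c ≤ 3) {d : ℕ} (hd : d ∈ [4, 5, 6, 7, 8])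
    (hc : colPoint n e c ∈ U) (hc' : colPoint n e' c' ∈ U)
    (hy : rowExp n e.1 e.2 c < rowExp n e.1 e.2 d ∧ rowExp n e.1 e.2 d < rowExp n e'.1 e'.2 c' ∨
      rowExp n e'.1 e'.2 c' < rowExp n e.1 e.2 d ∧ rowExp n e.1 e.2 d < rowExp n e.1 e.2 c) :
    False := by
  have hd4 : 4 ≤ d ∧ d ≤ 8 := by
    simp only [List.mem_cons, List.not_mem_nil, or_false] at hd
    omega
  refine hU.not_between he (List.mem_cons_of_mem _ hd) hc hc' ?_ ?_ hy <;> unfold xExp <;> omega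

/-- Point 1 lies between points 0 and 2 horizontally, and on level 3 of block `e.1` it is above
level 1 of that block and below block `e.2`. -/
theorem IsFree.not_both_ends (hU : IsFree n l U) (hl : IsEdgeList n l) (he : e ∈ l)
    (h0 : colPoint n e 0 ∈ U) : colPoint n e 2 ∉ U := by
  intro h2
  have h1 := hl.lt e he
  have h3 := hl.lt_n e he
  refine hU.not_between he (d := 1) (by simp) h0 h2 (xExp_lt_of_lt (by norm_num)).le
    (xExp_lt_of_lt (by norm_num)).le (.inl ⟨?_, ?_⟩) <;>
  · simp only [rowExp]
    exact yExp_lt_of_level (h1.trans h3) h3 (by norm_num) (by omega)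

theorem pos_lt_or_gt (hl : IsEdgeList n l) (he : e ∈ l) (he' : e' ∈ l) (hne : e ≠ e') :
    pos n e.1 e.2 < pos n e'.1 e'.2 ∨ pos n e'.1 e'.2 < pos n e.1 e.2 := by
  refine lt_or_gt_of_ne fun h => hne ?_
  obtain ⟨h1, h2⟩ := pos_inj (hl.lt_n e he) (hl.lt_n e' he') h
  exact Prod.ext h1 h2

/-- Points 3 of successive columns rise, because a later column has at least the same first vertex
and heights on a level increase with the column. Point 6 of the earlier column, just above its point
3, lies between them. -/
theorem IsFree.eq_of_mem_three (hU : IsFree n l U) (hl : IsEdgeList n l) (he : e ∈ l)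
    (he' : e' ∈ l) (h : colPoint n e 3 ∈ U) (h' : colPoint n e' 3 ∈ U) : e = e' := by
  by_contra hne
  wlog hpos : pos n e.1 e.2 < pos n e'.1 e'.2 generalizing e e'
  · exact this he' he h' h (Ne.symm hne) ((pos_lt_or_gt hl he he' hne).resolve_left hpos)
  have h1 := hl.lt e he
  have h3 := hl.lt_n e he
  refine hU.not_mem_of_pos_lt he hpos (d := 6) le_rfl (by simp) h h' (.inl ⟨?_, ?_⟩) <;>
    simp only [rowExp]
  · exact yExp_lt_of_lt (by omega) (by norm_num)
  · obtain h4 | h4 := (le_of_pos_lt (hl.lt_n e' he') hpos).lt_or_eq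
    · exact yExp_lt_of_level (h1.trans h3) h3 (by norm_num) (by omega)
    · rw [← h4] at hpos ⊢
      exact yExp_lt_of_pos (by omega) (by norm_num) hpos

/-- The separating point is taken in the earlier column. If this is `e`, it is point 6 or point 5,
just above or on the level below point 3; if it is `e'`, it is the guard below or above the end.
Whether `e.1 < w` decides which, since level 3 of block `e.1` lies above the levels 1 of all blocks
up to its own and below those of later blocks. -/
theorem IsFree.eq_of_mem_three_of_end (hU : IsFree n l U) (hl : IsEdgeList n l) (he : e ∈ l)
    (he' : e' ∈ l) (h : colPoint n e 3 ∈ U) (hw : IsEnd e' c w) (h' : colPoint n e' c ∈ U) :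
    e = e' := by
  by_contra hne
  have h1 := hl.lt e he
  have h2 := hl.lt_n e he
  have h1' := hl.lt e' he'
  have h2' := hl.lt_n e' he'
  obtain hpos | hpos := pos_lt_or_gt hl he he' hne
  · obtain hlt | hle := lt_or_ge e.1 w
    · refine hU.not_mem_of_pos_lt he hpos (d := 6) le_rfl (by simp) h h' (.inl ?_)
      rw [hw.rowExp_eq]
      simp only [rowExp]
      exact ⟨yExp_lt_of_lt (by omega) (by norm_num),
        yExp_lt_of_level (h1.trans h2) h2 (by norm_num) (by omega)⟩
    · refine hU.not_mem_of_pos_lt he hpos (d := 5) le_rfl (by simp) h h' (.inr ?_)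
      rw [hw.rowExp_eq]
      simp only [rowExp]
      exact ⟨yExp_lt_of_level (h1'.trans h2') h2' (by norm_num) (by omega),
        yExp_lt_of_level (h1.trans h2) h2 (by norm_num) (by omega)⟩
  · obtain hlt | hle := lt_or_ge e.1 w
    · obtain ⟨d, hd, hrow⟩ := hw.exists_below (n := n)
      refine hU.not_mem_of_pos_lt he' hpos hw.le hd h' h (.inr ?_)
      rw [hw.rowExp_eq, hrow]
      simp only [rowExp]
      exact ⟨yExp_lt_of_level (h1.trans h2) h2 (by norm_num) (by omega),
        yExp_lt_of_level (h1'.trans h2') h2' (by norm_num) (by omega)⟩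
    · obtain ⟨d, hd, hrow⟩ := hw.exists_above (n := n)
      refine hU.not_mem_of_pos_lt he' hpos hw.le hd h' h (.inl ?_)
      rw [hw.rowExp_eq, hrow]
      simp only [rowExp]
      exact ⟨yExp_lt_of_level (h1'.trans h2') h2' (by norm_num) (by omega),
        yExp_lt_of_level (h1'.trans h2') h2' (by norm_num) (by omega)⟩

/-- If the vertices differ, the other end lies in another block, above or below both guards of the
end in the earlier column; the guard on that side separates them. -/
theorem IsFree.eq_of_mem_ends (hU : IsFree n l U) (hl : IsEdgeList n l) (he : e ∈ l)
    (he' : e' ∈ l) (hne : e ≠ e') (hw : IsEnd e c w) (h : colPoint n e c ∈ U)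
    (hw' : IsEnd e' c' w') (h' : colPoint n e' c' ∈ U) : w = w' := by
  by_contra hww
  wlog hpos : pos n e.1 e.2 < pos n e'.1 e'.2 generalizing e e' w w' c c'
  · exact this he' he (Ne.symm hne) hw' h' hw h (Ne.symm hww)
      ((pos_lt_or_gt hl he he' hne).resolve_left hpos)
  have h1 := hl.lt e he
  have h2 := hl.lt_n e he
  have h1' := hl.lt e' he'
  have h2' := hl.lt_n e' he'
  obtain hlt | hlt := lt_or_gt_of_ne hww
  · obtain ⟨d, hd, hrow⟩ := hw.exists_above (n := n)
    refine hU.not_mem_of_pos_lt he hpos hw.le hd h h' (.inl ?_)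
    rw [hw.rowExp_eq, hw'.rowExp_eq, hrow]
    exact ⟨yExp_lt_of_level (h1.trans h2) h2 (by norm_num) (by omega),
      yExp_lt_of_level (h1.trans h2) h2 (by norm_num) (by omega)⟩
  · obtain ⟨d, hd, hrow⟩ := hw.exists_below (n := n)
    refine hU.not_mem_of_pos_lt he hpos hw.le hd h h' (.inr ?_)
    rw [hw.rowExp_eq, hw'.rowExp_eq, hrow]
    exact ⟨yExp_lt_of_level (h1'.trans h2') h2' (by norm_num) (by omega),
      yExp_lt_of_level (h1.trans h2) h2 (by norm_num) (by omega)⟩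

end

open scoped Classical in
/-- The vertex chosen for the edge `e` if `U` covers the point with index `3` in column `e`. -/
noncomputable def chosen (n : ℕ) (U : Set (ℝ × ℝ)) (e : ℕ × ℕ) : ℕ :=
  if colPoint n e 0 ∈ U then e.2 else e.1

-- Counting distinct members of `Z`: the members `K e` for the edges, and for each chosen vertex a
-- member covering an end at this vertex which `K e` misses. Choosing the missed end is what keeps
-- the two families disjoint.
open scoped Classical in
theorem card_chosen_add_length_le {𝒦 : Set (Set (ℝ × ℝ))} (h𝒦 : StripClass 𝒦) {n : ℕ}
    {l : List (ℕ × ℕ)} (hl : IsEdgeList n l) {Z : Set (Set (ℝ × ℝ))}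
    (hZ : IsClassCover 𝒦 (gadget hl) Z) {K : ℕ × ℕ → Set (ℝ × ℝ)} (hKZ : ∀ e ∈ l, K e ∈ Z)
    (hK : ∀ e ∈ l, colPoint n e 3 ∈ interior (K e)) :
    (l.toFinset.image fun e => chosen n (interior (K e)) e).card + l.length ≤ Z.ncard := by
  have hfree : ∀ Y ∈ Z, IsFree n l (interior Y) := fun Y hY =>
    ⟨h𝒦.boxConvex Y (hZ.subset hY), fun e he c hc =>
      hZ.avoids_blue Y hY _ ((mem_gadget_B hl).2 ⟨e, he, c, hc, rfl⟩)⟩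
  -- By `not_both_ends`, `K e` misses the chosen end: point 2 if it contains point 0, and otherwise
  -- point 0. Some other member must cover it.
  have hB : ∀ v ∈ l.toFinset.image (fun e => chosen n (interior (K e)) e), ∃ e ∈ l, ∃ c, ∃ Y ∈ Z,
      IsEnd e c v ∧ v = chosen n (interior (K e)) e ∧ colPoint n e c ∉ interior (K e) ∧
        colPoint n e c ∈ interior Y := by
    intro v hv
    obtain ⟨e, he, rfl⟩ := Finset.mem_image.1 hv
    rw [List.mem_toFinset] at he
    by_cases h : colPoint n e 0 ∈ interior (K e)
    · obtain ⟨Y, hY, hmem⟩ :=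
        hZ.covers_red _ ((mem_gadget_R hl).2 ⟨e, he, 2, by simp, rfl⟩)
      exact ⟨e, he, 2, Y, hY, .inr ⟨rfl, if_pos h⟩, rfl,
        (hfree _ (hKZ e he)).not_both_ends hl he h, hmem⟩
    · obtain ⟨Y, hY, hmem⟩ :=
        hZ.covers_red _ ((mem_gadget_R hl).2 ⟨e, he, 0, by simp, rfl⟩)
      exact ⟨e, he, 0, Y, hY, .inl ⟨rfl, if_neg h⟩, rfl, h, hmem⟩
  choose! E hE cc Y hYZ hend hch hnot hmem using hB
  set C := l.toFinset.image fun e => chosen n (interior (K e)) e with hC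
  -- If two vertices got the same member, then either they come from the same edge, whose chosen
  -- vertex is unique, or `eq_of_mem_ends` identifies them.
  have h1 : (C.image Y).card = C.card := by
    refine Finset.card_image_of_injOn fun v hv v' hv' heq => ?_
    by_cases h : E v = E v'
    · rw [hch v hv, hch v' hv', h]
    · exact (hfree _ (hYZ v hv)).eq_of_mem_ends hl (hE v hv) (hE v' hv') h (hend v hv)
        (hmem v hv) (hend v' hv') (heq ▸ hmem v' hv')
  have h2 : (l.toFinset.image K).card = l.length := by
    rw [Finset.card_image_of_injOn, List.toFinset_card_of_nodup hl.nodup]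
    intro e he e' he' heq
    rw [Finset.mem_coe, List.mem_toFinset] at he he'
    exact (hfree _ (hKZ e he)).eq_of_mem_three hl he he' (hK e he) (heq ▸ hK e' he')
  -- A common member would contain point 3 of `e` and an end of `E v`, so `e = E v`; but `K (E v)`
  -- misses that end.
  have h3 : Disjoint (C.image Y) (l.toFinset.image K) := by
    rw [Finset.disjoint_left]
    intro X hX hX'
    obtain ⟨v, hv, rfl⟩ := Finset.mem_image.1 hX
    obtain ⟨e, he, heq⟩ := Finset.mem_image.1 hX'
    rw [List.mem_toFinset] at he
    have h4 := (hfree _ (hKZ e he)).eq_of_mem_three_of_end hl he (hE v hv) (hK e he) (hend v hv)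
      (heq ▸ hmem v hv)
    refine hnot v hv ?_
    rw [← h4, heq, h4]
    exact hmem v hv
  rw [← h1, ← h2, ← Finset.card_union_of_disjoint h3, ← Set.ncard_coe_finset]
  refine Set.ncard_le_ncard ?_ hZ.finite
  intro X hX
  simp only [Finset.coe_union, Finset.coe_image, List.coe_toFinset] at hX
  obtain ⟨v, hv, rfl⟩ | ⟨e, he, rfl⟩ := hX
  · exact hYZ v hv
  · exact hKZ e he

end ClassCover

namespace ClassCover
open Computability (Γ' encodeNat decode_encodeNat)

/-! ### Binary numbers -/

theorem binVal_encodePosNum (p : PosNum) {t : List Γ'} (ht : binVal t = 0) :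
    binVal ((Computability.encodePosNum p).map Γ'.bit ++ t) = p := by
  induction p with
  | one => simp [Computability.encodePosNum, binVal, ht]
  | bit0 p ih => simp [Computability.encodePosNum, binVal, ih]; omega
  | bit1 p ih => simp [Computability.encodePosNum, binVal, ih]; omega

theorem binVal_encNat (m : ℕ) {t : List Γ'} (ht : binVal t = 0) : binVal (encNat m ++ t) = m := by
  unfold encNat encodeNat
  conv_rhs => rw [← Num.to_of_nat m]
  cases (m : Num) with
  | zero => simpa [Computability.encodeNum] using ht
  | pos p => exact binVal_encodePosNum p ht

theorem binVal_replicate (a : ℕ) (l : List Γ') :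
    binVal (List.replicate a (Γ'.bit false) ++ l) = 2 ^ a * binVal l := by
  induction a with
  | zero => simp
  | succ a ih => simp [List.replicate_succ, binVal, ih, pow_succ]; ring

theorem exists_posNum_pow (a : ℕ) : ∃ p : PosNum, (p : ℕ) = 2 ^ a ∧
    Computability.encodePosNum p = List.replicate a false ++ [true] := by
  induction a with
  | zero => exact ⟨1, rfl, rfl⟩
  | succ a ih =>
    obtain ⟨p, h1, h2⟩ := ih
    refine ⟨p.bit0, ?_, ?_⟩
    · rw [PosNum.cast_bit0, h1]; ring
    · simp [Computability.encodePosNum, h2, List.replicate_succ]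

theorem encNat_pow (a : ℕ) :
    encNat (2 ^ a) = List.replicate a (Γ'.bit false) ++ [Γ'.bit true] := by
  obtain ⟨p, h1, h2⟩ := exists_posNum_pow a
  have h3 : ((2 ^ a : ℕ) : Num) = Num.pos p := by
    rw [← h1]
    exact Num.of_to_nat (Num.pos p)
  unfold encNat encodeNat
  rw [h3]
  simp [Computability.encodeNum, h2]

theorem encRat_pow (a : ℕ) : encRat (2 ^ a) = powWord a := by
  have h1 : ((2 : ℚ) ^ a) = ((2 ^ a : ℕ) : ℚ) := by push_cast; rfl
  have h3 := encNat_pow 0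
  rw [h1]
  unfold encRat powWord
  rw [Rat.num_natCast, Rat.den_natCast, Int.natAbs_natCast, encNat_pow]
  simp only [pow_zero, List.replicate_zero, List.nil_append] at h3
  simp [h3]

theorem encPoint_ratPoint (p : ℕ × ℕ) : encPoint (ratPoint p) = pointWord p.1 p.2 := by
  simp [encPoint, ratPoint, pointWord, encRat_pow]

/-! ### The word of a graph -/

/-- The edges of the graph given by the word `w`. -/
def edges (w : List Γ') (n : ℕ) : List (ℕ × ℕ) :=
  (List.range n ×ˢ List.range n).filter fun e => isEdge w n e.1 e.2

theorem mem_edges {w : List Γ'} {n : ℕ} {e : ℕ × ℕ} :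
    e ∈ edges w n ↔ (e.1 < n ∧ e.2 < n) ∧ isEdge w n e.1 e.2 = true := by
  obtain ⟨i, j⟩ := e
  simp [edges]

theorem isEdgeList_edges (w : List Γ') (n : ℕ) : IsEdgeList n (edges w n) where
  nodup := (List.nodup_range.product List.nodup_range).filter _
  lt e he := by
    have := (mem_edges.1 he).2
    simp [isEdge] at this
    exact this.1
  lt_n e he := (mem_edges.1 he).1.2

/-- The nested loops visit the pairs in the order of the product list, so the word produced is
literally the encoding of the listed points, not just of the same set. -/
theorem overEdges_eq (g : ℕ → ℕ → ℕ → List Γ') (w : List Γ') (n : ℕ) :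
    overEdges g w n = (edges w n).flatMap fun e => g n e.1 e.2 := by
  have key : ∀ l : List (ℕ × ℕ), (l.filter fun e => isEdge w n e.1 e.2).flatMap
      (fun e => g n e.1 e.2) = l.flatMap fun e => bif isEdge w n e.1 e.2 then g n e.1 e.2 else [] := by
    intro l
    induction l with
    | nil => rfl
    | cons e l ih =>
      cases h : isEdge w n e.1 e.2 <;> simp [h, ih]
  unfold overEdges edges
  rw [key]
  simp [SProd.sprod, List.product, List.flatMap_assoc, List.flatMap_map]

theorem getElem?_flatMap {α β : Type} (f : α → List β) {m : ℕ} (hf : ∀ a, (f a).length = m)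
    (l : List α) (i j : ℕ) (hj : j < m) :
    (l.flatMap f)[i * m + j]? = (l[i]?).bind fun a => (f a)[j]? := by
  induction l generalizing i with
  | nil => simp
  | cons a l ih =>
    cases i with
    | zero => simp [List.getElem?_append_left (show j < (f a).length by rw [hf]; exact hj)]
    | succ i =>
      rw [List.flatMap_cons, List.getElem?_append_right (by rw [hf]; nlinarith), hf,
        show (i + 1) * m + j - m = i * m + j by rw [Nat.succ_mul]; omega, ih]
      simp

theorem count_comma_enc (G : FinGraph) : G.enc.count Γ'.comma = G.n := by
  have : ∀ C : Set (Fin G.n), (encSubset C).count Γ'.comma = 0 := fun C =>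
    List.count_eq_zero.2 (by simp [encSubset])
  simp [FinGraph.enc, List.count_flatMap, Function.comp_def, this]

/-- A row of the matrix with its comma has length `n + 1`, so `pos` is also the place of the entry
`(i, j)`. The test `i < j` keeps each undirected edge once. -/
theorem mem_edges_enc (G : FinGraph) {e : ℕ × ℕ} : e ∈ edges G.enc G.n ↔
    ∃ u v : Fin G.n, u < v ∧ G.graph.Adj u v ∧ e = (u.1, v.1) := by
  obtain ⟨i, j⟩ := e
  have hget : ∀ (hi : i < G.n) (hj : j < G.n), (G.enc.drop (pos G.n i j)).head? =
      some (Γ'.bit (@decide (G.graph.Adj ⟨i, hi⟩ ⟨j, hj⟩) (Classical.propDecidable _))) := by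
    intro hi hj
    rw [List.head?_drop]
    unfold pos FinGraph.enc
    rw [getElem?_flatMap _ (by simp [encSubset]) _ _ _ (by omega)]
    simp [encSubset, hi, hj, List.getElem?_append_left]
  rw [mem_edges]
  constructor
  · rintro ⟨⟨hi, hj⟩, h⟩
    simp only [isEdge, hget hi hj] at h
    simp at h
    exact ⟨⟨i, hi⟩, ⟨j, hj⟩, h.1, h.2, rfl⟩
  · rintro ⟨⟨u, hu⟩, ⟨v, hv⟩, huv, hadj, h⟩
    simp only [Prod.mk.injEq] at h
    obtain ⟨rfl, rfl⟩ := h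
    refine ⟨⟨hu, hv⟩, ?_⟩
    simp only [isEdge, hget hu hv]
    simpa [hadj] using huv

/-- The bichromatic point set of a graph. -/
noncomputable def FinGraph.gadget (G : FinGraph) : BichromaticSet :=
  ClassCover.gadget (isEdgeList_edges G.enc G.n)

theorem enc_gadget (G : FinGraph) : G.gadget.enc = reductionWord G.enc := by
  unfold BichromaticSet.enc FinGraph.gadget ClassCover.gadget reductionWord encList colPoints
  rw [count_comma_enc, overEdges_eq, overEdges_eq]
  simp [List.flatMap_assoc, encPoint_ratPoint, pointExp, redWord, blueWord, rowExp]

end ClassCover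

namespace ClassCover
open Computability (Γ' encodeNat decode_encodeNat)

/-! ### Reading the word of a class cover -/

theorem after_append {a : Γ'} {u : List Γ'} (hu : a ∉ u) (t : List Γ') :
    after a (u ++ a :: t) = t := by
  induction u with
  | nil => simp [after]
  | cons b u ih =>
    rw [List.mem_cons, not_or] at hu
    simp [after, Ne.symm hu.1, ih hu.2]

theorem not_mem_encNat {a : Γ'} (ha : ∀ b, a ≠ Γ'.bit b) (m : ℕ) : a ∉ encNat m := by
  intro h
  obtain ⟨b, -, hb⟩ := List.mem_map.1 h
  exact ha b hb.symm

theorem after_comma_encRat (q : ℚ) (t : List Γ') :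
    after Γ'.comma (encRat q ++ t) = encNat q.den ++ Γ'.ket :: t := by
  have h : encRat q ++ t = ([Γ'.bra, Γ'.bit (decide (q < 0))] ++ encNat q.num.natAbs) ++
      Γ'.comma :: (encNat q.den ++ Γ'.ket :: t) := by simp [encRat]
  rw [h, after_append]
  simp [not_mem_encNat]

theorem after_ket_encRat (q : ℚ) (t : List Γ') : after Γ'.ket (encRat q ++ t) = t := by
  have h : encRat q ++ t = ([Γ'.bra, Γ'.bit (decide (q < 0))] ++ encNat q.num.natAbs ++
      [Γ'.comma] ++ encNat q.den) ++ Γ'.ket :: t := by simp [encRat]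
  rw [h, after_append]
  simp [not_mem_encNat]

theorem skipSide_encSide (o : Option ℚ) (t : List Γ') : skipSide (encSide o ++ t) = t := by
  cases o with
  | none => rfl
  | some q => exact after_ket_encRat q t

theorem drop_two_encRat (q : ℚ) (t : List Γ') : (encRat q ++ t).drop 2 =
    encNat q.num.natAbs ++ Γ'.comma :: (encNat q.den ++ Γ'.ket :: t) := by
  simp [encRat]

theorem head?_drop_one_encRat (q : ℚ) (t : List Γ') :
    ((encRat q ++ t).drop 1).head? = some (Γ'.bit (decide (q < 0))) := by
  simp [encRat]

theorem lt_pow_iff {q : ℚ} (hq : 0 ≤ q) (a : ℕ) :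
    q < 2 ^ a ↔ q.num.natAbs < 2 ^ a * q.den := by
  have h1 : (q.num.natAbs : ℚ) = q.num := by
    rw [Nat.cast_natAbs, abs_of_nonneg (Rat.num_nonneg.2 hq)]
  have h2 : (0 : ℚ) < q.den := by exact_mod_cast q.den_pos
  rw [← Nat.cast_lt (α := ℚ), h1]
  conv_lhs => rw [← Rat.num_div_den q, div_lt_iff₀ h2]
  push_cast
  rfl

theorem pow_lt_iff {q : ℚ} (hq : 0 ≤ q) (a : ℕ) :
    2 ^ a < q ↔ 2 ^ a * q.den < q.num.natAbs := by
  have h1 : (q.num.natAbs : ℚ) = q.num := by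
    rw [Nat.cast_natAbs, abs_of_nonneg (Rat.num_nonneg.2 hq)]
  have h2 : (0 : ℚ) < q.den := by exact_mod_cast q.den_pos
  rw [← Nat.cast_lt (α := ℚ), h1]
  conv_lhs => rw [← Rat.num_div_den q, lt_div_iff₀ h2]
  push_cast
  rfl

theorem sideBelow_encSide (o : Option ℚ) (t : List Γ') (a : ℕ) :
    sideBelow (encSide o ++ t) a = true ↔ ∀ q ∈ o, (q : ℝ) < 2 ^ a := by
  cases o with
  | none => simp [encSide, sideBelow]
  | some q =>
    have h0 : ((encRat q ++ t).head? == some Γ'.blank) = false := by simp [encRat]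
    have h1 : ((q : ℝ) < 2 ^ a) ↔ q < 2 ^ a := by exact_mod_cast Iff.rfl
    simp only [encSide, sideBelow, h0, after_comma_encRat, drop_two_encRat, binLt_eq,
      head?_drop_one_encRat]
    rw [binVal_replicate, binVal_encNat _ rfl, binVal_encNat _ rfl]
    simp only [Option.mem_def, Option.some.injEq, forall_eq', h1]
    by_cases hq : q < 0
    · simpa [hq] using hq.trans (by positivity)
    · simp [hq, lt_pow_iff (not_lt.1 hq)]

theorem sideAbove_encSide (o : Option ℚ) (t : List Γ') (a : ℕ) :
    sideAbove (encSide o ++ t) a = true ↔ ∀ q ∈ o, (2 : ℝ) ^ a < (q : ℝ) := by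
  cases o with
  | none => simp [encSide, sideAbove]
  | some q =>
    have h0 : ((encRat q ++ t).head? == some Γ'.blank) = false := by simp [encRat]
    have h1 : ((2 : ℝ) ^ a < (q : ℝ)) ↔ 2 ^ a < q := by exact_mod_cast Iff.rfl
    simp only [encSide, sideAbove, h0, after_comma_encRat, drop_two_encRat, binLt_eq,
      head?_drop_one_encRat]
    rw [binVal_replicate, binVal_encNat _ rfl, binVal_encNat _ rfl]
    simp only [Option.mem_def, Option.some.injEq, forall_eq', h1]
    by_cases hq : q < 0
    · simpa [hq] using hq.le.trans (by positivity)
    · simp [hq, pow_lt_iff (not_lt.1 hq)]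

theorem interior_region (K : BoxCode) : interior K.region =
    {x | (∀ q ∈ K.left, (q : ℝ) < x.1) ∧ (∀ q ∈ K.right, x.1 < (q : ℝ)) ∧
      (∀ q ∈ K.bottom, (q : ℝ) < x.2) ∧ (∀ q ∈ K.top, x.2 < (q : ℝ))} := by
  have hge : ∀ o : Option ℚ, interior {x : ℝ | ∀ q ∈ o, (q : ℝ) ≤ x} = {x | ∀ q ∈ o, (q : ℝ) < x} := by
    rintro (_ | q)
    · simp
    · simp only [Option.mem_def, Option.some.injEq, forall_eq']
      exact interior_Ici (a := (q : ℝ))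
  have hle : ∀ o : Option ℚ, interior {x : ℝ | ∀ q ∈ o, x ≤ (q : ℝ)} = {x | ∀ q ∈ o, x < (q : ℝ)} := by
    rintro (_ | q)
    · simp
    · simp only [Option.mem_def, Option.some.injEq, forall_eq']
      exact interior_Iic (a := (q : ℝ))
  have h : K.region = ({x : ℝ | ∀ q ∈ K.left, (q : ℝ) ≤ x} ∩ {x | ∀ q ∈ K.right, x ≤ (q : ℝ)}) ×ˢ
      ({x : ℝ | ∀ q ∈ K.bottom, (q : ℝ) ≤ x} ∩ {x | ∀ q ∈ K.top, x ≤ (q : ℝ)}) := by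
    ext x
    simp only [BoxCode.region, Set.mem_ofPred_eq, Set.mem_prod, Set.mem_inter_iff]
    tauto
  rw [h, interior_prod_eq, interior_inter, interior_inter, hge, hle, hge, hle]
  ext x
  simp only [Set.mem_ofPred_eq, Set.mem_prod, Set.mem_inter_iff]
  tauto

theorem enc_append (K : BoxCode) (t : List Γ') : K.enc ++ t = Γ'.bra :: (encSide K.left ++
    (encSide K.right ++ (encSide K.bottom ++ (encSide K.top ++ Γ'.ket :: t)))) := by
  simp [BoxCode.enc]

theorem boxCovers_enc (K : BoxCode) (t : List Γ') (a b : ℕ) :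
    boxCovers (K.enc ++ t) a b = true ↔ ((2 : ℝ) ^ a, (2 : ℝ) ^ b) ∈ interior K.region := by
  rw [enc_append, interior_region]
  simp only [boxCovers, List.tail_cons, skipSide_encSide, Bool.and_eq_true, sideBelow_encSide,
    sideAbove_encSide, Set.mem_ofPred_eq]

theorem isBox_enc (K : BoxCode) (t : List Γ') : isBox (K.enc ++ t) = true := by
  rw [enc_append]
  cases K.left <;> simp [isBox, encSide, encRat]

theorem flatMap_drop_cons (g : List Γ' → List Γ') (c : Γ') (s : List Γ') :
    ((List.range (c :: s).length).flatMap fun k => g ((c :: s).drop k)) =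
      g (c :: s) ++ (List.range s.length).flatMap fun k => g (s.drop k) := by
  simp [List.range_succ_eq_map, List.flatMap_map]

theorem flatMap_drop_append {g : List Γ' → List Γ'} {u : List Γ'} (s : List Γ')
    (h : ∀ k < u.length, g (u.drop k ++ s) = []) :
    ((List.range (u ++ s).length).flatMap fun k => g ((u ++ s).drop k)) =
      (List.range s.length).flatMap fun k => g (s.drop k) := by
  induction u with
  | nil => rfl
  | cons c u ih =>
    rw [List.cons_append, flatMap_drop_cons, show g (c :: (u ++ s)) = [] from h 0 (by simp),
      List.nil_append]
    exact ih fun k hk => h (k + 1) (by simpa using hk)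

theorem isBox_cons_eq_false {c : Γ'} (hc : c ≠ Γ'.bra) (s : List Γ') : isBox (c :: s) = false := by
  simp [isBox, hc]

/-- Inside a side, a bracket `bra` occurs only at the start of a rational number, where a digit
follows. The scan thus never mistakes part of a box for a box. -/
theorem isBox_drop_encSide (o : Option ℚ) (s : List Γ') (k : ℕ) (hk : k < (encSide o).length) :
    isBox ((encSide o).drop k ++ s) = false := by
  cases o with
  | none =>
    obtain rfl : k = 0 := by simpa [encSide] using hk
    rfl
  | some q =>
    cases k with
    | zero => cases h : decide (q < 0) <;> simp [isBox, encSide, encRat, h]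
    | succ k =>
      rw [List.drop_eq_getElem_cons hk]
      refine isBox_cons_eq_false ?_ _
      have hmem : (encSide (some q))[k + 1] ∈ (encRat q).tail :=
        List.mem_iff_getElem.2 ⟨k, by simpa [encSide] using Nat.lt_sub_of_add_lt hk, by simp [encSide]⟩
      intro h
      rw [h] at hmem
      simp [encRat, not_mem_encNat] at hmem

/-- Only suffixes starting at the beginning of a box contribute, and the judgement does not depend
on what follows the box. Scanning positions is therefore the same as running through the list. -/
theorem flatMap_judge (a b a' b' : ℕ) (L : List BoxCode) :
    ((List.range (L.flatMap BoxCode.enc ++ [Γ'.ket]).length).flatMap fun k =>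
      judge a b a' b' ((L.flatMap BoxCode.enc ++ [Γ'.ket]).drop k)) =
      L.flatMap fun K => judge a b a' b' K.enc := by
  induction L with
  | nil => rfl
  | cons K L ih =>
    rw [List.flatMap_cons, List.flatMap_cons, List.append_assoc]
    generalize L.flatMap BoxCode.enc ++ [Γ'.ket] = t at ih ⊢
    have hside : ∀ (o : Option ℚ) (k : ℕ) (s : List Γ'), k < (encSide o).length →
        judge a b a' b' ((encSide o).drop k ++ s) = [] := fun o k s hk => by
      simp [judge, isBox_drop_encSide o s k hk]
    have hb : ∀ x y, boxCovers (K.enc ++ t) x y = boxCovers K.enc x y := fun x y => by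
      rw [Bool.eq_iff_iff, boxCovers_enc, ← boxCovers_enc K [], List.append_nil]
    have hi : isBox (K.enc ++ t) = isBox K.enc := by
      rw [isBox_enc, ← isBox_enc K [], List.append_nil]
    have hj : judge a b a' b' (K.enc ++ t) = judge a b a' b' K.enc := by
      simp only [judge, hb, hi]
    rw [← ih, ← hj, enc_append, flatMap_drop_cons, flatMap_drop_append _ fun k hk => hside _ _ _ hk,
      flatMap_drop_append _ fun k hk => hside _ _ _ hk,
      flatMap_drop_append _ fun k hk => hside _ _ _ hk,
      flatMap_drop_append _ fun k hk => hside _ _ _ hk, flatMap_drop_cons]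
    simp [judge, isBox_cons_eq_false]

theorem judge_enc (K : BoxCode) (a b a' b' : ℕ) : judge a b a' b' K.enc =
    bif boxCovers K.enc a b then [Γ'.bit (boxCovers K.enc a' b')] else [] := by
  have h : isBox K.enc = true := by simpa using isBox_enc K []
  simp only [judge, h, Bool.true_and]
  cases boxCovers K.enc a' b' <;> rfl

/-- The first digit produced comes from the first box covering the first point. The same box answers
the question about the second point, so its role as the member `K e` is consistent. -/
theorem exists_firstCovers {L : List BoxCode} {a b : ℕ} (a' b' : ℕ)
    (h : ∃ K ∈ L, ((2 : ℝ) ^ a, (2 : ℝ) ^ b) ∈ interior K.region) :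
    ∃ K ∈ L, ((2 : ℝ) ^ a, (2 : ℝ) ^ b) ∈ interior K.region ∧
      (firstCovers (encList BoxCode.enc L) a b a' b' = true ↔
        ((2 : ℝ) ^ a', (2 : ℝ) ^ b') ∈ interior K.region) := by
  have hcov : ∀ K : BoxCode, ∀ x y : ℕ, boxCovers K.enc x y = true ↔
      ((2 : ℝ) ^ x, (2 : ℝ) ^ y) ∈ interior K.region := fun K x y => by
    simpa using boxCovers_enc K [] x y
  have htail : (encList BoxCode.enc L).tail = L.flatMap BoxCode.enc ++ [Γ'.ket] := by
    simp [encList]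
  unfold firstCovers
  rw [htail, flatMap_judge]
  simp only [← hcov] at h ⊢
  clear htail
  induction L with
  | nil => simp at h
  | cons K L ih =>
    by_cases hK : boxCovers K.enc a b = true
    · exact ⟨K, List.mem_cons_self, hK, by simp [judge_enc, hK]⟩
    · obtain ⟨K', hK', h1⟩ := ih (by simpa [hK] using h)
      exact ⟨K', List.mem_cons_of_mem _ hK', by simpa [judge_enc, hK] using h1⟩

end ClassCover

namespace ClassCover
open Computability (Γ' encodeNat decode_encodeNat)

/-! ### The approximation preserving reduction -/

open scoped Classical in
/-- A graph of maximum degree `d` has at most `d` edges per vertex of a vertex cover. -/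
theorem length_edges_le {G : FinGraph} {d : ℕ} (hG : G.MaxDegreeLE d) {C : Set (Fin G.n)}
    (hC : G.graph.IsVertexCover C) : (edges G.enc G.n).length ≤ d * C.ncard := by
  -- Every edge is recovered as a sorted pair from one of its ends in `C` and a neighbour of that
  -- end.
  have hsub : (edges G.enc G.n).toFinset ⊆ C.toFinset.biUnion fun v =>
      (G.graph.neighborSet v).toFinset.image fun u => (min v.1 u.1, max v.1 u.1) := by
    intro e he
    obtain ⟨u, v, huv, hadj, rfl⟩ := (mem_edges_enc G).1 (List.mem_toFinset.1 he)
    have huv' : u.1 ≤ v.1 := huv.le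
    simp only [Finset.mem_biUnion, Finset.mem_image, Set.mem_toFinset, SimpleGraph.mem_neighborSet]
    obtain h | h := hC hadj
    · exact ⟨u, h, v, hadj, by rw [min_eq_left huv', max_eq_right huv']⟩
    · exact ⟨v, h, u, hadj.symm, by rw [min_eq_right huv', max_eq_left huv']⟩
  rw [← List.toFinset_card_of_nodup (isEdgeList_edges G.enc G.n).nodup,
    Set.ncard_eq_toFinset_card', mul_comm]
  refine (Finset.card_le_card hsub).trans (Finset.card_biUnion_le_card_mul _ _ _ fun v _ => ?_)
  refine Finset.card_image_le.trans ?_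
  rw [← Set.ncard_eq_toFinset_card']
  exact hG v

theorem exists_classCover_of_isVertexCover {𝒦 : Set (Set (ℝ × ℝ))} (h𝒦 : StripClass 𝒦)
    (G : FinGraph) {C : Set (Fin G.n)} (hC : G.graph.IsVertexCover C) :
    ∃ Z, IsClassCover 𝒦 G.gadget Z ∧ Z.ncard ≤ C.ncard + (edges G.enc G.n).length := by
  classical
  obtain ⟨Z, hZ, hcard⟩ := exists_classCover h𝒦 (isEdgeList_edges G.enc G.n)
    (C.toFinset.image Fin.val) (by
      intro e he
      obtain ⟨u, v, -, hadj, rfl⟩ := (mem_edges_enc G).1 he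
      refine (hC hadj).imp ?_ ?_ <;> exact fun h => Finset.mem_image_of_mem _ (by simpa using h))
  refine ⟨Z, hZ, hcard.trans (Nat.add_le_add_right ?_ _)⟩
  rw [Set.ncard_eq_toFinset_card']
  exact Finset.card_image_le

-- `K e` is any choice of boxes on which the answers of `firstCovers` are correct; the word then
-- spells the set of the vertices `chosen` with respect to these boxes.
open scoped Classical in
theorem coverWord_eq {G : FinGraph} {L : List BoxCode} {K : ℕ × ℕ → BoxCode}
    (hK : ∀ e ∈ edges G.enc G.n, (firstCovers (encList BoxCode.enc L) (xExp G.n e.1 e.2 3)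
      (rowExp G.n e.1 e.2 3) (xExp G.n e.1 e.2 0) (rowExp G.n e.1 e.2 0) = true ↔
        colPoint G.n e 0 ∈ interior (K e).region)) :
    coverWord G.enc (encList BoxCode.enc L) = encSubset {v : Fin G.n | v.1 ∈
      (edges G.enc G.n).toFinset.image fun e => chosen G.n (interior (K e).region) e} := by
  have hiff : ∀ v : Fin G.n, (List.range G.n).any (fun i => (List.range G.n).any fun j =>
      isEdge G.enc G.n i j && isChosen (encList BoxCode.enc L) G.n i j v.1) = true ↔
      v ∈ {v : Fin G.n | v.1 ∈
        (edges G.enc G.n).toFinset.image fun e => chosen G.n (interior (K e).region) e} := by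
    intro v
    have hch : ∀ e ∈ edges G.enc G.n, (isChosen (encList BoxCode.enc L) G.n e.1 e.2 v.1 = true ↔
        chosen G.n (interior (K e).region) e = v.1) := by
      intro e he
      have h := hK e he
      simp only [rowExp] at h
      unfold isChosen chosen
      split_ifs with h'
      · simp [h.2 h']
      · simp [Bool.eq_false_iff.2 (mt h.1 h')]
    simp only [List.any_eq_true, List.mem_range, Bool.and_eq_true,
      Set.mem_ofPred_eq, Finset.mem_image, List.mem_toFinset]
    constructor
    · rintro ⟨i, hi, j, hj, he, hc⟩
      have hmem : (i, j) ∈ edges G.enc G.n := mem_edges.2 ⟨⟨hi, hj⟩, he⟩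
      exact ⟨_, hmem, (hch _ hmem).1 hc⟩
    · rintro ⟨e, he, hc⟩
      obtain ⟨⟨hi, hj⟩, he'⟩ := mem_edges.1 he
      exact ⟨e.1, hi, e.2, hj, he', (hch e he).2 hc⟩
  have hrange : ∀ g : ℕ → List Γ', (List.range G.n).flatMap g =
      (List.finRange G.n).flatMap fun v => g v.1 := fun g => by
    rw [← List.map_coe_finRange_eq_range, List.flatMap_map]
  unfold coverWord encSubset
  rw [count_comma_enc, hrange, List.map_eq_flatMap]
  congr 1
  funext v
  by_cases h : v ∈ {v : Fin G.n | v.1 ∈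
      (edges G.enc G.n).toFinset.image fun e => chosen G.n (interior (K e).region) e}
  · rw [(hiff v).2 h]
    exact congrArg (fun b => [Γ'.bit b]) (@decide_eq_true _ (_) h).symm
  · rw [Bool.eq_false_iff.2 (mt (hiff v).1 h)]
    exact congrArg (fun b => [Γ'.bit b]) (@decide_eq_false _ (_) h).symm

theorem exists_vertexCover {𝒦 : Set (Set (ℝ × ℝ))} (h𝒦 : StripClass 𝒦) (G : FinGraph)
    {L : List BoxCode} (hL : IsClassCover 𝒦 G.gadget (regions L)) :
    ∃ C : Set (Fin G.n), coverWord G.enc (encList BoxCode.enc L) = encSubset C ∧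
      G.graph.IsVertexCover C ∧
      C.ncard + (edges G.enc G.n).length ≤ (regions L).ncard := by
  classical
  have hl := isEdgeList_edges G.enc G.n
  have hex : ∀ e ∈ edges G.enc G.n, ∃ K ∈ L, colPoint G.n e 3 ∈ interior K.region ∧
      (firstCovers (encList BoxCode.enc L) (xExp G.n e.1 e.2 3) (rowExp G.n e.1 e.2 3)
        (xExp G.n e.1 e.2 0) (rowExp G.n e.1 e.2 0) = true ↔
          colPoint G.n e 0 ∈ interior K.region) := by
    intro e he
    refine exists_firstCovers _ _ ?_
    obtain ⟨Y, ⟨K, hK, rfl⟩, hmem⟩ :=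
      hL.covers_red _ ((mem_gadget_R hl).2 ⟨e, he, 3, by simp, rfl⟩)
    exact ⟨K, hK, hmem⟩
  have : Nonempty BoxCode := ⟨⟨none, none, none, none⟩⟩
  choose! K hKL hK3 hK0 using hex
  refine ⟨_, coverWord_eq hK0, ?_, ?_⟩
  · have key : ∀ u v, u < v → G.graph.Adj u v → ∀ C : Set (Fin G.n), (∀ x : Fin G.n,
        x.1 = chosen G.n (interior (K (u.1, v.1)).region) (u.1, v.1) → x ∈ C) → u ∈ C ∨ v ∈ C := by
      intro u v _ _ C hC
      by_cases h : colPoint G.n (u.1, v.1) 0 ∈ interior (K (u.1, v.1)).region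
      · exact .inr (hC v (if_pos h).symm)
      · exact .inl (hC u (if_neg h).symm)
    intro u v hadj
    obtain huv | huv := lt_or_gt_of_ne hadj.ne
    · refine key u v huv hadj _ fun x hx => ?_
      rw [Set.mem_ofPred_eq, hx]
      exact Finset.mem_image_of_mem _
        (List.mem_toFinset.2 ((mem_edges_enc G).2 ⟨u, v, huv, hadj, rfl⟩))
    · refine (key v u huv hadj.symm _ fun x hx => ?_).symm
      rw [Set.mem_ofPred_eq, hx]
      exact Finset.mem_image_of_mem _
        (List.mem_toFinset.2 ((mem_edges_enc G).2 ⟨v, u, huv, hadj.symm, rfl⟩))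
  · refine le_trans (Nat.add_le_add_right ?_ _)
      (card_chosen_add_length_le h𝒦 hl hL (K := fun e => (K e).region)
        (fun e he => ⟨K e, hKL e he, rfl⟩) hK3)
    rw [← Set.ncard_coe_finset]
    exact Set.ncard_le_ncard_of_injOn Fin.val (fun v hv => hv) Fin.val_injective.injOn

/-- The gadget is in general position and always has a class cover, obtained from the set of all
vertices, so it is an admissible instance for any `P` implied by general position. -/
theorem vertexCoverApproximable {𝒦 : Set (Set (ℝ × ℝ))}
    (h𝒦 : StripClass 𝒦) {P : BichromaticSet → Prop}
    (hP : ∀ S : BichromaticSet, S.GeneralPosition → P S) {ε : ℝ} (hε : 0 < ε) (d : ℕ)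
    (h : ClassCoverApproximable 𝒦 P (1 + ε)) : VertexCoverApproximable d (1 + (d + 1) * ε) := by
  obtain ⟨f, ⟨T⟩, hf⟩ := h
  have hex : ∀ G : FinGraph, ∃ Z, IsClassCover 𝒦 G.gadget Z := fun G => by
    obtain ⟨Z, hZ, -⟩ := exists_classCover_of_isVertexCover h𝒦 G (C := Set.univ)
      fun _ _ _ => .inl trivial
    exact ⟨Z, hZ⟩
  let inst : {G : FinGraph // G.MaxDegreeLE d} →
      {S : BichromaticSet // P S ∧ ∃ Z, IsClassCover 𝒦 S Z} := fun G =>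
    ⟨G.1.gadget, hP _ (gadget_generalPosition _), hex G.1⟩
  refine ⟨fun G => coverWord G.1.enc (f (inst G)), PT.computable (A := T.toTM2ComputableAux) ?_, ?_⟩
  · let _ : Ctx {G : FinGraph // G.MaxDegreeLE d} := ⟨1, fun G => [G.1.enc], fun _ => rfl⟩
    have henc : PT T.toTM2ComputableAux fun G : {G : FinGraph // G.MaxDegreeLE d} => G.1.enc :=
      PT.of_regs PT.id rfl fun _ => rfl
    refine PT.coverWord henc (PT.oracle T (h := inst) ?_)
    exact (PT.reductionWord.comp henc).of_eq fun G => (enc_gadget G.1).symm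
  · intro G
    obtain ⟨L, hL, hcov, hopt⟩ := hf (inst G)
    obtain ⟨C, hC, hvc, hcard⟩ := exists_vertexCover h𝒦 G.1 hcov
    refine ⟨C, by rw [← hC, ← hL], hvc, fun C' hC' => ?_⟩
    obtain ⟨Z, hZ, hZcard⟩ := exists_classCover_of_isVertexCover h𝒦 G.1 hC'
    have h1 := hopt Z hZ
    have h2 := length_edges_le G.2 hC'
    generalize (edges G.1.enc G.1.n).length = m at *
    have h3 : (C.ncard : ℝ) + m ≤ (regions L).ncard := by exact_mod_cast hcard
    have h4 : (Z.ncard : ℝ) ≤ C'.ncard + m := by exact_mod_cast hZcard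
    have h5 : (m : ℝ) ≤ d * C'.ncard := by exact_mod_cast h2
    have h6 := mul_le_mul_of_nonneg_left h4 (show 0 ≤ 1 + ε by linarith)
    have h7 := mul_le_mul_of_nonneg_left h5 hε.le
    -- Here `|C| + m ≤ (1 + ε) * (|C'| + m)` and `m ≤ d * |C'|`: the `m` without the factor `ε`
    -- cancels, and `ε * m ≤ ε * d * |C'|` remains.
    nlinarith

end ClassCover

theorem mainTheorem1 (ε : ℝ) (hε : 0 < ε) (d : ℕ) :
    -- axis-aligned boxes, all point sets
    (ClassCover.ClassCoverApproximable ClassCover.boxes (fun _ => True) (1 + ε) →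
      ClassCover.VertexCoverApproximable d (1 + (d + 1) * ε)) ∧
    -- axis-aligned boxes, point sets in general position
    (ClassCover.ClassCoverApproximable ClassCover.boxes
        ClassCover.BichromaticSet.GeneralPosition (1 + ε) →
      ClassCover.VertexCoverApproximable d (1 + (d + 1) * ε)) ∧
    -- axis-aligned half-strips, all point sets
    (ClassCover.ClassCoverApproximable ClassCover.halfStrips (fun _ => True) (1 + ε) →
      ClassCover.VertexCoverApproximable d (1 + (d + 1) * ε)) ∧
    -- axis-aligned half-strips, point sets in general position
    (ClassCover.ClassCoverApproximable ClassCover.halfStrips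
        ClassCover.BichromaticSet.GeneralPosition (1 + ε) →
      ClassCover.VertexCoverApproximable d (1 + (d + 1) * ε)) := by
  have hP : ∀ S : ClassCover.BichromaticSet, S.GeneralPosition → True := fun _ _ => trivial
  exact ⟨ClassCover.vertexCoverApproximable ClassCover.stripClass_boxes hP hε d,
    ClassCover.vertexCoverApproximable ClassCover.stripClass_boxes (fun _ => id) hε d,
    ClassCover.vertexCoverApproximable ClassCover.stripClass_halfStrips hP hε d,
    ClassCover.vertexCoverApproximable ClassCover.stripClass_halfStrips (fun _ => id) hε d⟩
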